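/- **Setting (switching between models).** An agent repeatedly chooses actions $a_t$ from a finite set $\mathcal A$ and observes outcomes $y_t$ drawn independently from $q^*(\cdot|a_t)$, with payoff $u(a_t,y_t)$, discount factor $\delta\in[0,1)$ and switching threshold $\alpha>1$. A subjective model $\theta$ is a finite nonempty parameter set $\Omega^\theta$ in a Euclidean space with positive outcome densities $q^\theta(\cdot|a,\omega)$ (with respect to the same dominating measure as $q^*$) under which $u(a,\cdot)$ is integrable and such that $|\ln (q^*(\cdot|a)/q^\theta(\cdot|a,\omega))|$ is dominated by a function in $L^2(q^*(\cdot|a))$; $\Theta$ is the set of all such models. Given a full-support prior on $\Omega^\theta$, an optimal policy maps each belief on $\Omega^\theta$ to an action solving the discounted dynamic programming problem of an agent who believes in $\theta$ and updates by Bayes' rule. A switcher starts with the initial model $\theta$ and entertains a competing model $\theta^c$; in each period $t\ge1$ she switches to the other model if and only if the ratio of its likelihood for the history (averaged over its prior) to the likelihood of the current model exceeds $\alpha$; she then applies the policy of the adopted model to its posterior given the full history. $\theta$ *persists* against $\theta^c$ at given priors and policies if with positive probability the model choice is eventually always $\theta$. $\theta$ is *globally robust* if for some full-support prior and some optimal policy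 it persists against every $\theta^c\in\Theta$ at every full-support prior and every optimal policy of $\theta^c$. Given densities $q(\cdot|a,\omega)$, $\omega\in\Omega^q$, the $q$-family $\Theta^q$ is the set of models in $\Theta$ with $\Omega^\theta\subseteq\Omega^q$ and $q^\theta=q$. $\theta\in\Theta^q$ is *$q$-constrained locally robust* if there are $\varepsilon>0$, a full-support prior $\pi_0^\theta$ and an optimal policy at which $\theta$ persists against every $\theta^c\in\Theta^q$ with Hausdorff distance $d_H(\Omega^\theta,\Omega^{\theta^c})\le\varepsilon$, at every full-support prior of $\theta^c$ within Prokhorov distance $\varepsilon$ of $\pi_0^\theta$ and every optimal policy of $\theta^c$. **Setting (effort choice).** $\mathcal A\subset\mathbb R$ is finite and nonempty, $u(a,y)=y$, and $y_t=g(a_t,b^*,\omega^*)+\eta_t$ with $\eta_t$ i.i.d. normal with mean zero and known positive variance, where $b^*\in[\underline b,\overline b]$ is the agent's ability and $\omega^*\in[\underline\omega,\overline\omega]$ the teammate's. The function $g$ is twice continuously differentiable and strictly increasing in $b$ and in $\omega$, with $g_{aa}<0$, $g_{ab}\le0$, $g_{a\omega}>0$, and for all $a\in\mathcal A$ and $b\in[\underline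 b,\overline b]$ there is $\omega\in[\underline\omega,\overline\omega]$ with $g(a,b,\omega)=g(a,b^*,\omega^*)$. Let $q(\cdot|a,b,\omega)$ be the normal density of $g(a,b,\omega)+\eta$ and $\Omega^q=[\underline b,\overline b]\times[\underline\omega,\overline\omega]$. A model with self-perception $\hat b$ is the model in $\Theta^q$ with parameter set $\{\hat b\}\times W$ for a finite $W\subset[\underline\omega,\overline\omega]$; as an initial model it is assumed that $W$ contains every $\hat\omega\in[\underline\omega,\overline\omega]$ with $g(a,\hat b,\hat\omega)=g(a,b^*,\omega^*)$ for some $a\in\mathcal A$. **Proposition.** There is a finite strictly decreasing sequence $\beta_1>\beta_2>\dots>\beta_N$, $N\ge1$, with $\beta_1<b^*$ and $\beta_N\le\underline b$, such that for every finite set $\mathcal B\subseteq[\underline b,\overline b]$, every $\hat b\in\mathcal B$ and every initial model $\theta$ with self-perception $\hat b$: 1. if $\hat b>\beta_1$ (overconfidence or mild underconfidence), then $\theta$ is globally robust; 2. if $\hat b\in(\beta_{2k},\beta_{2k-1})$ for some $k\ge1$ with $2k\le N$, then $\theta$ is not $q$-constrained locally robust; moreover, for every $\tilde b\in\mathcal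 B\cap(\hat b,b^*]$ there is a model $\theta^c\in\Theta^q$ with self-perception $\tilde b$ against which $\theta$ does not persist, at any full-support priors and optimal policies of $\theta$ and $\theta^c$; 3. if $\hat b\in(\beta_{2k+1},\beta_{2k})$ for some $k\ge1$ with $2k+1\le N$, then $\theta$ is globally robust. -/

import Mathlib

open MeasureTheory ProbabilityTheory Set Filter
open scoped NNReal ENNReal

noncomputable section

namespace ModelSwitching

/-! ### The decision environment -/

/-- A repeated decision problem: dominating measure `ν`, density `qstar a` of the true outcome
distribution at the action `a`, flow payoff `u`, discount factor `δ`, switching threshold `α`. -/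
structure Environment (𝓐 𝓨 : Type) [MeasurableSpace 𝓨] where
  ν : Measure 𝓨
  qstar : 𝓐 → 𝓨 → ℝ
  u : 𝓐 → 𝓨 → ℝ
  δ : ℝ
  α : ℝ
  qstar_measurable : ∀ a, Measurable (qstar a)
  qstar_pos : ∀ a y, 0 < qstar a y
  qstar_lintegral : ∀ a, ∫⁻ y, ENNReal.ofReal (qstar a y) ∂ν = 1
  u_integrable : ∀ a, Integrable (u a) (ν.withDensity fun y => ENNReal.ofReal (qstar a y))
  δ_nonneg : 0 ≤ δ
  δ_lt_one : δ < 1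
  one_lt_α : 1 < α

/-- The raw data of a subjective model: a finite set `Ω` of parameters in a Euclidean space and
outcome densities `q a ω` (only the values at `ω ∈ Ω` matter). -/
structure Model (𝓐 𝓨 : Type) (d : ℕ) where
  Ω : Finset (EuclideanSpace ℝ (Fin d))
  q : 𝓐 → EuclideanSpace ℝ (Fin d) → 𝓨 → ℝ

variable {𝓐 𝓨 : Type} [MeasurableSpace 𝓨] {d d' : ℕ}

/-- The true outcome distribution at `a`. -/
def Environment.Qstar (E : Environment 𝓐 𝓨) (a : 𝓐) : Measure 𝓨 :=
  E.ν.withDensity fun y => ENNReal.ofReal (E.qstar a y)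

/-- The outcome distribution at `a` under the parameter `ω` of a model. -/
def Model.Q (E : Environment 𝓐 𝓨) (θ : Model 𝓐 𝓨 d) (a : 𝓐)
    (ω : EuclideanSpace ℝ (Fin d)) : Measure 𝓨 :=
  E.ν.withDensity fun y => ENNReal.ofReal (θ.q a ω y)

/-- Membership in the class `Θ` of all subjective models for the environment `E`. -/
structure Model.Admissible (E : Environment 𝓐 𝓨) (θ : Model 𝓐 𝓨 d) : Prop where
  nonempty : θ.Ω.Nonempty
  measurable : ∀ a, ∀ ω ∈ θ.Ω, Measurable (θ.q a ω)
  pos : ∀ a, ∀ ω ∈ θ.Ω, ∀ y, 0 < θ.q a ω y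
  lintegral : ∀ a, ∀ ω ∈ θ.Ω, ∫⁻ y, ENNReal.ofReal (θ.q a ω y) ∂E.ν = 1
  u_integrable : ∀ a, ∀ ω ∈ θ.Ω, Integrable (E.u a) (θ.Q E a ω)
  log_ratio : ∀ a, ∀ ω ∈ θ.Ω, ∃ G : 𝓨 → ℝ, MemLp G 2 (E.Qstar a) ∧
    ∀ᵐ y ∂(E.Qstar a), |Real.log (E.qstar a y / θ.q a ω y)| ≤ G y

/-! ### Beliefs and optimal policies

Beliefs on the parameters of `θ` are the points of `stdSimplex ℝ θ.Ω`. -/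

/-- A full-support belief. -/
def IsFullSupport (θ : Model 𝓐 𝓨 d) (π : θ.Ω → ℝ) : Prop :=
  π ∈ stdSimplex ℝ θ.Ω ∧ ∀ ω, 0 < π ω

/-- The Bayesian operator: the posterior after the action `a` and the outcome `y`. -/
def bayes (θ : Model 𝓐 𝓨 d) (a : 𝓐) (y : 𝓨) (π : θ.Ω → ℝ) : θ.Ω → ℝ :=
  fun ω => π ω * θ.q a ω y / ∑ ω', π ω' * θ.q a ω' y

/-- Subjective expected discounted payoff of the action `a` at the belief `π`, with continuation
value `U`. -/
def actionValue (E : Environment 𝓐 𝓨) (θ : Model 𝓐 𝓨 d) (U : (θ.Ω → ℝ) → ℝ)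
    (π : θ.Ω → ℝ) (a : 𝓐) : ℝ :=
  ∑ ω, π ω * ∫ y, (E.u a y + E.δ * U (bayes θ a y π)) * θ.q a ω y ∂E.ν

/-- `U` is the value function of the dynamic programming problem: the bounded measurable solution
of the Bellman equation on the simplex of beliefs. -/
def IsValueFunction (E : Environment 𝓐 𝓨) (θ : Model 𝓐 𝓨 d) (U : (θ.Ω → ℝ) → ℝ) : Prop :=
  Measurable U ∧ (∃ C, ∀ π ∈ stdSimplex ℝ θ.Ω, |U π| ≤ C) ∧
    ∀ π ∈ stdSimplex ℝ θ.Ω, IsGreatest (range (actionValue E θ U π)) (U π)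

/-- A (measurable) pure policy that picks an optimal action at every belief. -/
def IsOptimalPolicy (E : Environment 𝓐 𝓨) (θ : Model 𝓐 𝓨 d) (p : (θ.Ω → ℝ) → 𝓐) : Prop :=
  (∀ a, MeasurableSet {π | p π = a}) ∧
    ∃ U, IsValueFunction E θ U ∧ ∀ π ∈ stdSimplex ℝ θ.Ω, actionValue E θ U π (p π) = U π

/-! ### The switcher

A finite history is the list of past pairs (action, outcome), the most recent pair first. -/

/-- The likelihood of a history under `θ`, evaluated at the prior `π₀`. -/
def likelihood (θ : Model 𝓐 𝓨 d) (π₀ : θ.Ω → ℝ) (h : List (𝓐 × 𝓨)) : ℝ :=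
  ∑ ω, π₀ ω * (h.map fun x => θ.q x.1 ω x.2).prod

/-- The posterior after a history. -/
def posterior (θ : Model 𝓐 𝓨 d) (π₀ : θ.Ω → ℝ) : List (𝓐 × 𝓨) → (θ.Ω → ℝ)
  | [] => π₀
  | x :: h => bayes θ x.1 x.2 (posterior θ π₀ h)

/-- The label of the model that the switcher adopts. -/
inductive Label where
  | initial
  | competing

open Classical in
/-- The model choice of a switcher with initial model `θ` and competing model `θc` after a
history. The Bayes factor of the currently adopted model is `1 < α`, so a switch occurs exactly
when the Bayes factor of the other model exceeds `α`. -/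
def modelChoice (α : ℝ) (θ : Model 𝓐 𝓨 d) (π₀ : θ.Ω → ℝ) (θc : Model 𝓐 𝓨 d')
    (πc : θc.Ω → ℝ) : List (𝓐 × 𝓨) → Label
  | [] => Label.initial
  | x :: h =>
    match modelChoice α θ π₀ θc πc h with
    | Label.initial =>
      if likelihood θc πc (x :: h) / likelihood θ π₀ (x :: h) > α
      then Label.competing else Label.initial
    | Label.competing =>
      if likelihood θ π₀ (x :: h) / likelihood θc πc (x :: h) > α
      then Label.initial else Label.competing

/-- The action of the switcher after a history: the policy of the adopted model, applied to the
posterior of that model given the full history. -/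
def switcherAction (α : ℝ) (θ : Model 𝓐 𝓨 d) (π₀ : θ.Ω → ℝ) (p : (θ.Ω → ℝ) → 𝓐)
    (θc : Model 𝓐 𝓨 d') (πc : θc.Ω → ℝ) (pc : (θc.Ω → ℝ) → 𝓐) (h : List (𝓐 × 𝓨)) : 𝓐 :=
  match modelChoice α θ π₀ θc πc h with
  | Label.initial => p (posterior θ π₀ h)
  | Label.competing => pc (posterior θc πc h)

/-- The history of the switcher at the beginning of period `t`, along the sample point `s`, where
`s (t, a)` is the outcome that realizes in period `t` if the action is `a`. -/
def switcherHistory (α : ℝ) (θ : Model 𝓐 𝓨 d) (π₀ : θ.Ω → ℝ) (p : (θ.Ω → ℝ) → 𝓐)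
    (θc : Model 𝓐 𝓨 d') (πc : θc.Ω → ℝ) (pc : (θc.Ω → ℝ) → 𝓐) (s : ℕ × 𝓐 → 𝓨) :
    ℕ → List (𝓐 × 𝓨)
  | 0 => []
  | t + 1 =>
    let h := switcherHistory α θ π₀ p θc πc pc s t
    let a := switcherAction α θ π₀ p θc πc pc h
    (a, s (t, a)) :: h

/-- The law of the outcomes: independent draws from the true distributions. -/
def Environment.pathLaw (E : Environment 𝓐 𝓨) : Measure (ℕ × 𝓐 → 𝓨) :=
  Measure.infinitePi fun i : ℕ × 𝓐 => E.Qstar i.2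

/-- `θ` persists against `θc` at the given priors and policies: with positive probability the
model choice is eventually always the initial model. -/
def Persists (E : Environment 𝓐 𝓨) (θ : Model 𝓐 𝓨 d) (π₀ : θ.Ω → ℝ) (p : (θ.Ω → ℝ) → 𝓐)
    (θc : Model 𝓐 𝓨 d') (πc : θc.Ω → ℝ) (pc : (θc.Ω → ℝ) → 𝓐) : Prop :=
  0 < E.pathLaw {s | ∀ᶠ t in atTop,
    modelChoice E.α θ π₀ θc πc (switcherHistory E.α θ π₀ p θc πc pc s t) = Label.initial}

/-! ### Robustness -/

/-- Global robustness. -/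
def GloballyRobust (E : Environment 𝓐 𝓨) (θ : Model 𝓐 𝓨 d) : Prop :=
  ∃ π₀, IsFullSupport θ π₀ ∧ ∃ p, IsOptimalPolicy E θ p ∧
    ∀ (d' : ℕ) (θc : Model 𝓐 𝓨 d'), θc.Admissible E →
      ∀ πc, IsFullSupport θc πc → ∀ pc, IsOptimalPolicy E θc pc →
        Persists E θ π₀ p θc πc pc

/-- Membership in the `q`-family of models with parameters in `Ωq`. -/
def InFamily (E : Environment 𝓐 𝓨) (Ωq : Set (EuclideanSpace ℝ (Fin d)))
    (q : 𝓐 → EuclideanSpace ℝ (Fin d) → 𝓨 → ℝ) (θ : Model 𝓐 𝓨 d) : Prop :=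
  θ.Admissible E ∧ (θ.Ω : Set (EuclideanSpace ℝ (Fin d))) ⊆ Ωq ∧
    ∀ a, ∀ ω ∈ θ.Ω, θ.q a ω = q a ω

/-- A belief on the parameters of `θ` as a measure on the ambient Euclidean space. -/
def beliefMeasure (θ : Model 𝓐 𝓨 d) (π : θ.Ω → ℝ) : Measure (EuclideanSpace ℝ (Fin d)) :=
  ∑ ω, ENNReal.ofReal (π ω) • Measure.dirac (ω : EuclideanSpace ℝ (Fin d))

/-- `q`-constrained local robustness: persistence against all models of the `q`-family whose
parameter set is close in the Hausdorff distance, at all priors that are close in the Prokhorov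
distance. -/
def LocallyRobust (E : Environment 𝓐 𝓨) (Ωq : Set (EuclideanSpace ℝ (Fin d)))
    (q : 𝓐 → EuclideanSpace ℝ (Fin d) → 𝓨 → ℝ) (θ : Model 𝓐 𝓨 d) : Prop :=
  ∃ ε > 0, ∃ π₀, IsFullSupport θ π₀ ∧ ∃ p, IsOptimalPolicy E θ p ∧
    ∀ θc : Model 𝓐 𝓨 d, InFamily E Ωq q θc →
      Metric.hausdorffDist (θ.Ω : Set (EuclideanSpace ℝ (Fin d))) θc.Ω ≤ ε →
      ∀ πc, IsFullSupport θc πc →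
        levyProkhorovDist (beliefMeasure θ π₀) (beliefMeasure θc πc) ≤ ε →
        ∀ pc, IsOptimalPolicy E θc pc → Persists E θ π₀ p θc πc pc

/-! ### Effort choice with a misperceived own ability -/

/-- Primitives of the effort-choice problem: finite set `A` of effort levels, ranges
`[bLo, bHi]` and `[wLo, wHi]` of the own ability and of the teammate's ability, their true values
`bStar` and `wStar`, mean output `g a b w`, variance `v` of the normal noise, discount factor `δ`,
switching threshold `α`. -/
structure TeamProblem where
  A : Finset ℝ
  A_nonempty : A.Nonempty
  bLo : ℝ
  bHi : ℝ
  wLo : ℝ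
  wHi : ℝ
  bStar : ℝ
  wStar : ℝ
  bStar_mem : bStar ∈ Icc bLo bHi
  wStar_mem : wStar ∈ Icc wLo wHi
  g : ℝ → ℝ → ℝ → ℝ
  v : ℝ≥0
  v_ne_zero : v ≠ 0
  δ : ℝ
  δ_nonneg : 0 ≤ δ
  δ_lt_one : δ < 1
  α : ℝ
  one_lt_α : 1 < α

namespace TeamProblem

variable (P : TeamProblem)

/-- The assumptions on the output function `g`; `a` ranges over the convex hull of the effort
levels. -/
structure Regular : Prop where
  contDiff : ∀ a ∈ convexHull ℝ (P.A : Set ℝ), ∀ b ∈ Icc P.bLo P.bHi, ∀ w ∈ Icc P.wLo P.wHi,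
    ContDiffAt ℝ 2 (fun x : ℝ × ℝ × ℝ => P.g x.1 x.2.1 x.2.2) (a, b, w)
  strictMono_b : ∀ a ∈ convexHull ℝ (P.A : Set ℝ), ∀ w ∈ Icc P.wLo P.wHi,
    StrictMonoOn (fun b => P.g a b w) (Icc P.bLo P.bHi)
  strictMono_w : ∀ a ∈ convexHull ℝ (P.A : Set ℝ), ∀ b ∈ Icc P.bLo P.bHi,
    StrictMonoOn (fun w => P.g a b w) (Icc P.wLo P.wHi)
  exists_fit : ∀ a ∈ P.A, ∀ b ∈ Icc P.bLo P.bHi, ∃ w ∈ Icc P.wLo P.wHi,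
    P.g a b w = P.g a P.bStar P.wStar
  g_aa_neg : ∀ a ∈ convexHull ℝ (P.A : Set ℝ), ∀ b ∈ Icc P.bLo P.bHi, ∀ w ∈ Icc P.wLo P.wHi,
    deriv (fun a₁ => deriv (fun a₂ => P.g a₂ b w) a₁) a < 0
  g_ab_nonpos : ∀ a ∈ convexHull ℝ (P.A : Set ℝ), ∀ b ∈ Icc P.bLo P.bHi,
    ∀ w ∈ Icc P.wLo P.wHi, deriv (fun b₁ => deriv (fun a₂ => P.g a₂ b₁ w) a) b ≤ 0
  g_aw_pos : ∀ a ∈ convexHull ℝ (P.A : Set ℝ), ∀ b ∈ Icc P.bLo P.bHi,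
    ∀ w ∈ Icc P.wLo P.wHi, 0 < deriv (fun w₁ => deriv (fun a₂ => P.g a₂ b w₁) a) w

/-- The density of output at effort `a` under the abilities `(b, w) = (ω 0, ω 1)`. -/
def density (a : P.A) (ω : EuclideanSpace ℝ (Fin 2)) (y : ℝ) : ℝ :=
  gaussianPDFReal (P.g a (ω 0) (ω 1)) P.v y

/-- The environment: normal output around `g a bStar wStar`, and payoff `u (a, y) = y`. -/
def env : Environment P.A ℝ where
  ν := volume
  qstar a := P.density a !₂[P.bStar, P.wStar]
  u _ y := y
  δ := P.δ
  α := P.α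
  qstar_measurable _ := measurable_gaussianPDFReal _ _
  qstar_pos _ _ := gaussianPDFReal_pos _ _ _ P.v_ne_zero
  qstar_lintegral _ := lintegral_gaussianPDFReal_eq_one _ P.v_ne_zero
  u_integrable a := by
    have h := (memLp_id_gaussianReal (μ := P.g a P.bStar P.wStar) (v := P.v) 1).integrable
      (by norm_num)
    rw [gaussianReal_of_var_ne_zero _ P.v_ne_zero] at h
    exact h
  δ_nonneg := P.δ_nonneg
  δ_lt_one := P.δ_lt_one
  one_lt_α := P.one_lt_α

/-- The parameter space of the `q`-family. -/
def paramSpace : Set (EuclideanSpace ℝ (Fin 2)) :=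
  {ω | ω 0 ∈ Icc P.bLo P.bHi ∧ ω 1 ∈ Icc P.wLo P.wHi}

open Classical in
/-- The model with self-perception `b` and set `W` of values for the teammate's ability, with the
augmented parameter set `{b} × W`. -/
def model (b : ℝ) (W : Finset ℝ) : Model P.A ℝ 2 where
  Ω := W.image fun w => !₂[b, w]
  q := P.density

/-- `W` is an admitted parameter space for an initial model with self-perception `b`: a finite
subset of `[wLo, wHi]` with every value that matches the true mean output at some effort. -/
def IsInitialSpace (b : ℝ) (W : Finset ℝ) : Prop :=
  (W : Set ℝ) ⊆ Icc P.wLo P.wHi ∧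
    ∀ a ∈ P.A, ∀ w ∈ Icc P.wLo P.wHi, P.g a b w = P.g a P.bStar P.wStar → w ∈ W

/-- The model with self-perception `b` and parameter space `W` is globally robust. -/
def Robust (b : ℝ) (W : Finset ℝ) : Prop :=
  GloballyRobust P.env (P.model b W)

/-- The model with self-perception `b` and parameter space `W` is `q`-constrained locally robust. -/
def QRobust (b : ℝ) (W : Finset ℝ) : Prop :=
  LocallyRobust P.env P.paramSpace P.density (P.model b W)

/-- `θ` does not persist against `θc`, whatever the full-support priors and optimal policies. -/
def NeverPersists (θ θc : Model P.A ℝ 2) : Prop :=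
  ∀ π₀, IsFullSupport θ π₀ → ∀ p, IsOptimalPolicy P.env θ p →
    ∀ πc, IsFullSupport θc πc → ∀ pc, IsOptimalPolicy P.env θc pc →
      ¬ Persists P.env θ π₀ p θc πc pc

end TeamProblem

end ModelSwitching

end

namespace ModelSwitching

/-! ### A maximal inequality for nonnegative supermartingales -/

/-! Everything rests on one probabilistic fact. Whatever adaptive rule selects the actions, the
likelihood of a model divided by the true likelihood is a nonnegative supermartingale under the true
law, so it ever reaches a level c with probability at most 1/c (`maximal_inequality`,
`Adapted.measure_exists_le`).

Robustness (`globallyRobust_of_fit`). Suppose a parameter ω₀ of θ reproduces the truth at every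
action that is myopically optimal under ω₀. Take a prior concentrated near ω₀. Off a bad event of
probability below one, no competitor gains a factor c < α on the truth and no other parameter of θ
gains a large factor K. Then the posterior stays near ω₀, where optimal policies are myopic
(`exists_myopic_near_vertex`), so the played actions are ones at which ω₀ is exact. Hence θ loses at
most a factor 1 - η against the truth, and no switch ever occurs.

Non-robustness (`neverPersists_of_dominated`). If ω' has smaller Gaussian bias than ω wherever ω is
biased, a small power of their likelihood ratio contracts in mean at each such effort. The ratio
then tends to zero on almost every path where ω is biased infinitely often
(`ae_tendsto_likelihoodRatio`). If θ were kept forever and some ω were biased only finitely often,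
beliefs would concentrate on ω and the effort would settle where ω is exact. That effort must then
be optimal under ω. When no such self-confirming pair exists, all parameters of θ lose to their
dominators and a switch must occur.

Economics. Call an effort a self-confirming at b if it is optimal under the teammate's ability
fitted to the truth at a. Raising b along the fit at a fixed a lowers the returns to effort while
output at a stays pinned. So between two values of b at which a is self-confirming it is so
strictly, and the robustness criterion applies. Below b*, the sets of such b are closed, disjoint
for different efforts, and without isolated points in the interior; one of them reaches up to b*.
Their endpoints are the β's (`exists_alternating`). In the gaps, a larger self-perception up to b*
offers dominating parameters, also arbitrarily close ones (`exists_dominating`,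
`exists_dominating_near`). Above b* the fitted ability increases with effort, and a monotone
argument always yields a strictly self-confirming effort (`hasStrictFit_of_ge`). -/

theorem maximal_inequality {Ω : Type*} {mΩ : MeasurableSpace Ω} (μ : Measure Ω)
    (ℱ : ℕ → MeasurableSpace Ω) (hmono : Monotone ℱ) (hle : ∀ t, ℱ t ≤ mΩ)
    (M : ℕ → Ω → ℝ≥0∞) (hM : ∀ t, Measurable[ℱ t] (M t))
    (hstep : ∀ t B, MeasurableSet[ℱ t] B → ∫⁻ s in B, M (t + 1) s ∂μ ≤ ∫⁻ s in B, M t s ∂μ)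
    (c : ℝ≥0∞) : c * μ {s | ∃ t, c ≤ M t s} ≤ ∫⁻ s, M 0 s ∂μ := by
  -- The paths that have not yet reached the level c by time t.
  let N : ℕ → Set Ω := fun t => {s | ∀ k ≤ t, M k s < c}
  have hbelow : ∀ t, MeasurableSet[ℱ t] {s | M t s < c} := fun t =>
    hM t measurableSet_Iio
  have hNF : ∀ t, MeasurableSet[ℱ t] (N t) := by
    intro t
    have : N t = ⋂ k ∈ Finset.range (t + 1), {s | M k s < c} := by
      ext s; simp [N]
    rw [this]
    refine Finset.measurableSet_biInter _ fun k hk => ?_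
    exact hmono (Nat.lt_succ_iff.1 (Finset.mem_range.1 hk)) _ (hbelow k)
  have hN : ∀ t, MeasurableSet (N t) := fun t => hle t _ (hNF t)
  have hMm : ∀ t, Measurable (M t) := fun t => (hM t).mono (hle t) le_rfl
  have split : ∀ t (S : Set Ω), MeasurableSet S →
      c * μ (S ∩ {s | c ≤ M t s}) + ∫⁻ s in S ∩ {s | M t s < c}, M t s ∂μ
        ≤ ∫⁻ s in S, M t s ∂μ := by
    intro t S hS
    have hm : MeasurableSet {s | M t s < c} := hle t _ (hbelow t)
    rw [← lintegral_inter_add_sdiff (M t) S hm, add_comm]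
    gcongr
    have h1 : S \ {s | M t s < c} = S ∩ {s | c ≤ M t s} := by
      ext s; simp
    rw [h1, ← setLIntegral_const]
    refine setLIntegral_mono (hMm t) fun s hs => hs.2
  -- This is the supermartingale bound for the process stopped at its first passage: stopped paths
  -- are charged c, the others their current value.
  have key : ∀ t, c * μ (N t)ᶜ + ∫⁻ s in N t, M t s ∂μ ≤ ∫⁻ s, M 0 s ∂μ := by
    intro t
    induction t with
    | zero =>
      have := split 0 univ MeasurableSet.univ
      have h0 : N 0 = {s | M 0 s < c} := by ext s; simp [N]
      have h1 : (N 0)ᶜ = {s | c ≤ M 0 s} := by rw [h0]; ext s; simp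
      rw [h1, h0]
      simpa using this
    | succ t ih =>
      have h0 : N (t + 1) = N t ∩ {s | M (t + 1) s < c} := by
        ext s
        simp only [N, mem_ofPred_eq, mem_inter_iff]
        constructor
        · exact fun h => ⟨fun k hk => h k (by omega), h _ le_rfl⟩
        · rintro ⟨h, h'⟩ k hk
          rcases Nat.lt_or_ge t k with h2 | h2
          · obtain rfl : k = t + 1 := by omega
            exact h'
          · exact h k h2
      have h1 : (N (t + 1))ᶜ ⊆ (N t)ᶜ ∪ (N t ∩ {s | c ≤ M (t + 1) s}) := by
        intro s hs
        rw [h0] at hs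
        by_cases h : s ∈ N t
        · refine Or.inr ⟨h, ?_⟩
          by_contra h'
          exact hs ⟨h, by simpa using h'⟩
        · exact Or.inl h
      calc c * μ (N (t + 1))ᶜ + ∫⁻ s in N (t + 1), M (t + 1) s ∂μ
          ≤ c * (μ (N t)ᶜ + μ (N t ∩ {s | c ≤ M (t + 1) s}))
            + ∫⁻ s in N t ∩ {s | M (t + 1) s < c}, M (t + 1) s ∂μ := by
            rw [h0] at *
            gcongr
            exact (measure_mono h1).trans (measure_union_le _ _)
        _ = c * μ (N t)ᶜ + (c * μ (N t ∩ {s | c ≤ M (t + 1) s})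
            + ∫⁻ s in N t ∩ {s | M (t + 1) s < c}, M (t + 1) s ∂μ) := by ring
        _ ≤ c * μ (N t)ᶜ + ∫⁻ s in N t, M t s ∂μ := by
            gcongr
            exact (split (t + 1) (N t) (hN t)).trans (hstep t _ (hNF t))
        _ ≤ _ := ih
  have hU : {s | ∃ t, c ≤ M t s} = ⋃ t, (N t)ᶜ := by
    ext s
    simp only [N, mem_ofPred_eq, mem_iUnion, mem_compl_iff, not_forall, not_lt]
    exact ⟨fun ⟨t, ht⟩ => ⟨t, t, le_rfl, ht⟩, fun ⟨_, k, _, hk⟩ => ⟨k, hk⟩⟩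
  have hmonoN : Monotone fun t => (N t)ᶜ := by
    intro i j hij s hs hs'
    exact hs fun k hk => hs' k (hk.trans hij)
  rw [hU, hmonoN.measure_iUnion, ENNReal.mul_iSup]
  exact iSup_le fun t => le_self_add.trans (key t)

/-! ### Controlled histories -/

variable {𝓐 𝓨 : Type} [MeasurableSpace 𝓨]

/-- The outcomes realized before period `t`. -/
@[reducible] def past (𝓐 : Type) {𝓨 : Type} [MeasurableSpace 𝓨] (t : ℕ) : MeasurableSpace (ℕ × 𝓐 → 𝓨) :=
  ⨆ i ∈ {i : ℕ × 𝓐 | i.1 < t}, MeasurableSpace.comap (fun s => s i) inferInstance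

/-- The history generated by a rule that maps histories to actions. -/
def history (σ : List (𝓐 × 𝓨) → 𝓐) (s : ℕ × 𝓐 → 𝓨) : ℕ → List (𝓐 × 𝓨)
  | 0 => []
  | t + 1 => (σ (history σ s t), s (t, σ (history σ s t))) :: history σ s t

/-- The action in every period is determined measurably by the past outcomes. -/
def Adapted (σ : List (𝓐 × 𝓨) → 𝓐) : Prop :=
  ∀ t a, MeasurableSet[past 𝓐 t] {s | σ (history σ s t) = a}

theorem past_le (t : ℕ) : past 𝓐 t ≤ (inferInstance : MeasurableSpace (ℕ × 𝓐 → 𝓨)) :=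
  iSup₂_le fun i _ => (measurable_pi_apply i).comap_le

theorem past_mono : Monotone (past 𝓐 (𝓨 := 𝓨)) := by
  intro t t' h
  exact biSup_mono fun i (hi : i.1 < t) => (lt_of_lt_of_le hi h : i.1 < t')

theorem measurable_coord_past {t k : ℕ} (h : k < t) (a : 𝓐) :
    Measurable[past 𝓐 t] fun s : ℕ × 𝓐 → 𝓨 => s (k, a) :=
  Measurable.of_comap_le (le_iSup₂_of_le (f := fun (i : ℕ × 𝓐) (_ : i ∈ {i : ℕ × 𝓐 | i.1 < t}) =>
    MeasurableSpace.comap (fun s : ℕ × 𝓐 → 𝓨 => s i) inferInstance) (k, a) h le_rfl)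

theorem measurable_select [Countable 𝓐] {Ω β : Type*} [MeasurableSpace Ω] [MeasurableSpace β]
    {A : Ω → 𝓐} (hA : ∀ a, MeasurableSet {s | A s = a}) {F : 𝓐 → Ω → β}
    (hF : ∀ a, Measurable (F a)) : Measurable fun s => F (A s) s := by
  intro B hB
  have : (fun s => F (A s) s) ⁻¹' B = ⋃ a, {s | A s = a} ∩ F a ⁻¹' B := by
    ext s; simp
  rw [this]
  exact MeasurableSet.iUnion fun a => (hA a).inter (hF a hB)

theorem Environment.isProbabilityMeasure (E : Environment 𝓐 𝓨) (a : 𝓐) :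
    IsProbabilityMeasure (E.Qstar a) :=
  ⟨by rw [Environment.Qstar, withDensity_apply _ MeasurableSet.univ, Measure.restrict_univ,
    E.qstar_lintegral]⟩

theorem Environment.isProbabilityMeasure_pathLaw (E : Environment 𝓐 𝓨) :
    IsProbabilityMeasure E.pathLaw := by
  have := E.isProbabilityMeasure
  unfold Environment.pathLaw
  infer_instance

theorem Environment.lintegral_coord (E : Environment 𝓐 𝓨) (t : ℕ) (a : 𝓐) {f : 𝓨 → ℝ≥0∞}
    (hf : Measurable f) : ∫⁻ s, f (s (t, a)) ∂E.pathLaw = ∫⁻ y, f y ∂E.Qstar a := by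
  have := E.isProbabilityMeasure
  have h := (measurePreserving_eval_infinitePi (fun i : ℕ × 𝓐 => E.Qstar i.2) (t, a))
  exact h.lintegral_comp hf

/-- The coordinates with period index below t and the single coordinate (t, a) are disjoint families
of independent variables. -/
theorem Environment.indep_past (E : Environment 𝓐 𝓨) (t : ℕ) (a : 𝓐) :
    Indep (past 𝓐 t) (MeasurableSpace.comap (fun s : ℕ × 𝓐 → 𝓨 => s (t, a)) inferInstance)
      E.pathLaw := by
  have := E.isProbabilityMeasure
  have hi : iIndep (fun i : ℕ × 𝓐 => MeasurableSpace.comap (fun s : ℕ × 𝓐 → 𝓨 => s i) inferInstance)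
      E.pathLaw :=
    iIndepFun_infinitePi (P := fun i : ℕ × 𝓐 => E.Qstar i.2) (X := fun _ y => y)
      (fun _ => measurable_id)
  have := indep_iSup_of_disjoint (S := {i : ℕ × 𝓐 | i.1 < t}) (T := {(t, a)})
    (fun i => (measurable_pi_apply i).comap_le) hi (by simp)
  simpa [past] using this

/-- One step of a multiplicative process whose factors have conditional mean at most one. -/
theorem Environment.lintegral_step [Fintype 𝓐] (E : Environment 𝓐 𝓨) (t : ℕ)
    {X : (ℕ × 𝓐 → 𝓨) → ℝ≥0∞} (hX : Measurable[past 𝓐 t] X) {A : (ℕ × 𝓐 → 𝓨) → 𝓐}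
    (hA : ∀ a, MeasurableSet[past 𝓐 t] {s | A s = a}) {r : 𝓐 → 𝓨 → ℝ≥0∞}
    (hr : ∀ a, Measurable (r a)) (hr1 : ∀ a, ∫⁻ y, r a y ∂E.Qstar a ≤ 1) :
    ∫⁻ s, r (A s) (s (t, A s)) * X s ∂E.pathLaw ≤ ∫⁻ s, X s ∂E.pathLaw := by
  classical
  have hXm : Measurable X := hX.mono (past_le t) le_rfl
  have hAm : ∀ a, MeasurableSet {s | A s = a} := fun a => past_le t _ (hA a)
  -- Splitting over the finitely many values of the past-measurable action makes the fresh outcome a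
  -- fixed coordinate, independent of the rest of each term.
  have h1 : ∀ s, r (A s) (s (t, A s)) * X s
      = ∑ a, ({s | A s = a}.indicator X s) * r a (s (t, a)) := by
    intro s
    rw [Finset.sum_eq_single (A s)]
    · simp [mul_comm]
    · intro b _ hb
      simp [indicator, hb.symm]
    · simp
  have h2 : ∀ s, X s = ∑ a, {s | A s = a}.indicator X s := by
    intro s
    rw [Finset.sum_eq_single (A s)]
    · simp
    · intro b _ hb
      simp [indicator, hb.symm]
    · simp
  have hm : ∀ a, Measurable fun s : ℕ × 𝓐 → 𝓨 => r a (s (t, a)) := fun a =>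
    (hr a).comp (measurable_pi_apply _)
  calc ∫⁻ s, r (A s) (s (t, A s)) * X s ∂E.pathLaw
      = ∑ a, ∫⁻ s, ({s | A s = a}.indicator X s) * r a (s (t, a)) ∂E.pathLaw := by
        simp_rw [h1]
        exact lintegral_finsetSum _ fun a _ => (hXm.indicator (hAm a)).mul (hm a)
    _ ≤ ∑ a, ∫⁻ s, {s | A s = a}.indicator X s ∂E.pathLaw := by
        refine Finset.sum_le_sum fun a _ => ?_
        have h3 := lintegral_mul_eq_lintegral_mul_lintegral_of_independent_measurableSpace
          (past_le t) (measurable_pi_apply (t, a)).comap_le (E.indep_past t a)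
          (f := {s | A s = a}.indicator X) (g := fun s => r a (s (t, a)))
          (Measurable.indicator (m := past 𝓐 t) hX (hA a))
          ((hr a).comp (comap_measurable _))
        rw [h3, E.lintegral_coord t a (hr a)]
        exact mul_le_of_le_one_right' (hr1 a)
    _ = ∫⁻ s, X s ∂E.pathLaw := by
        rw [← lintegral_finsetSum _ fun a _ => hXm.indicator (hAm a)]
        simp_rw [← h2]

/-- The product of the factors `r` along a history. -/
def histProd {𝓐 𝓨 M : Type*} [Mul M] [One M] (r : 𝓐 → 𝓨 → M) (h : List (𝓐 × 𝓨)) : M :=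
  (h.map fun x => r x.1 x.2).prod

@[simp] theorem histProd_nil {𝓐 𝓨 M : Type*} [Mul M] [One M] (r : 𝓐 → 𝓨 → M) :
    histProd r [] = 1 := rfl

@[simp] theorem histProd_cons {𝓐 𝓨 M : Type*} [Mul M] [One M] (r : 𝓐 → 𝓨 → M) (x : 𝓐 × 𝓨) (h) :
    histProd r (x :: h) = r x.1 x.2 * histProd r h := by
  simp [histProd]

theorem Adapted.measurable_histProd [Fintype 𝓐] {σ : List (𝓐 × 𝓨) → 𝓐} {t : ℕ}
    (hσ : ∀ k < t, ∀ a, MeasurableSet[past 𝓐 k] {s | σ (history σ s k) = a})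
    {M : Type*} [MeasurableSpace M] [Mul M] [One M] [MeasurableMul₂ M]
    {r : 𝓐 → 𝓨 → M} (hr : ∀ a, Measurable (r a)) :
    Measurable[past 𝓐 t] fun s => histProd r (history σ s t) := by
  induction t with
  | zero => simp [history]
  | succ t ih =>
    have h1 := (ih fun k hk => hσ k (by omega)).mono (past_mono t.le_succ) le_rfl
    have h2 := @measurable_select 𝓐 _ _ _ (past 𝓐 (t + 1)) _ (fun s => σ (history σ s t))
      (fun a => past_mono t.le_succ _ (hσ t (by omega) a)) (fun a s => r a (s (t, a)))
      (fun a => (hr a).comp (measurable_coord_past (Nat.lt_succ_self t) a))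
    simp only [history, histProd_cons]
    exact Measurable.mul (m := past 𝓐 (t + 1)) h2 h1

/-- The maximal inequality for a mixture of multiplicative processes. -/
theorem Adapted.measure_exists_le [Fintype 𝓐] {E : Environment 𝓐 𝓨} {σ : List (𝓐 × 𝓨) → 𝓐}
    (hσ : Adapted σ) {ι : Type*} [Fintype ι] (p : ι → ℝ≥0∞) (r : ι → 𝓐 → 𝓨 → ℝ≥0∞)
    (hr : ∀ i a, Measurable (r i a)) (hr1 : ∀ i a, ∫⁻ y, r i a y ∂E.Qstar a ≤ 1) (c : ℝ≥0∞) :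
    c * E.pathLaw {s | ∃ t, c ≤ ∑ i, p i * histProd (r i) (history σ s t)} ≤ ∑ i, p i := by
  have := E.isProbabilityMeasure_pathLaw
  have hm : ∀ i t, Measurable[past 𝓐 t] fun s => histProd (r i) (history σ s t) := fun i t =>
    Adapted.measurable_histProd (fun k _ => hσ k) (hr i)
  have hm' : ∀ i t, Measurable fun s => histProd (r i) (history σ s t) := fun i t =>
    (hm i t).mono (past_le t) le_rfl
  refine (maximal_inequality E.pathLaw (past 𝓐) past_mono past_le
    (fun t s => ∑ i, p i * histProd (r i) (history σ s t)) ?_ ?_ c).trans ?_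
  · intro t
    exact Finset.measurable_fun_sum (m := past 𝓐 t) _ fun i _ =>
      Measurable.const_mul (m := past 𝓐 t) (hm i t) (p i)
  · intro t B hB
    have hBm := past_le t _ hB
    rw [lintegral_finsetSum _ fun i _ => (hm' i _).const_mul _,
      lintegral_finsetSum _ fun i _ => (hm' i _).const_mul _]
    refine Finset.sum_le_sum fun i _ => ?_
    rw [lintegral_const_mul _ (hm' i _), lintegral_const_mul _ (hm' i _)]
    refine mul_le_mul_right ?_ (p i)
    rw [← lintegral_indicator hBm, ← lintegral_indicator hBm (fun s => histProd (r i) (history σ s t))]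
    refine le_trans (le_of_eq ?_) (E.lintegral_step t
      (Measurable.indicator (m := past 𝓐 t) (hm i t) hB) (hσ t) (hr i) (hr1 i))
    refine lintegral_congr fun s => ?_
    by_cases h : s ∈ B <;> simp [h, history]
  · simp [history]

/-- By the maximal inequality the process reaches n with probability at most 1/n, so the event of
being unbounded is null. -/
theorem Adapted.ae_exists_bound [Fintype 𝓐] {E : Environment 𝓐 𝓨} {σ : List (𝓐 × 𝓨) → 𝓐}
    (hσ : Adapted σ) (r : 𝓐 → 𝓨 → ℝ≥0∞)
    (hr : ∀ a, Measurable (r a)) (hr1 : ∀ a, ∫⁻ y, r a y ∂E.Qstar a ≤ 1) :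
    ∀ᵐ s ∂E.pathLaw, ∃ C : ℝ≥0, ∀ t, histProd r (history σ s t) ≤ C := by
  have h : ∀ n : ℕ, (n : ℝ≥0∞) * E.pathLaw {s | ¬ ∃ C : ℝ≥0, ∀ t, histProd r (history σ s t) ≤ C}
      ≤ 1 := by
    intro n
    have := hσ.measure_exists_le (E := E) (ι := Unit) (fun _ => 1) (fun _ => r) (fun _ => hr)
      (fun _ => hr1) n
    simp only [Finset.univ_unique, Finset.sum_const, Finset.card_singleton, one_smul, one_mul]
      at this
    refine le_trans ?_ this
    gcongr
    intro hs
    by_contra hcon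
    push Not at hcon
    exact hs ⟨n, fun t => by simpa using (hcon t).le⟩
  rw [ae_iff]
  by_contra hne
  obtain ⟨n, hn⟩ := ENNReal.exists_nat_mul_gt hne ENNReal.one_ne_top
  exact absurd (h n) (not_le.2 hn)

/-! ### The dynamic programming problem -/

variable {d : ℕ}

/-- The expected flow payoff of the action `a` under the parameter `ω`. -/
noncomputable def meanPayoff (E : Environment 𝓐 𝓨) (θ : Model 𝓐 𝓨 d) (a : 𝓐)
    (ω : EuclideanSpace ℝ (Fin d)) : ℝ :=
  ∫ y, E.u a y * θ.q a ω y ∂E.ν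

namespace Model.Admissible

variable {E : Environment 𝓐 𝓨} {θ : Model 𝓐 𝓨 d}

theorem integrable_density (hθ : θ.Admissible E) (a : 𝓐) (ω : θ.Ω) :
    Integrable (θ.q a ω) E.ν := by
  refine ⟨(hθ.measurable a ω ω.2).aestronglyMeasurable, ?_⟩
  rw [hasFiniteIntegral_iff_ofReal (ae_of_all _ fun y => (hθ.pos a ω ω.2 y).le),
    hθ.lintegral a ω ω.2]
  exact ENNReal.one_lt_top

theorem integral_density (hθ : θ.Admissible E) (a : 𝓐) (ω : θ.Ω) :
    ∫ y, θ.q a ω y ∂E.ν = 1 := by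
  rw [integral_eq_lintegral_of_nonneg_ae (ae_of_all _ fun y => (hθ.pos a ω ω.2 y).le)
    (hθ.measurable a ω ω.2).aestronglyMeasurable, hθ.lintegral a ω ω.2]
  simp

theorem integrable_payoff (hθ : θ.Admissible E) (a : 𝓐) (ω : θ.Ω) :
    Integrable (fun y => E.u a y * θ.q a ω y) E.ν := by
  have h := hθ.u_integrable a ω ω.2
  rw [Model.Q, integrable_withDensity_iff (hθ.measurable a ω ω.2).ennreal_ofReal
    (ae_of_all _ fun _ => ENNReal.ofReal_lt_top)] at h
  refine h.congr (ae_of_all _ fun y => ?_)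
  simp [ENNReal.toReal_ofReal (hθ.pos a ω ω.2 y).le]

theorem sum_pos (hθ : θ.Admissible E) {π : θ.Ω → ℝ} (hπ : π ∈ stdSimplex ℝ θ.Ω) (a : 𝓐) (y : 𝓨) :
    0 < ∑ ω', π ω' * θ.q a ω' y := by
  have h0 : ∀ ω, 0 ≤ π ω * θ.q a ω y := fun ω => mul_nonneg (hπ.1 ω) (hθ.pos a ω ω.2 y).le
  refine (Finset.sum_nonneg fun ω _ => h0 ω).lt_of_ne' fun h => ?_
  have h1 := (Finset.sum_eq_zero_iff_of_nonneg fun ω _ => h0 ω).1 h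
  have h2 : ∑ ω, π ω = 0 := Finset.sum_eq_zero fun ω hω =>
    (mul_eq_zero.1 (h1 ω hω)).resolve_right (hθ.pos a ω ω.2 y).ne'
  rw [hπ.2] at h2
  exact one_ne_zero h2

theorem bayes_mem (hθ : θ.Admissible E) {π : θ.Ω → ℝ} (hπ : π ∈ stdSimplex ℝ θ.Ω) (a : 𝓐)
    (y : 𝓨) : bayes θ a y π ∈ stdSimplex ℝ θ.Ω := by
  refine ⟨fun ω => div_nonneg (mul_nonneg (hπ.1 ω) (hθ.pos a ω ω.2 y).le)
    (hθ.sum_pos hπ a y).le, ?_⟩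
  simp only [bayes]
  rw [← Finset.sum_div, div_self (hθ.sum_pos hπ a y).ne']

theorem measurable_bayes (hθ : θ.Admissible E) (a : 𝓐) (π : θ.Ω → ℝ) :
    Measurable fun y => bayes θ a y π := by
  refine measurable_pi_lambda _ fun ω => ?_
  have := fun ω : θ.Ω => hθ.measurable a ω ω.2
  unfold bayes
  fun_prop

theorem continuousOn_bayes (hθ : θ.Admissible E) (a : 𝓐) (y : 𝓨) :
    ContinuousOn (bayes θ a y) (stdSimplex ℝ θ.Ω) := by
  refine continuousOn_pi.2 fun ω => ?_
  refine ContinuousOn.div (by fun_prop) (by fun_prop) fun π hπ => (hθ.sum_pos hπ a y).ne'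

theorem integrable_continuation (hθ : θ.Admissible E) {U : (θ.Ω → ℝ) → ℝ} (hU : Measurable U)
    {C : ℝ} (hC : ∀ π ∈ stdSimplex ℝ θ.Ω, |U π| ≤ C) {π : θ.Ω → ℝ} (hπ : π ∈ stdSimplex ℝ θ.Ω)
    (a : 𝓐) (ω : θ.Ω) : Integrable (fun y => U (bayes θ a y π) * θ.q a ω y) E.ν :=
  (hθ.integrable_density a ω).bdd_mul (c := C)
    (hU.comp (hθ.measurable_bayes a π)).aestronglyMeasurable
    (ae_of_all _ fun y => hC _ (hθ.bayes_mem hπ a y))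

theorem actionValue_eq (hθ : θ.Admissible E) {U : (θ.Ω → ℝ) → ℝ} (hU : Measurable U)
    {C : ℝ} (hC : ∀ π ∈ stdSimplex ℝ θ.Ω, |U π| ≤ C) {π : θ.Ω → ℝ} (hπ : π ∈ stdSimplex ℝ θ.Ω)
    (a : 𝓐) : actionValue E θ U π a = ∑ ω, π ω * (meanPayoff E θ a ω +
      E.δ * ∫ y, U (bayes θ a y π) * θ.q a ω y ∂E.ν) := by
  refine Finset.sum_congr rfl fun ω _ => ?_
  congr 1
  rw [meanPayoff, ← integral_const_mul, ← integral_add (hθ.integrable_payoff a ω)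
    ((hθ.integrable_continuation hU hC hπ a ω).const_mul _)]
  refine integral_congr_ae (ae_of_all _ fun y => ?_)
  ring

/-- The Bellman operator contracts by δ because Bayesian posteriors stay in the simplex and
continuation values are averaged against probability densities. -/
theorem abs_actionValue_sub_le (hθ : θ.Admissible E) {U U' : (θ.Ω → ℝ) → ℝ} (hU : Measurable U)
    (hU' : Measurable U') {C C' D : ℝ} (hC : ∀ π ∈ stdSimplex ℝ θ.Ω, |U π| ≤ C)
    (hC' : ∀ π ∈ stdSimplex ℝ θ.Ω, |U' π| ≤ C')
    (hD : ∀ π ∈ stdSimplex ℝ θ.Ω, |U π - U' π| ≤ D)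
    {π : θ.Ω → ℝ} (hπ : π ∈ stdSimplex ℝ θ.Ω) (a : 𝓐) :
    |actionValue E θ U π a - actionValue E θ U' π a| ≤ E.δ * D := by
  rw [hθ.actionValue_eq hU hC hπ, hθ.actionValue_eq hU' hC' hπ, ← Finset.sum_sub_distrib]
  have h1 : ∀ ω, |π ω * (meanPayoff E θ a ω + E.δ * ∫ y, U (bayes θ a y π) * θ.q a ω y ∂E.ν) -
      π ω * (meanPayoff E θ a ω + E.δ * ∫ y, U' (bayes θ a y π) * θ.q a ω y ∂E.ν)|
      ≤ π ω * (E.δ * D) := by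
    intro ω
    have h2 : π ω * (meanPayoff E θ a ω + E.δ * ∫ y, U (bayes θ a y π) * θ.q a ω y ∂E.ν) -
      π ω * (meanPayoff E θ a ω + E.δ * ∫ y, U' (bayes θ a y π) * θ.q a ω y ∂E.ν)
      = π ω * (E.δ * ∫ y, (U (bayes θ a y π) - U' (bayes θ a y π)) * θ.q a ω y ∂E.ν) := by
      have h3 : ∫ y, (U (bayes θ a y π) - U' (bayes θ a y π)) * θ.q a ω y ∂E.ν
          = ∫ y, U (bayes θ a y π) * θ.q a ω y ∂E.ν
            - ∫ y, U' (bayes θ a y π) * θ.q a ω y ∂E.ν := by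
        rw [← integral_sub (hθ.integrable_continuation hU hC hπ a ω)
          (hθ.integrable_continuation hU' hC' hπ a ω)]
        refine integral_congr_ae (ae_of_all _ fun y => ?_)
        ring
      rw [h3]; ring
    rw [h2, abs_mul, abs_mul, abs_of_nonneg (hπ.1 ω), abs_of_nonneg E.δ_nonneg]
    refine mul_le_mul_of_nonneg_left (mul_le_mul_of_nonneg_left ?_ E.δ_nonneg) (hπ.1 ω)
    calc |∫ y, (U (bayes θ a y π) - U' (bayes θ a y π)) * θ.q a ω y ∂E.ν|
        ≤ ∫ y, D * θ.q a ω y ∂E.ν := by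
          rw [← Real.norm_eq_abs]
          refine norm_integral_le_of_norm_le ((hθ.integrable_density a ω).const_mul D)
            (ae_of_all _ fun y => ?_)
          rw [norm_mul, Real.norm_eq_abs, Real.norm_eq_abs, abs_of_pos (hθ.pos a ω ω.2 y)]
          exact mul_le_mul_of_nonneg_right (hD _ (hθ.bayes_mem hπ a y)) (hθ.pos a ω ω.2 y).le
      _ = D := by rw [integral_const_mul, hθ.integral_density, mul_one]
  calc _ ≤ ∑ ω, π ω * (E.δ * D) := (Finset.abs_sum_le_sum_abs _ _).trans
        (Finset.sum_le_sum fun ω _ => h1 ω)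
    _ = E.δ * D := by rw [← Finset.sum_mul, hπ.2, one_mul]

/-- Positive densities make the posterior continuous in the belief for each outcome; dominated
convergence then passes continuity to the expected continuation value. -/
theorem continuousOn_actionValue (hθ : θ.Admissible E) {U : (θ.Ω → ℝ) → ℝ} (hU : Measurable U)
    (hUc : ContinuousOn U (stdSimplex ℝ θ.Ω)) (a : 𝓐) :
    ContinuousOn (fun π => actionValue E θ U π a) (stdSimplex ℝ θ.Ω) := by
  obtain ⟨C, hC⟩ := (isCompact_stdSimplex ℝ θ.Ω).exists_bound_of_continuousOn hUc
  simp only [Real.norm_eq_abs] at hC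
  refine ContinuousOn.congr ?_ fun π hπ => hθ.actionValue_eq hU hC hπ a
  refine continuousOn_finsetSum _ fun ω _ => ?_
  refine ContinuousOn.mul (by fun_prop) (continuousOn_const.add (continuousOn_const.mul ?_))
  refine continuousOn_of_dominated (bound := fun y => C * θ.q a ω y) ?_ ?_ ?_ ?_
  · exact fun π hπ => (hθ.integrable_continuation hU hC hπ a ω).aestronglyMeasurable
  · refine fun π hπ => ae_of_all _ fun y => ?_
    rw [norm_mul, Real.norm_eq_abs, Real.norm_eq_abs, abs_of_pos (hθ.pos a ω ω.2 y)]
    exact mul_le_mul_of_nonneg_right (hC _ (hθ.bayes_mem hπ a y)) (hθ.pos a ω ω.2 y).le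
  · exact (hθ.integrable_density a ω).const_mul C
  · refine ae_of_all _ fun y => ContinuousOn.mul ?_ continuousOn_const
    exact hUc.comp (hθ.continuousOn_bayes a y) fun π hπ => hθ.bayes_mem hπ a y

open Classical in
/-- The extension by zero of a continuous function on the simplex of beliefs. -/
noncomputable def extend (θ : Model 𝓐 𝓨 d) (V : C(stdSimplex ℝ θ.Ω, ℝ)) (π : θ.Ω → ℝ) : ℝ :=
  if h : π ∈ stdSimplex ℝ θ.Ω then V ⟨π, h⟩ else 0

theorem extend_apply (V : C(stdSimplex ℝ θ.Ω, ℝ)) {π : θ.Ω → ℝ} (h : π ∈ stdSimplex ℝ θ.Ω) :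
    extend θ V π = V ⟨π, h⟩ := dif_pos h

theorem continuousOn_extend (V : C(stdSimplex ℝ θ.Ω, ℝ)) :
    ContinuousOn (extend θ V) (stdSimplex ℝ θ.Ω) := by
  rw [continuousOn_iff_continuous_domRestrict]
  convert V.continuous using 1
  ext π
  exact extend_apply V π.2

theorem measurable_extend (V : C(stdSimplex ℝ θ.Ω, ℝ)) : Measurable (extend θ V) := by
  classical
  unfold extend
  exact Measurable.dite (s := stdSimplex ℝ θ.Ω) V.continuous.measurable measurable_const
    (isClosed_stdSimplex ℝ θ.Ω).measurableSet

theorem abs_extend_le (V : C(stdSimplex ℝ θ.Ω, ℝ)) (π : θ.Ω → ℝ)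
    (h : π ∈ stdSimplex ℝ θ.Ω) : |extend θ V π| ≤ ‖V‖ := by
  rw [extend_apply V h, ← Real.norm_eq_abs]
  exact V.norm_coe_le_norm _

/-- Banach's fixed point theorem for the Bellman operator on continuous functions on the simplex.
Extending by zero off the simplex supplies the measurable function on the whole space that
`IsValueFunction` asks for. -/
theorem exists_continuous_valueFunction [Fintype 𝓐] [Nonempty 𝓐] (hθ : θ.Admissible E) :
    ∃ U, IsValueFunction E θ U ∧ ContinuousOn U (stdSimplex ℝ θ.Ω) := by
  have hne : (Finset.univ : Finset 𝓐).Nonempty := Finset.univ_nonempty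
  let T : C(stdSimplex ℝ θ.Ω, ℝ) → C(stdSimplex ℝ θ.Ω, ℝ) := fun V =>
    { toFun := fun π => Finset.univ.sup' hne fun a => actionValue E θ (extend θ V) π.1 a
      continuous_toFun := Continuous.finset_sup'_apply hne fun a _ =>
        continuousOn_iff_continuous_domRestrict.1
          (hθ.continuousOn_actionValue (measurable_extend V) (continuousOn_extend V) a) }
  have hT : ContractingWith ⟨E.δ, E.δ_nonneg⟩ T := by
    refine ⟨E.δ_lt_one, LipschitzWith.of_dist_le_mul fun V V' => ?_⟩
    have hD : ∀ π ∈ stdSimplex ℝ θ.Ω, |extend θ V π - extend θ V' π| ≤ dist V V' := by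
      intro π hπ
      rw [extend_apply V hπ, extend_apply V' hπ, ← Real.dist_eq]
      exact ContinuousMap.dist_apply_le_dist _
    refine (ContinuousMap.dist_le (mul_nonneg E.δ_nonneg dist_nonneg)).2 fun π => ?_
    have h1 := fun a => abs_le.1 (hθ.abs_actionValue_sub_le (measurable_extend V)
      (measurable_extend V') (abs_extend_le V) (abs_extend_le V') hD π.2 a)
    rw [Real.dist_eq]
    change |Finset.univ.sup' hne _ - Finset.univ.sup' hne _| ≤ E.δ * dist V V'
    rw [abs_sub_le_iff]
    constructor
    · rw [sub_le_iff_le_add]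
      refine Finset.sup'_le _ _ fun a ha => ?_
      have := Finset.le_sup' (fun a => actionValue E θ (extend θ V') π.1 a) ha
      have := (h1 a).2
      linarith
    · rw [sub_le_iff_le_add]
      refine Finset.sup'_le _ _ fun a ha => ?_
      have := Finset.le_sup' (fun a => actionValue E θ (extend θ V) π.1 a) ha
      have := (h1 a).1
      linarith
  have : Nonempty C(stdSimplex ℝ θ.Ω, ℝ) := ⟨0⟩
  let V := hT.fixedPoint
  have hV : T V = V := hT.fixedPoint_isFixedPt
  refine ⟨extend θ V, ⟨measurable_extend V, ⟨_, abs_extend_le V⟩, fun π hπ => ?_⟩,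
    continuousOn_extend V⟩
  have h2 : extend θ V π = Finset.univ.sup' hne fun a => actionValue E θ (extend θ V) π a := by
    rw [extend_apply V hπ]
    exact (congrArg (fun F : C(stdSimplex ℝ θ.Ω, ℝ) => F ⟨π, hπ⟩) hV).symm
  rw [h2]
  constructor
  · obtain ⟨a, -, ha⟩ := Finset.exists_mem_eq_sup' hne fun a => actionValue E θ (extend θ V) π a
    exact ⟨a, ha.symm⟩
  · rintro _ ⟨a, rfl⟩
    exact Finset.le_sup' (fun a => actionValue E θ (extend θ V) π a) (Finset.mem_univ a)

/-- Iterating the contraction bounds the gap of two bounded solutions by a multiple of δ ^ n. Hence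
every value function inherits the continuity of the fixed point. -/
theorem valueFunction_unique (hθ : θ.Admissible E) {U U' : (θ.Ω → ℝ) → ℝ}
    (hU : IsValueFunction E θ U) (hU' : IsValueFunction E θ U') :
    EqOn U U' (stdSimplex ℝ θ.Ω) := by
  obtain ⟨hm, ⟨C, hC⟩, hg⟩ := hU
  obtain ⟨hm', ⟨C', hC'⟩, hg'⟩ := hU'
  have step : ∀ n : ℕ, ∀ π ∈ stdSimplex ℝ θ.Ω, |U π - U' π| ≤ E.δ ^ n * (C + C') := by
    intro n
    induction n with
    | zero =>
      intro π hπ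
      have := abs_sub (U π) (U' π)
      linarith [hC π hπ, hC' π hπ]
    | succ n ih =>
      intro π hπ
      have h1 := fun a => abs_le.1 (hθ.abs_actionValue_sub_le hm hm' hC hC' ih hπ a)
      obtain ⟨⟨a, ha⟩, hub⟩ := hg π hπ
      obtain ⟨⟨a', ha'⟩, hub'⟩ := hg' π hπ
      have h2 := hub ⟨a', rfl⟩
      have h3 := hub' ⟨a, rfl⟩
      rw [abs_le, pow_succ']
      constructor
      · linarith [(h1 a').1]
      · linarith [(h1 a).2]
  intro π hπ
  have hlim : Tendsto (fun n : ℕ => E.δ ^ n * (C + C')) atTop (nhds 0) := by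
    simpa using (tendsto_pow_atTop_nhds_zero_of_lt_one E.δ_nonneg E.δ_lt_one).mul_const (C + C')
  have := ge_of_tendsto' hlim fun n => step n π hπ
  exact sub_eq_zero.1 (abs_eq_zero.1 (le_antisymm this (abs_nonneg _)))

theorem continuousOn_valueFunction [Fintype 𝓐] [Nonempty 𝓐] (hθ : θ.Admissible E)
    {U : (θ.Ω → ℝ) → ℝ} (hU : IsValueFunction E θ U) : ContinuousOn U (stdSimplex ℝ θ.Ω) := by
  obtain ⟨V, hV, hVc⟩ := hθ.exists_continuous_valueFunction
  exact hVc.congr (hθ.valueFunction_unique hU hV)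

end Model.Admissible

/-- Measurable selection from a finite family of measurable sets. -/
theorem exists_measurable_selection {X ι : Type*} [MeasurableSpace X] [Nonempty ι]
    (F : Finset ι) {S : ι → Set X} (hS : ∀ i, MeasurableSet (S i)) :
    ∃ p : X → ι, (∀ i, MeasurableSet {x | p x = i}) ∧ ∀ x, (∃ i ∈ F, x ∈ S i) → x ∈ S (p x) := by
  classical
  induction F using Finset.induction_on with
  | empty => exact ⟨fun _ => Classical.arbitrary ι, fun i => MeasurableSet.const _, by simp⟩
  | insert j F _ ih =>
    obtain ⟨p, hp, hpS⟩ := ih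
    refine ⟨fun x => if x ∈ S j then j else p x, fun i => ?_, fun x hx => ?_⟩
    · have : {x | (if x ∈ S j then j else p x) = i}
          = (S j ∩ {_x | j = i}) ∪ ((S j)ᶜ ∩ {x | p x = i}) := by
        ext x
        by_cases h : x ∈ S j <;> simp [h]
      rw [this]
      exact ((hS j).inter (MeasurableSet.const _)).union ((hS j).compl.inter (hp i))
    · by_cases h : x ∈ S j
      · simp [h]
      · simp only [h, if_false]
        refine hpS x ?_
        obtain ⟨i, hi, hxi⟩ := hx
        rcases Finset.mem_insert.1 hi with rfl | hi
        · exact absurd hxi h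
        · exact ⟨i, hi, hxi⟩

namespace Model.Admissible

variable {E : Environment 𝓐 𝓨} {θ : Model 𝓐 𝓨 d}

/-- For each action the beliefs at which it is optimal form a closed set, so a choice in a fixed
order of the finitely many actions is measurable. -/
theorem exists_optimalPolicy [Fintype 𝓐] [Nonempty 𝓐] (hθ : θ.Admissible E) :
    ∃ p, IsOptimalPolicy E θ p := by
  obtain ⟨U, hU, hUc⟩ := hθ.exists_continuous_valueFunction
  have hclosed := isClosed_stdSimplex ℝ θ.Ω
  let S : 𝓐 → Set (θ.Ω → ℝ) := fun a =>
    stdSimplex ℝ θ.Ω ∩ (fun π => actionValue E θ U π a - U π) ⁻¹' {0}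
  have hS : ∀ a, MeasurableSet (S a) := fun a =>
    (((hθ.continuousOn_actionValue hU.1 hUc a).sub hUc).preimage_isClosed_of_isClosed
      hclosed isClosed_singleton).measurableSet
  obtain ⟨p, hp, hpS⟩ := exists_measurable_selection Finset.univ hS
  refine ⟨p, hp, U, hU, fun π hπ => ?_⟩
  obtain ⟨a, ha⟩ := (hU.2.2 π hπ).1
  have := hpS π ⟨a, Finset.mem_univ a, hπ, by simp [ha]⟩
  exact sub_eq_zero.1 this.2

open Classical in
-- A degenerate belief is fixed by Bayes' rule, so the continuation value does not depend on the
-- action and only the flow payoff matters.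
theorem actionValue_vertex (hθ : θ.Admissible E) {U : (θ.Ω → ℝ) → ℝ}
    (hU : IsValueFunction E θ U) (ω₀ : θ.Ω) (a : 𝓐) :
    actionValue E θ U (Pi.single ω₀ 1) a
      = meanPayoff E θ a ω₀ + E.δ * U (Pi.single ω₀ 1) := by
  have hv : (Pi.single ω₀ 1 : θ.Ω → ℝ) ∈ stdSimplex ℝ θ.Ω := single_mem_stdSimplex ℝ ω₀
  obtain ⟨hm, ⟨C, hC⟩, -⟩ := hU
  have hb : ∀ y, bayes θ a y (Pi.single ω₀ 1) = Pi.single ω₀ 1 := by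
    intro y
    have hs : ∑ ω' : θ.Ω, (Pi.single ω₀ 1 : θ.Ω → ℝ) ω' * θ.q a ω' y = θ.q a ω₀ y := by
      rw [Finset.sum_eq_single ω₀] <;> simp +contextual
    ext ω
    rw [bayes, hs]
    rcases eq_or_ne ω ω₀ with rfl | h
    · simp [(hθ.pos a ω ω.2 y).ne']
    · simp [h]
  rw [hθ.actionValue_eq hm hC hv, Finset.sum_eq_single ω₀]
  · simp only [hb, Pi.single_eq_same, one_mul]
    rw [integral_const_mul, hθ.integral_density, mul_one]
  · intro ω _ h
    simp [h]
  · simp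

/-- Near a degenerate belief an optimal policy picks myopically optimal actions. -/
theorem exists_myopic_near_vertex [Fintype 𝓐] [Nonempty 𝓐] (hθ : θ.Admissible E)
    {p : (θ.Ω → ℝ) → 𝓐} (hp : IsOptimalPolicy E θ p) (ω₀ : θ.Ω) :
    ∃ κ > 0, ∀ π ∈ stdSimplex ℝ θ.Ω, 1 - κ < π ω₀ →
      ∀ a, meanPayoff E θ a ω₀ ≤ meanPayoff E θ (p π) ω₀ := by
  classical
  obtain ⟨-, U, hU, hpU⟩ := hp
  have hUc := hθ.continuousOn_valueFunction hU
  set v : θ.Ω → ℝ := Pi.single ω₀ 1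
  have hv : v ∈ stdSimplex ℝ θ.Ω := single_mem_stdSimplex ℝ ω₀
  -- An action that is myopically worse is strictly suboptimal at the vertex, and strictness
  -- survives nearby by continuity of both sides.
  have hev : ∀ a, (∃ b, meanPayoff E θ a ω₀ < meanPayoff E θ b ω₀) →
      ∀ᶠ π in nhdsWithin v (stdSimplex ℝ θ.Ω), actionValue E θ U π a < U π := by
    rintro a ⟨b, hb⟩
    refine ((hθ.continuousOn_actionValue hU.1 hUc a) v hv).eventually_lt (hUc v hv) ?_
    have h1 := (hU.2.2 v hv).2 ⟨b, rfl⟩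
    change actionValue E θ U v a < U v
    rw [hθ.actionValue_vertex hU] at h1 ⊢
    linarith
  have hev' : ∀ᶠ π in nhdsWithin v (stdSimplex ℝ θ.Ω), ∀ a,
      (∃ b, meanPayoff E θ a ω₀ < meanPayoff E θ b ω₀) → actionValue E θ U π a < U π := by
    rw [eventually_all]
    intro a
    by_cases h : ∃ b, meanPayoff E θ a ω₀ < meanPayoff E θ b ω₀
    · filter_upwards [hev a h] with π hπ _ using hπ
    · exact Eventually.of_forall fun π h' => absurd h' h
  obtain ⟨κ, hκ, hball⟩ := Metric.mem_nhdsWithin_iff.1 hev'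
  refine ⟨κ, hκ, fun π hπ hπκ a => ?_⟩
  by_contra hcon
  refine absurd (hpU π hπ) (ne_of_lt (hball ⟨?_, hπ⟩ (p π) ⟨a, not_le.1 hcon⟩))
  rw [Metric.mem_ball, dist_pi_lt_iff hκ]
  intro ω
  rw [Real.dist_eq, abs_lt]
  have hle : ∀ ω, π ω ≤ 1 := fun ω => hπ.2 ▸ Finset.single_le_sum (fun i _ => hπ.1 i)
    (Finset.mem_univ ω)
  rcases eq_or_ne ω ω₀ with rfl | h
  · simp only [v, Pi.single_eq_same]
    constructor <;> linarith [hle ω]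
  -- Mass above 1 - κ at ω₀ leaves less than κ for any other parameter, so the belief is within κ of
  -- the vertex in the sup distance.
  · simp only [v, Pi.single_eq_of_ne h, sub_zero]
    have h2 : π ω + π ω₀ ≤ 1 := by
      rw [← hπ.2, ← Finset.sum_pair h]
      exact Finset.sum_le_sum_of_subset_of_nonneg (Finset.subset_univ _) fun i _ _ => hπ.1 i
    constructor <;> linarith [hπ.1 ω]

end Model.Admissible

/-! ### Likelihoods and posteriors -/

variable {d' : ℕ}

theorem histProd_pos {𝓐 𝓨 : Type*} {f : 𝓐 → 𝓨 → ℝ} (hf : ∀ a y, 0 < f a y) (h : List (𝓐 × 𝓨)) :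
    0 < histProd f h := by
  induction h with
  | nil => simp
  | cons x h ih => simpa using mul_pos (hf _ _) ih

theorem histProd_div {𝓐 𝓨 : Type*} (f g : 𝓐 → 𝓨 → ℝ) (h : List (𝓐 × 𝓨)) :
    histProd (fun a y => f a y / g a y) h = histProd f h / histProd g h := by
  induction h with
  | nil => simp
  | cons x h ih => simp [ih, mul_div_mul_comm]

theorem histProd_ofReal {𝓐 𝓨 : Type*} {f : 𝓐 → 𝓨 → ℝ} (hf : ∀ a y, 0 ≤ f a y)
    (h : List (𝓐 × 𝓨)) :
    histProd (fun a y => ENNReal.ofReal (f a y)) h = ENNReal.ofReal (histProd f h) := by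
  induction h with
  | nil => simp
  | cons x h ih => simp [ih, ENNReal.ofReal_mul (hf _ _)]

theorem likelihood_eq (θ : Model 𝓐 𝓨 d) (π₀ : θ.Ω → ℝ) (h : List (𝓐 × 𝓨)) :
    likelihood θ π₀ h = ∑ ω, π₀ ω * histProd (fun a => θ.q a ω) h := rfl

namespace Model.Admissible

variable {E : Environment 𝓐 𝓨} {θ : Model 𝓐 𝓨 d}

theorem histProd_pos (hθ : θ.Admissible E) (ω : θ.Ω) (h : List (𝓐 × 𝓨)) :
    0 < histProd (fun a => θ.q a ω) h :=
  ModelSwitching.histProd_pos (fun a y => hθ.pos a ω ω.2 y) h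

theorem likelihood_pos (hθ : θ.Admissible E) {π₀ : θ.Ω → ℝ} (hπ : IsFullSupport θ π₀)
    (h : List (𝓐 × 𝓨)) : 0 < likelihood θ π₀ h := by
  obtain ⟨ω, hω⟩ := hθ.nonempty
  exact Finset.sum_pos (fun ω _ => mul_pos (hπ.2 ω) (hθ.histProd_pos ω h))
    ⟨⟨ω, hω⟩, Finset.mem_univ _⟩

theorem posterior_eq (hθ : θ.Admissible E) {π₀ : θ.Ω → ℝ} (hπ : IsFullSupport θ π₀)
    (h : List (𝓐 × 𝓨)) (ω : θ.Ω) : posterior θ π₀ h ω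
      = π₀ ω * histProd (fun a => θ.q a ω) h / likelihood θ π₀ h := by
  induction h generalizing ω with
  | nil =>
    have h : likelihood θ π₀ ([] : List (𝓐 × 𝓨)) = 1 := by
      rw [likelihood_eq]; simpa using hπ.1.2
    rw [h]; simp [posterior]
  | cons x h ih =>
    have hL := (hθ.likelihood_pos hπ h).ne'
    have hL' := (hθ.likelihood_pos hπ (x :: h)).ne'
    have hs : ∑ ω', posterior θ π₀ h ω' * θ.q x.1 ω' x.2
        = likelihood θ π₀ (x :: h) / likelihood θ π₀ h := by
      rw [likelihood_eq θ π₀ (x :: h), Finset.sum_div]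
      refine Finset.sum_congr rfl fun ω' _ => ?_
      rw [ih, histProd_cons]
      ring
    rw [posterior, bayes, hs, ih, histProd_cons]
    field_simp

theorem posterior_mem (hθ : θ.Admissible E) {π₀ : θ.Ω → ℝ} (hπ : IsFullSupport θ π₀)
    (h : List (𝓐 × 𝓨)) : posterior θ π₀ h ∈ stdSimplex ℝ θ.Ω := by
  have hL := hθ.likelihood_pos hπ h
  refine ⟨fun ω => ?_, ?_⟩
  · rw [hθ.posterior_eq hπ]
    exact div_nonneg (mul_nonneg (hπ.2 ω).le (hθ.histProd_pos ω h).le) hL.le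
  · simp_rw [hθ.posterior_eq hπ]
    rw [← Finset.sum_div, ← likelihood_eq, div_self hL.ne']

end Model.Admissible

theorem switcherHistory_eq (α : ℝ) (θ : Model 𝓐 𝓨 d) (π₀ : θ.Ω → ℝ) (p : (θ.Ω → ℝ) → 𝓐)
    (θc : Model 𝓐 𝓨 d') (πc : θc.Ω → ℝ) (pc : (θc.Ω → ℝ) → 𝓐) (s : ℕ × 𝓐 → 𝓨) (t : ℕ) :
    switcherHistory α θ π₀ p θc πc pc s t
      = history (switcherAction α θ π₀ p θc πc pc) s t := by
  induction t with
  | zero => rfl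
  | succ t ih => simp only [switcherHistory, history, ih]

theorem modelChoice_cons_eq_initial {α : ℝ} {θ : Model 𝓐 𝓨 d} {π₀ : θ.Ω → ℝ}
    {θc : Model 𝓐 𝓨 d'} {πc : θc.Ω → ℝ} {x : 𝓐 × 𝓨} {h : List (𝓐 × 𝓨)} :
    modelChoice α θ π₀ θc πc (x :: h) = Label.initial ↔
      (modelChoice α θ π₀ θc πc h = Label.initial ∧
        likelihood θc πc (x :: h) / likelihood θ π₀ (x :: h) ≤ α) ∨
      (modelChoice α θ π₀ θc πc h ≠ Label.initial ∧
        α < likelihood θ π₀ (x :: h) / likelihood θc πc (x :: h)) := by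
  rw [modelChoice]
  cases hm : modelChoice α θ π₀ θc πc h with
  | initial =>
    by_cases hr : likelihood θc πc (x :: h) / likelihood θ π₀ (x :: h) > α
    · simp [hr, hr.not_ge]
    · simp [hr, not_lt.1 hr]
  | competing =>
    by_cases hr : likelihood θ π₀ (x :: h) / likelihood θc πc (x :: h) > α
    · simp [hr]
    · simp [hr]

/-- Model choice and posteriors are functions of likelihoods, which are products along the history.
The induction is strong because the history at t involves the actions of all earlier periods. -/
theorem adapted_switcherAction [Fintype 𝓐] {E : Environment 𝓐 𝓨} (α : ℝ) {θ : Model 𝓐 𝓨 d}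
    (hθ : θ.Admissible E) {π₀ : θ.Ω → ℝ} (hπ : IsFullSupport θ π₀) {p : (θ.Ω → ℝ) → 𝓐}
    (hp : IsOptimalPolicy E θ p) {θc : Model 𝓐 𝓨 d'} (hθc : θc.Admissible E) {πc : θc.Ω → ℝ}
    (hπc : IsFullSupport θc πc) {pc : (θc.Ω → ℝ) → 𝓐} (hpc : IsOptimalPolicy E θc pc) :
    Adapted (switcherAction α θ π₀ p θc πc pc) := by
  set σ := switcherAction α θ π₀ p θc πc pc with hσ
  have main : ∀ t, MeasurableSet[past 𝓐 t]
      {s | modelChoice α θ π₀ θc πc (history σ s t) = Label.initial} ∧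
      ∀ a, MeasurableSet[past 𝓐 t] {s | σ (history σ s t) = a} := by
    intro t
    induction t using Nat.strong_induction_on with
    | _ t ih =>
    have hq : ∀ ω : θ.Ω, Measurable[past 𝓐 t] fun s =>
        histProd (fun a => θ.q a ω) (history σ s t) := fun ω =>
      Adapted.measurable_histProd (fun k hk => (ih k hk).2) fun a => hθ.measurable a ω ω.2
    have hqc : ∀ ω : θc.Ω, Measurable[past 𝓐 t] fun s =>
        histProd (fun a => θc.q a ω) (history σ s t) := fun ω =>
      Adapted.measurable_histProd (fun k hk => (ih k hk).2) fun a => hθc.measurable a ω ω.2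
    have hL : Measurable[past 𝓐 t] fun s => likelihood θ π₀ (history σ s t) := by
      simp only [likelihood_eq]
      exact Finset.measurable_fun_sum (m := past 𝓐 t) _ fun ω _ =>
        Measurable.const_mul (m := past 𝓐 t) (hq ω) _
    have hLc : Measurable[past 𝓐 t] fun s => likelihood θc πc (history σ s t) := by
      simp only [likelihood_eq]
      exact Finset.measurable_fun_sum (m := past 𝓐 t) _ fun ω _ =>
        Measurable.const_mul (m := past 𝓐 t) (hqc ω) _
    have hpost : Measurable[past 𝓐 t] fun s => posterior θ π₀ (history σ s t) := by
      refine @measurable_pi_lambda _ _ _ (past 𝓐 t) _ _ fun ω => ?_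
      simp only [hθ.posterior_eq hπ]
      exact Measurable.div (m := past 𝓐 t) (Measurable.const_mul (m := past 𝓐 t) (hq ω) _) hL
    have hpostc : Measurable[past 𝓐 t] fun s => posterior θc πc (history σ s t) := by
      refine @measurable_pi_lambda _ _ _ (past 𝓐 t) _ _ fun ω => ?_
      simp only [hθc.posterior_eq hπc]
      exact Measurable.div (m := past 𝓐 t) (Measurable.const_mul (m := past 𝓐 t) (hqc ω) _) hLc
    have hm : MeasurableSet[past 𝓐 t]
        {s | modelChoice α θ π₀ θc πc (history σ s t) = Label.initial} := by
      cases t with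
      | zero => simp [history, modelChoice]
      | succ t =>
        have h1 := past_mono t.le_succ _ (ih t t.lt_succ_self).1
        have h2 : MeasurableSet[past 𝓐 (t + 1)] {s | likelihood θc πc (history σ s (t + 1))
            / likelihood θ π₀ (history σ s (t + 1)) ≤ α} :=
          (Measurable.div (m := past 𝓐 (t + 1)) hLc hL) measurableSet_Iic
        have h3 : MeasurableSet[past 𝓐 (t + 1)] {s | α < likelihood θ π₀ (history σ s (t + 1))
            / likelihood θc πc (history σ s (t + 1))} :=
          (Measurable.div (m := past 𝓐 (t + 1)) hL hLc) measurableSet_Ioi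
        convert ((h1.inter h2).union (h1.compl.inter h3)) using 1
        ext s
        simp only [history, mem_ofPred_eq, modelChoice_cons_eq_initial, mem_union, mem_inter_iff,
          mem_compl_iff]
    refine ⟨hm, fun a => ?_⟩
    have h1 : MeasurableSet[past 𝓐 t] {s | p (posterior θ π₀ (history σ s t)) = a} :=
      hpost (hp.1 a)
    have h2 : MeasurableSet[past 𝓐 t] {s | pc (posterior θc πc (history σ s t)) = a} :=
      hpostc (hpc.1 a)
    convert ((hm.inter h1).union (hm.compl.inter h2)) using 1
    ext s
    simp only [hσ, mem_ofPred_eq, mem_union, mem_inter_iff, mem_compl_iff]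
    rw [switcherAction]
    cases modelChoice α θ π₀ θc πc
      (history (switcherAction α θ π₀ p θc πc pc) s t) <;> simp
  exact fun t => (main t).2

theorem Environment.lintegral_div_qstar (E : Environment 𝓐 𝓨) (a : 𝓐) {f : 𝓨 → ℝ}
    (hf : Measurable f) :
    ∫⁻ y, ENNReal.ofReal (f y / E.qstar a y) ∂E.Qstar a = ∫⁻ y, ENNReal.ofReal (f y) ∂E.ν := by
  rw [Environment.Qstar, lintegral_withDensity_eq_lintegral_mul _
    (E.qstar_measurable a).ennreal_ofReal
    (g := fun y => ENNReal.ofReal (f y / E.qstar a y))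
    (hf.div (E.qstar_measurable a)).ennreal_ofReal]
  refine lintegral_congr fun y => ?_
  rw [Pi.mul_apply, ← ENNReal.ofReal_mul (E.qstar_pos a y).le,
    mul_div_cancel₀ _ (E.qstar_pos a y).ne']

/-- The likelihood of a model exceeds the true likelihood by the factor `c` with probability at
most `1 / c`. -/
theorem Model.Admissible.measure_likelihood_ge_le [Fintype 𝓐] {E : Environment 𝓐 𝓨}
    {θ : Model 𝓐 𝓨 d} (hθ : θ.Admissible E) {σ : List (𝓐 × 𝓨) → 𝓐} (hσ : Adapted σ)
    {π : θ.Ω → ℝ} (hπ : π ∈ stdSimplex ℝ θ.Ω) {c : ℝ} (hc : 0 < c) :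
    E.pathLaw {s | ∃ t, c * histProd E.qstar (history σ s t) ≤ likelihood θ π (history σ s t)}
      ≤ ENNReal.ofReal (1 / c) := by
  have hr0 : ∀ (ω : θ.Ω) a y, 0 ≤ θ.q a ω y / E.qstar a y := fun ω a y =>
    div_nonneg (hθ.pos a ω ω.2 y).le (E.qstar_pos a y).le
  -- The likelihood relative to the truth is the belief-weighted mixture of the parameters' density
  -- ratio products, each with one-step mean one.
  have key := hσ.measure_exists_le (E := E) (fun ω : θ.Ω => ENNReal.ofReal (π ω))
    (fun ω a y => ENNReal.ofReal (θ.q a ω y / E.qstar a y))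
    (fun ω a => ((hθ.measurable a ω ω.2).div (E.qstar_measurable a)).ennreal_ofReal)
    (fun ω a => by rw [E.lintegral_div_qstar a (hθ.measurable a ω ω.2), hθ.lintegral a ω ω.2])
    (ENNReal.ofReal c)
  have hsum : ∑ ω, ENNReal.ofReal (π ω) = 1 := by
    rw [← ENNReal.ofReal_sum_of_nonneg fun ω _ => hπ.1 ω, hπ.2, ENNReal.ofReal_one]
  have hset : ∀ h : List (𝓐 × 𝓨), ∑ ω, ENNReal.ofReal (π ω) *
      histProd (fun a y => ENNReal.ofReal (θ.q a ω y / E.qstar a y)) h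
      = ENNReal.ofReal (likelihood θ π h / histProd E.qstar h) := by
    intro h
    rw [likelihood_eq, Finset.sum_div, ENNReal.ofReal_sum_of_nonneg]
    · refine Finset.sum_congr rfl fun ω _ => ?_
      rw [histProd_ofReal (hr0 ω), ← ENNReal.ofReal_mul (hπ.1 ω), histProd_div, mul_div_assoc]
    · exact fun ω _ => div_nonneg (mul_nonneg (hπ.1 ω) (hθ.histProd_pos ω h).le)
        (ModelSwitching.histProd_pos E.qstar_pos h).le
  simp only [hset, hsum] at key
  rw [one_div, ENNReal.ofReal_inv_of_pos hc]
  rw [mul_comm, ← ENNReal.le_div_iff_mul_le (Or.inl (by simpa using hc)) (Or.inl (by simp)),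
    one_div] at key
  refine le_trans (measure_mono ?_) key
  rintro s ⟨t, ht⟩
  refine ⟨t, ENNReal.ofReal_le_ofReal ?_⟩
  rwa [le_div_iff₀ (ModelSwitching.histProd_pos E.qstar_pos _)]

/-! ### Global robustness from a parameter that fits where it is optimal -/

/-- A model is globally robust if it has a parameter that matches the true outcome distribution
at every action that is myopically optimal under this parameter. -/
theorem globallyRobust_of_fit [Fintype 𝓐] [Nonempty 𝓐] {E : Environment 𝓐 𝓨}
    {θ : Model 𝓐 𝓨 d} (hθ : θ.Admissible E) (ω₀ : θ.Ω)
    (hfit : ∀ a, (∀ b, meanPayoff E θ b ω₀ ≤ meanPayoff E θ a ω₀) → θ.q a ω₀ = E.qstar a) :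
    GloballyRobust E θ := by
  classical
  obtain ⟨p, hp⟩ := hθ.exists_optimalPolicy
  obtain ⟨κ, hκ, hnear⟩ := hθ.exists_myopic_near_vertex hp ω₀
  set n : ℝ := (Fintype.card θ.Ω : ℝ) with hn
  have hn0 : 0 < n := by
    have : Nonempty θ.Ω := ⟨ω₀⟩
    rw [hn, Nat.cast_pos]; exact Fintype.card_pos
  have hα := E.one_lt_α
  -- The constants: c < α caps the competitor's gain on the truth, K caps the gain of each parameter
  -- of θ, and 1/c + n/K < 1 leaves positive probability. The prior spreads mass η evenly and puts
  -- the rest on ω₀; η is so small that c ≤ α(1 - η) and that the posterior mass off ω₀, at most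
  -- ηK/(1 - η), stays below κ.
  obtain ⟨c, hc1, hcα⟩ := exists_between hα
  have hc0 : 0 < c := by linarith
  have hgap : 0 < 1 - 1 / c := by
    rw [sub_pos, div_lt_one hc0]; exact hc1
  obtain ⟨K, hK⟩ := exists_gt (n / (1 - 1 / c))
  have hK0 : 0 < K := lt_trans (by positivity) hK
  have hK' : 1 / c + n * (1 / K) < 1 := by
    rw [div_lt_iff₀ hgap] at hK
    have : n * (1 / K) < 1 - 1 / c := by
      rw [mul_one_div, div_lt_iff₀ hK0]; linarith
    linarith
  have hη : ∃ η : ℝ, 0 < η ∧ η < 1 ∧ c ≤ E.α * (1 - η) ∧ η * K < κ * (1 - η) := by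
    have h1 : ∀ᶠ η in nhds (0 : ℝ), η < 1 ∧ c < E.α * (1 - η) ∧ η * K < κ * (1 - η) := by
      refine (eventually_lt_nhds one_pos).and (Eventually.and ?_ ?_)
      · refine ContinuousAt.eventually_lt (by fun_prop) (by fun_prop) (by simpa using hcα)
      · refine ContinuousAt.eventually_lt (by fun_prop) (by fun_prop) (by simpa using hκ)
    obtain ⟨η, h2, h3⟩ := ((h1.filter_mono nhdsWithin_le_nhds).and
      (self_mem_nhdsWithin : Ioi (0 : ℝ) ∈ nhdsWithin 0 (Ioi 0))).exists
    exact ⟨η, h3, h2.1, h2.2.1.le, h2.2.2⟩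
  obtain ⟨η, hη0, hη1, hηc, hηκ⟩ := hη
  let π₀ : θ.Ω → ℝ := fun ω => η / n + (1 - η) * (Pi.single ω₀ 1 : θ.Ω → ℝ) ω
  have hπ₀ : IsFullSupport θ π₀ := by
    have hpos : ∀ ω, 0 < π₀ ω := by
      intro ω
      have : 0 ≤ (Pi.single ω₀ 1 : θ.Ω → ℝ) ω := (single_mem_stdSimplex ℝ ω₀).1 ω
      have := mul_nonneg (sub_nonneg.2 hη1.le) this
      have : 0 < η / n := by positivity
      simp only [π₀]; linarith
    refine ⟨⟨fun ω => (hpos ω).le, ?_⟩, hpos⟩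
    simp only [π₀]
    rw [Finset.sum_add_distrib, ← Finset.mul_sum, (single_mem_stdSimplex ℝ ω₀).2]
    simp only [Finset.sum_const, Finset.card_univ, nsmul_eq_mul, ← hn]
    field_simp
    ring
  have hπ0 : 1 - η ≤ π₀ ω₀ := by
    have : 0 < η / n := by positivity
    simp only [π₀, Pi.single_eq_same]; linarith
  have hπne : ∀ ω, ω ≠ ω₀ → π₀ ω = η / n := fun ω h => by simp [π₀, h]
  refine ⟨π₀, hπ₀, p, hp, fun d' θc hθc πc hπc pc hpc => ?_⟩
  have hσ := adapted_switcherAction E.α hθ hπ₀ hp hθc hπc hpc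
  unfold Persists
  simp only [switcherHistory_eq]
  set σ := switcherAction E.α θ π₀ p θc πc pc with hσdef
  set G : Set (ℕ × 𝓐 → 𝓨) := {s | ∀ᶠ t in atTop,
    modelChoice E.α θ π₀ θc πc (history σ s t) = Label.initial} with hG
  have hprob := E.isProbabilityMeasure_pathLaw
  let B₁ : Set (ℕ × 𝓐 → 𝓨) :=
    {s | ∃ t, c * histProd E.qstar (history σ s t) ≤ likelihood θc πc (history σ s t)}
  let B₂ : θ.Ω → Set (ℕ × 𝓐 → 𝓨) := fun ω => {s | ∃ t, K * histProd E.qstar (history σ s t)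
    ≤ likelihood θ (Pi.single ω 1) (history σ s t)}
  have hB₁ : E.pathLaw B₁ ≤ ENNReal.ofReal (1 / c) :=
    hθc.measure_likelihood_ge_le hσ hπc.1 hc0
  have hB₂ : ∀ ω, E.pathLaw (B₂ ω) ≤ ENNReal.ofReal (1 / K) := fun ω =>
    hθ.measure_likelihood_ge_le hσ (single_mem_stdSimplex ℝ ω) hK0
  have hsingle : ∀ ω h, likelihood θ (Pi.single ω 1) h = histProd (fun a => θ.q a ω) h := by
    intro ω h
    rw [likelihood_eq, Finset.sum_eq_single ω] <;> simp +contextual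
  have hgood : ∀ s, s ∉ B₁ → (∀ ω, s ∉ B₂ ω) → s ∈ G := by
    intro s hs₁ hs₂
    have hs₁' : ∀ t, likelihood θc πc (history σ s t) < c * histProd E.qstar (history σ s t) :=
      fun t => not_le.1 fun hcon => hs₁ ⟨t, hcon⟩
    have hs₂' : ∀ (ω : θ.Ω) t, histProd (fun a => θ.q a ω) (history σ s t)
        < K * histProd E.qstar (history σ s t) := fun ω t => by
      rw [← hsingle]
      exact not_le.1 fun hcon => hs₂ ω ⟨t, hcon⟩
    -- The two invariants sustain each other: an exact ω₀ keeps the posterior near it and the Bayes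
    -- factor of the competitor below α, and the adopted policy then plays only actions at which ω₀
    -- is exact.
    have claim : ∀ t, modelChoice E.α θ π₀ θc πc (history σ s t) = Label.initial ∧
        histProd (fun a => θ.q a ω₀) (history σ s t) = histProd E.qstar (history σ s t) := by
      intro t
      induction t with
      | zero => exact ⟨rfl, rfl⟩
      | succ t ih =>
        obtain ⟨ih1, ih2⟩ := ih
        have hLow : ∀ h, (1 - η) * histProd (fun a => θ.q a ω₀) h ≤ likelihood θ π₀ h := by
          intro h
          have h1 : π₀ ω₀ * histProd (fun a => θ.q a ω₀) h ≤ likelihood θ π₀ h :=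
            Finset.single_le_sum (f := fun ω => π₀ ω * histProd (fun a => θ.q a ω) h)
              (fun ω _ => (mul_pos (hπ₀.2 ω) (hθ.histProd_pos ω h)).le) (Finset.mem_univ ω₀)
          exact (mul_le_mul_of_nonneg_right hπ0 (hθ.histProd_pos ω₀ h).le).trans h1
        have hact : σ (history σ s t) = p (posterior θ π₀ (history σ s t)) := by
          rw [hσdef, switcherAction, ← hσdef, ih1]
        have hP := ModelSwitching.histProd_pos E.qstar_pos (history σ s t)
        have hpost : 1 - κ < posterior θ π₀ (history σ s t) ω₀ := by
          have hL := hθ.likelihood_pos hπ₀ (history σ s t)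
          have hsum := (hθ.posterior_mem hπ₀ (history σ s t)).2
          rw [← Finset.add_sum_erase _ _ (Finset.mem_univ ω₀)] at hsum
          have hrest : ∑ ω ∈ Finset.univ.erase ω₀, posterior θ π₀ (history σ s t) ω
              ≤ ∑ ω ∈ Finset.univ.erase ω₀, (η * K / (1 - η)) / n := by
            refine Finset.sum_le_sum fun ω hω => ?_
            rw [hθ.posterior_eq hπ₀, hπne ω (Finset.ne_of_mem_erase hω), div_le_iff₀ hL]
            have h1 := hLow (history σ s t)
            rw [ih2] at h1
            have h2 : 0 < 1 - η := by linarith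
            calc η / n * histProd (fun a => θ.q a ω) (history σ s t)
                ≤ η / n * (K * histProd E.qstar (history σ s t)) := by
                  gcongr
                  exact (hs₂' ω t).le
              _ = η * K / (1 - η) / n * ((1 - η) * histProd E.qstar (history σ s t)) := by
                  field_simp
              _ ≤ _ := by gcongr
          have hrest' : ∑ ω ∈ Finset.univ.erase ω₀, (η * K / (1 - η)) / n < κ := by
            have h2 : 0 < 1 - η := by linarith
            calc ∑ ω ∈ Finset.univ.erase ω₀, (η * K / (1 - η)) / n
                ≤ ∑ ω : θ.Ω, (η * K / (1 - η)) / n :=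
                  Finset.sum_le_sum_of_subset_of_nonneg (Finset.subset_univ _)
                    fun _ _ _ => by positivity
              _ = η * K / (1 - η) := by
                  simp only [Finset.sum_const, Finset.card_univ, nsmul_eq_mul, ← hn]
                  field_simp
              _ < κ := by rwa [div_lt_iff₀ h2]
          linarith
        have hq := hfit _ (hnear _ (hθ.posterior_mem hπ₀ _) hpost)
        have h2 : histProd (fun a => θ.q a ω₀) (history σ s (t + 1))
            = histProd E.qstar (history σ s (t + 1)) := by
          simp only [history, histProd_cons, ih2, hact, hq]
        refine ⟨?_, h2⟩
        have hratio : likelihood θc πc (history σ s (t + 1))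
            / likelihood θ π₀ (history σ s (t + 1)) ≤ E.α := by
          rw [div_le_iff₀ (hθ.likelihood_pos hπ₀ _)]
          have h3 := hLow (history σ s (t + 1))
          rw [h2] at h3
          calc _ ≤ c * histProd E.qstar (history σ s (t + 1)) := (hs₁' (t + 1)).le
            _ ≤ E.α * (1 - η) * histProd E.qstar (history σ s (t + 1)) :=
                mul_le_mul_of_nonneg_right hηc (ModelSwitching.histProd_pos E.qstar_pos _).le
            _ = E.α * ((1 - η) * histProd E.qstar (history σ s (t + 1))) := by ring
            _ ≤ _ := mul_le_mul_of_nonneg_left h3 (by linarith)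
        exact modelChoice_cons_eq_initial.2 (Or.inl ⟨ih1, hratio⟩)
    exact Eventually.of_forall fun t => (claim t).1
  -- Positivity follows by subadditivity, which holds for arbitrary sets, so measurability of `G`
  -- never enters.
  have hcover : (univ : Set (ℕ × 𝓐 → 𝓨)) ⊆ G ∪ (B₁ ∪ ⋃ ω, B₂ ω) := by
    intro s _
    by_contra hcon
    simp only [mem_union, mem_iUnion, not_or, not_exists] at hcon
    exact hcon.1 (hgood s hcon.2.1 hcon.2.2)
  have hbad : E.pathLaw (B₁ ∪ ⋃ ω, B₂ ω) < 1 := by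
    calc E.pathLaw (B₁ ∪ ⋃ ω, B₂ ω) ≤ E.pathLaw B₁ + ∑ ω, E.pathLaw (B₂ ω) :=
          (measure_union_le _ _).trans (by gcongr; exact measure_iUnion_fintype_le _ _)
      _ ≤ ENNReal.ofReal (1 / c) + ∑ ω : θ.Ω, ENNReal.ofReal (1 / K) := by
          gcongr with ω
          exact hB₂ ω
      _ = ENNReal.ofReal (1 / c + n * (1 / K)) := by
          rw [← ENNReal.ofReal_sum_of_nonneg fun _ _ => by positivity,
            ← ENNReal.ofReal_add (by positivity) (Finset.sum_nonneg fun _ _ => by positivity)]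
          simp [hn]
      _ < 1 := by rw [← ENNReal.ofReal_one]; exact (ENNReal.ofReal_lt_ofReal_iff one_pos).2 hK'
  rw [pos_iff_ne_zero]
  intro h0
  have h1 : (1 : ℝ≥0∞) ≤ E.pathLaw G + E.pathLaw (B₁ ∪ ⋃ ω, B₂ ω) := by
    rw [← hprob.measure_univ]
    exact (measure_mono hcover).trans (measure_union_le _ _)
  rw [h0, zero_add] at h1
  exact absurd hbad (not_lt.2 h1)

/-! ### Gaussian likelihood ratios and dominated parameters -/

namespace TeamProblem

variable (P : TeamProblem)

instance : Nonempty P.A := P.A_nonempty.to_subtype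

/-- The bias of the mean output at effort `a` under the parameter `ω`. -/
noncomputable def bias (ω : EuclideanSpace ℝ (Fin 2)) (a : P.A) : ℝ :=
  P.g a (ω 0) (ω 1) - P.g a P.bStar P.wStar

/-- The parameter `ω'` has a smaller bias than `ω` at every effort, strictly where `ω` is biased. -/
def Dominates (ω' ω : EuclideanSpace ℝ (Fin 2)) : Prop :=
  ∀ a : P.A, (P.bias ω a = 0 → P.bias ω' a = 0) ∧
    (P.bias ω a ≠ 0 → |P.bias ω' a| < |P.bias ω a|)

theorem Qstar_env (a : P.A) : P.env.Qstar a = gaussianReal (P.g a P.bStar P.wStar) P.v := by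
  rw [gaussianReal_of_var_ne_zero _ P.v_ne_zero]
  rfl

theorem qstar_env (a : P.A) : P.env.qstar a = P.density a !₂[P.bStar, P.wStar] := rfl

theorem density_pos (a : P.A) (ω : EuclideanSpace ℝ (Fin 2)) (y : ℝ) : 0 < P.density a ω y :=
  gaussianPDFReal_pos _ _ _ P.v_ne_zero

theorem measurable_density (a : P.A) (ω : EuclideanSpace ℝ (Fin 2)) :
    Measurable (P.density a ω) := measurable_gaussianPDFReal _ _

theorem density_eq_of_bias_eq_zero {a : P.A} {ω : EuclideanSpace ℝ (Fin 2)}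
    (h : P.bias ω a = 0) : P.density a ω = P.env.qstar a := by
  ext y
  rw [qstar_env, density, density, sub_eq_zero.1 h]
  simp

theorem density_div (a : P.A) (ω ω' : EuclideanSpace ℝ (Fin 2)) (y : ℝ) :
    P.density a ω y / P.density a ω' y = Real.exp
      (((P.g a (ω' 0) (ω' 1)) ^ 2 - (P.g a (ω 0) (ω 1)) ^ 2) / (2 * P.v)
        + ((P.g a (ω 0) (ω 1)) - (P.g a (ω' 0) (ω' 1))) / P.v * y) := by
  have hv : (P.v : ℝ) ≠ 0 := by exact_mod_cast P.v_ne_zero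
  have hv0 : (0 : ℝ) < P.v := lt_of_le_of_ne P.v.2 hv.symm
  have h2 : (Real.sqrt (2 * Real.pi * P.v))⁻¹ ≠ 0 := by positivity
  rw [density, density, gaussianPDFReal, gaussianPDFReal, mul_div_mul_left _ _ h2, ← Real.exp_sub]
  congr 1
  field_simp
  ring

/-- With a common variance the log density ratio is affine in the outcome, hence square integrable
under the normal truth. -/
theorem admissible_of_density {θ : Model P.A ℝ 2} (hne : θ.Ω.Nonempty)
    (hq : ∀ a, ∀ ω ∈ θ.Ω, θ.q a ω = P.density a ω) : θ.Admissible P.env where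
  nonempty := hne
  measurable a ω hω := by rw [hq a ω hω]; exact P.measurable_density a ω
  pos a ω hω y := by rw [hq a ω hω]; exact P.density_pos a ω y
  lintegral a ω hω := by
    rw [hq a ω hω]
    exact lintegral_gaussianPDFReal_eq_one _ P.v_ne_zero
  u_integrable a ω hω := by
    have h := (memLp_id_gaussianReal (μ := P.g a (ω 0) (ω 1)) (v := P.v) 1).integrable
      (by norm_num)
    rw [gaussianReal_of_var_ne_zero _ P.v_ne_zero] at h
    rw [Model.Q, hq a ω hω]
    exact h
  log_ratio a ω hω := by
    refine ⟨fun y => |Real.log (P.env.qstar a y / θ.q a ω y)|, ?_, ae_of_all _ fun y => le_rfl⟩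
    rw [hq a ω hω, Qstar_env]
    simp only [qstar_env, density_div, Real.log_exp]
    have h : ∀ c k : ℝ, MemLp (fun y : ℝ => c + k * y) 2
        (gaussianReal (P.g a P.bStar P.wStar) P.v) := fun c k =>
      (memLp_const c).add ((memLp_id_gaussianReal' 2 (by simp)).const_mul k)
    exact (h _ _).abs

theorem meanPayoff_eq {θ : Model P.A ℝ 2} {ω : EuclideanSpace ℝ (Fin 2)} {a : P.A}
    (hq : θ.q a ω = P.density a ω) : meanPayoff P.env θ a ω = P.g a (ω 0) (ω 1) := by
  have h := integral_id_gaussianReal (μ := P.g a (ω 0) (ω 1)) (v := P.v)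
  rw [integral_gaussianReal_eq_integral_smul P.v_ne_zero] at h
  rw [meanPayoff, hq, ← h]
  refine integral_congr_ae (ae_of_all _ fun y => ?_)
  exact mul_comm _ _

/-- The ratio is the exponential of an affine function, so its s-th moment is a Gaussian moment
generating function. To first order in s the exponent has the sign of the difference of squared
biases. -/
theorem lintegral_density_ratio (a : P.A) (ω ω' : EuclideanSpace ℝ (Fin 2)) (s : ℝ) :
    ∫⁻ y, ENNReal.ofReal ((P.density a ω y / P.density a ω' y) ^ s) ∂P.env.Qstar a
      = ENNReal.ofReal (Real.exp (s / (2 * P.v) *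
        (P.bias ω' a ^ 2 - P.bias ω a ^ 2 + s * (P.bias ω a - P.bias ω' a) ^ 2))) := by
  have hv : (P.v : ℝ) ≠ 0 := by exact_mod_cast P.v_ne_zero
  rw [Qstar_env]
  set m := P.g a (ω 0) (ω 1) with hm
  set m' := P.g a (ω' 0) (ω' 1) with hm'
  set m₀ := P.g a P.bStar P.wStar with hm₀
  have h1 : ∀ y, (P.density a ω y / P.density a ω' y) ^ s
      = Real.exp (s * ((m' ^ 2 - m ^ 2) / (2 * P.v))) * Real.exp (s * ((m - m') / P.v) * y) := by
    intro y
    rw [density_div, ← Real.exp_mul, ← Real.exp_add]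
    congr 1
    ring
  simp_rw [h1]
  have hint := integrable_exp_mul_gaussianReal (μ := m₀) (v := P.v) (s * ((m - m') / P.v))
  rw [← ofReal_integral_eq_lintegral_ofReal (hint.const_mul _)
    (ae_of_all _ fun y => by positivity), integral_const_mul]
  have h2 := mgf_gaussianReal (p := gaussianReal m₀ P.v) (X := id) (μ := m₀) (v := P.v)
    (by simp) (s * ((m - m') / P.v))
  rw [mgf] at h2
  simp only [id] at h2
  rw [h2, ← Real.exp_add]
  congr 2
  simp only [bias, ← hm, ← hm', ← hm₀]
  field_simp
  ring

end TeamProblem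

theorem histProd_rpow_mul {𝓐 𝓨 : Type*} {f : 𝓐 → 𝓨 → ℝ} (hf : ∀ a y, 0 < f a y) (w : 𝓐 → ℝ)
    (s : ℝ) (h : List (𝓐 × 𝓨)) :
    histProd (fun a y => f a y ^ s * w a) h = histProd f h ^ s * histProd (fun a _ => w a) h := by
  induction h with
  | nil => simp
  | cons x h ih =>
    rw [histProd_cons, histProd_cons, histProd_cons, ih,
      Real.mul_rpow (hf _ _).le (histProd_pos hf h).le]
    ring

/-- A product of factors that are at least one, and at least `c > 1` infinitely often, diverges. -/
theorem tendsto_histProd_atTop {𝓐 𝓨 : Type} {σ : List (𝓐 × 𝓨) → 𝓐} {s : ℕ × 𝓐 → 𝓨}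
    {w : 𝓐 → ℝ} (hw : ∀ a, 1 ≤ w a) {c : ℝ} (hc : 1 < c)
    (hf : ∃ᶠ t in atTop, c ≤ w (σ (history σ s t))) :
    Tendsto (fun t => histProd (fun a (_ : 𝓨) => w a) (history σ s t)) atTop atTop := by
  have hpos : ∀ t, 0 < histProd (fun a (_ : 𝓨) => w a) (history σ s t) := fun t =>
    histProd_pos (fun a _ => lt_of_lt_of_le one_pos (hw a)) _
  have hmono : Monotone fun t => histProd (fun a (_ : 𝓨) => w a) (history σ s t) := by
    refine monotone_nat_of_le_succ fun t => ?_
    rw [history, histProd_cons]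
    exact le_mul_of_one_le_left (hpos t).le (hw _)
  have hpow : ∀ n : ℕ, ∃ t, c ^ n ≤ histProd (fun a (_ : 𝓨) => w a) (history σ s t) := by
    intro n
    induction n with
    | zero => exact ⟨0, by simp [history]⟩
    | succ n ih =>
      obtain ⟨t, ht⟩ := ih
      obtain ⟨t', htt', ht'⟩ := frequently_atTop.1 hf t
      refine ⟨t' + 1, ?_⟩
      rw [history, histProd_cons, pow_succ']
      exact mul_le_mul ht' (ht.trans (hmono htt')) (by positivity) (by linarith [hw (σ (history σ s t'))])
  refine tendsto_atTop_atTop_of_monotone hmono fun b => ?_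
  obtain ⟨n, hn⟩ := pow_unbounded_of_one_lt b hc
  obtain ⟨t, ht⟩ := hpow n
  exact ⟨t, hn.le.trans ht⟩

namespace TeamProblem

variable (P : TeamProblem)

/-- Where ω is biased, domination makes the bracket negative at s = 0, hence for small s > 0. As
there are finitely many efforts, one s and one ρ < 1 serve all. -/
theorem exists_contraction {ω ω' : EuclideanSpace ℝ (Fin 2)} (hdom : P.Dominates ω' ω) :
    ∃ s > 0, ∃ ρ > 0, ρ < 1 ∧ ∀ a, P.bias ω a ≠ 0 → Real.exp (s / (2 * P.v) *
      (P.bias ω' a ^ 2 - P.bias ω a ^ 2 + s * (P.bias ω a - P.bias ω' a) ^ 2)) ≤ ρ := by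
  have hv : (P.v : ℝ) ≠ 0 := by exact_mod_cast P.v_ne_zero
  have hv0 : (0 : ℝ) < P.v := lt_of_le_of_ne P.v.2 hv.symm
  have h1 : ∀ᶠ s in nhds (0 : ℝ), ∀ a, P.bias ω a ≠ 0 →
      P.bias ω' a ^ 2 - P.bias ω a ^ 2 + s * (P.bias ω a - P.bias ω' a) ^ 2 < 0 := by
    rw [eventually_all]
    intro a
    by_cases h : P.bias ω a = 0
    · exact Eventually.of_forall fun s h' => absurd h h'
    · have h2 := sq_lt_sq.2 ((hdom a).2 h)
      have : ∀ᶠ s in nhds (0 : ℝ),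
          P.bias ω' a ^ 2 - P.bias ω a ^ 2 + s * (P.bias ω a - P.bias ω' a) ^ 2 < 0 :=
        ContinuousAt.eventually_lt (by fun_prop) (by fun_prop) (by simpa using h2)
      filter_upwards [this] with s hs _ using hs
  obtain ⟨s, hs, hs0⟩ := ((h1.filter_mono nhdsWithin_le_nhds).and
    (self_mem_nhdsWithin : Ioi (0 : ℝ) ∈ nhdsWithin 0 (Ioi 0))).exists
  have hs0 : 0 < s := hs0
  have h3 : ∀ᶠ ρ in nhdsWithin (1 : ℝ) (Iio 1), ∀ a, P.bias ω a ≠ 0 → Real.exp (s / (2 * P.v) *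
      (P.bias ω' a ^ 2 - P.bias ω a ^ 2 + s * (P.bias ω a - P.bias ω' a) ^ 2)) ≤ ρ := by
    rw [eventually_all]
    intro a
    by_cases h : P.bias ω a = 0
    · exact Eventually.of_forall fun s h' => absurd h h'
    · have h4 : Real.exp (s / (2 * P.v) *
          (P.bias ω' a ^ 2 - P.bias ω a ^ 2 + s * (P.bias ω a - P.bias ω' a) ^ 2)) < 1 := by
        rw [Real.exp_lt_one_iff]
        exact mul_neg_of_pos_of_neg (by positivity) (hs a h)
      filter_upwards [nhdsWithin_le_nhds (eventually_gt_nhds h4)] with ρ hρ _ using hρ.le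
  obtain ⟨ρ, ⟨hρ, hρ1⟩, hρ0⟩ := ((h3.and (self_mem_nhdsWithin :
    Iio (1 : ℝ) ∈ nhdsWithin 1 (Iio 1))).and
    (nhdsWithin_le_nhds (eventually_gt_nhds (one_pos (α := ℝ))))).exists
  exact ⟨s, hs0, ρ, hρ0, hρ1, hρ⟩

/-- The likelihood ratio of a parameter to a dominating one vanishes along every path on which the
former is biased infinitely often. -/
theorem ae_tendsto_likelihoodRatio {σ : List (P.A × ℝ) → P.A} (hσ : Adapted σ)
    {ω ω' : EuclideanSpace ℝ (Fin 2)} (hdom : P.Dominates ω' ω) :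
    ∀ᵐ x ∂P.env.pathLaw, (∃ᶠ t in atTop, P.bias ω (σ (history σ x t)) ≠ 0) →
      Tendsto (fun t => histProd (fun a => P.density a ω) (history σ x t) /
        histProd (fun a => P.density a ω') (history σ x t)) atTop (nhds 0) := by
  classical
  obtain ⟨s, hs0, ρ, hρ0, hρ1, hρ⟩ := P.exists_contraction hdom
  -- The slack in the contraction is turned into a weight ρ⁻¹ at biased efforts, with mean factor
  -- still at most one. The weighted power of the ratio stays bounded almost surely while the
  -- weights diverge, so the ratio itself vanishes.
  let w : P.A → ℝ := fun a => if P.bias ω a = 0 then 1 else ρ⁻¹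
  have hρinv : 1 < ρ⁻¹ := (one_lt_inv₀ hρ0).2 hρ1
  have hw : ∀ a, 1 ≤ w a := by
    intro a
    by_cases h : P.bias ω a = 0
    · simp [w, h]
    · simpa [w, h] using hρinv.le
  have hrpos : ∀ a y, 0 < P.density a ω y / P.density a ω' y := fun a y =>
    div_pos (P.density_pos a ω y) (P.density_pos a ω' y)
  let r : P.A → ℝ → ℝ := fun a y => (P.density a ω y / P.density a ω' y) ^ s * w a
  have hr0 : ∀ a y, 0 ≤ r a y := fun a y =>
    mul_nonneg (Real.rpow_nonneg (hrpos a y).le s) (zero_le_one.trans (hw a))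
  have hrm : ∀ a, Measurable fun y => (P.density a ω y / P.density a ω' y) ^ s := fun a =>
    ((P.measurable_density a ω).div (P.measurable_density a ω')).pow_const s
  have hbound := hσ.ae_exists_bound (E := P.env) (fun a y => ENNReal.ofReal (r a y))
    (fun a => ((hrm a).mul_const _).ennreal_ofReal) (fun a => by
      have h1 : ∀ y, ENNReal.ofReal (r a y) = ENNReal.ofReal
          ((P.density a ω y / P.density a ω' y) ^ s) * ENNReal.ofReal (w a) := fun y =>
        ENNReal.ofReal_mul (Real.rpow_nonneg (hrpos a y).le s)
      simp_rw [h1]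
      rw [lintegral_mul_const _ (hrm a).ennreal_ofReal, lintegral_density_ratio,
        ← ENNReal.ofReal_mul (Real.exp_pos _).le, ENNReal.ofReal_le_one]
      by_cases h : P.bias ω a = 0
      · simp [w, h, (hdom a).1 h]
      · simp only [w, h, if_false]
        rw [← div_eq_mul_inv, div_le_one hρ0]
        exact hρ a h)
  filter_upwards [hbound] with x hx hfreq
  obtain ⟨C, hC⟩ := hx
  have hW := tendsto_histProd_atTop (σ := σ) (s := x) hw hρinv
    (hfreq.mono fun t ht => by simp [w, ht])
  set R : ℕ → ℝ := fun t => histProd (fun a => P.density a ω) (history σ x t) /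
        histProd (fun a => P.density a ω') (history σ x t) with hR
  set W : ℕ → ℝ := fun t => histProd (fun a (_ : ℝ) => w a) (history σ x t)
  have hWpos : ∀ t, 0 < W t := fun t => histProd_pos (fun a _ => lt_of_lt_of_le one_pos (hw a)) _
  have hRpos : ∀ t, 0 < R t := fun t => div_pos (histProd_pos (fun a y => P.density_pos a ω y) _)
    (histProd_pos (fun a y => P.density_pos a ω' y) _)
  have hle : ∀ t, R t ^ s ≤ C / W t := by
    intro t
    have h1 := hC t
    rw [histProd_ofReal hr0, histProd_rpow_mul hrpos, histProd_div] at h1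
    rw [le_div_iff₀ (hWpos t)]
    have h2 := ENNReal.toReal_mono ENNReal.coe_ne_top h1
    rwa [ENNReal.toReal_ofReal (mul_nonneg (Real.rpow_nonneg (hRpos t).le s) (hWpos t).le)] at h2
  have hlim : Tendsto (fun t => R t ^ s) atTop (nhds 0) :=
    squeeze_zero (fun t => Real.rpow_nonneg (hRpos t).le s) hle (hW.const_div_atTop _)
  have h3 := hlim.rpow_const (p := s⁻¹) (Or.inr (inv_pos.2 hs0).le)
  rw [Real.zero_rpow (inv_pos.2 hs0).ne'] at h3
  refine h3.congr fun t => ?_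
  rw [← Real.rpow_mul (hRpos t).le, mul_inv_cancel₀ hs0.ne', Real.rpow_one]

theorem bias_true (a : P.A) : P.bias !₂[P.bStar, P.wStar] a = 0 := by
  simp [bias]

theorem dominates_true (ω : EuclideanSpace ℝ (Fin 2)) :
    P.Dominates !₂[P.bStar, P.wStar] ω := fun a =>
  ⟨fun _ => P.bias_true a, fun h => by rw [P.bias_true a, abs_zero]; exact abs_pos.2 h⟩

end TeamProblem

/-- Equal factors cancel from period T on, so the ratio freezes. -/
theorem history_tail_eq {𝓐 𝓨 : Type} {σ : List (𝓐 × 𝓨) → 𝓐} {s : ℕ × 𝓐 → 𝓨} {f g : 𝓐 → 𝓨 → ℝ}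
    (hg : ∀ a y, 0 < g a y) {T : ℕ}
    (h : ∀ t ≥ T, f (σ (history σ s t)) = g (σ (history σ s t))) :
    ∀ t ≥ T, histProd f (history σ s t) / histProd g (history σ s t)
      = histProd f (history σ s T) / histProd g (history σ s T) := by
  intro t ht
  induction t, ht using Nat.le_induction with
  | base => rfl
  | succ t ht ih =>
    rw [history, histProd_cons, histProd_cons, ← ih, h t ht,
      mul_div_mul_left _ _ (hg _ _).ne']

/-! ### Non-persistence against a dominating model -/

namespace TeamProblem

variable (P : TeamProblem)

/-- A model does not persist if every parameter is dominated by a parameter of the competing model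
and no parameter matches the truth at an effort that is optimal under this parameter. -/
theorem neverPersists_of_dominated {θ θc : Model P.A ℝ 2} (hθ : θ.Admissible P.env)
    (hq : ∀ a, ∀ ω ∈ θ.Ω, θ.q a ω = P.density a ω) (hθc : θc.Admissible P.env)
    (hqc : ∀ a, ∀ ω ∈ θc.Ω, θc.q a ω = P.density a ω)
    (hinj : ∀ ω ∈ θ.Ω, ∀ a a', P.bias ω a = 0 → P.bias ω a' = 0 → a = a')
    (hsep : ∀ ω ∈ θ.Ω, ∀ ω' ∈ θ.Ω, ∀ a, P.bias ω a = 0 → P.bias ω' a = 0 → ω = ω')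
    (hno : ∀ ω ∈ θ.Ω, ∀ a, P.bias ω a = 0 →
      ∃ a' : P.A, P.g a (ω 0) (ω 1) < P.g a' (ω 0) (ω 1))
    (hdom : ∀ ω ∈ θ.Ω, ∃ ω' ∈ θc.Ω, P.Dominates ω' ω) : P.NeverPersists θ θc := by
  classical
  intro π₀ hπ p hp πc hπc pc hpc
  have hσ := adapted_switcherAction P.env.α hθ hπ hp hθc hπc hpc
  unfold Persists
  simp only [switcherHistory_eq]
  set σ := switcherAction P.env.α θ π₀ p θc πc pc with hσdef
  choose f hf hfdom using hdom
  have htrue : ∀ᵐ x ∂P.env.pathLaw, ∀ ω : θ.Ω,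
      (∃ᶠ t in atTop, P.bias ω (σ (history σ x t)) ≠ 0) →
      Tendsto (fun t => histProd (fun a => P.density a ω) (history σ x t) /
        histProd (fun a => P.density a !₂[P.bStar, P.wStar]) (history σ x t)) atTop (nhds 0) :=
    ae_all_iff.2 fun ω => P.ae_tendsto_likelihoodRatio hσ (P.dominates_true ω)
  have hcomp : ∀ᵐ x ∂P.env.pathLaw, ∀ ω : θ.Ω,
      (∃ᶠ t in atTop, P.bias ω (σ (history σ x t)) ≠ 0) →
      Tendsto (fun t => histProd (fun a => P.density a ω) (history σ x t) /
        histProd (fun a => P.density a (f ω ω.2)) (history σ x t)) atTop (nhds 0) :=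
    ae_all_iff.2 fun ω => P.ae_tendsto_likelihoodRatio hσ (hfdom ω ω.2)
  have hqθ : ∀ ω : θ.Ω, (fun a => θ.q a ω) = fun a => P.density a ω := fun ω =>
    funext fun a => hq a ω ω.2
  have hqθc : ∀ ω : θc.Ω, (fun a => θc.q a ω) = fun a => P.density a ω := fun ω =>
    funext fun a => hqc a ω ω.2
  have hpos : ∀ ω (h : List (P.A × ℝ)), 0 < histProd (fun a => P.density a ω) h := fun ω h =>
    histProd_pos (fun a y => P.density_pos a ω y) h
  rw [not_lt, nonpos_iff_eq_zero]
  refine measure_mono_null ?_ (ae_iff.1 (htrue.and hcomp))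
  intro x hx hgood
  obtain ⟨hx₁, hx₂⟩ := hgood
  have hx : ∀ᶠ t in atTop, modelChoice P.env.α θ π₀ θc πc (history σ x t) = Label.initial := hx
  have hact : ∀ᶠ t in atTop, σ (history σ x t) = p (posterior θ π₀ (history σ x t)) := by
    filter_upwards [hx] with t ht
    rw [hσdef, switcherAction, ← hσdef, ht]
  -- Otherwise the effort settles at the single one where ω is exact. All other parameters are
  -- biased there and lose to the truth, hence to ω, so the posterior concentrates on ω. The policy
  -- then becomes myopic under ω, contradicting that a better effort exists.
  have hfreq : ∀ ω : θ.Ω, ∃ᶠ t in atTop, P.bias ω (σ (history σ x t)) ≠ 0 := by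
    intro ω
    by_contra hcon
    rw [not_frequently] at hcon
    simp only [not_not] at hcon
    obtain ⟨T, hT⟩ := eventually_atTop.1 hcon
    have hconst : ∀ t ≥ T, σ (history σ x t) = σ (history σ x T) := fun t ht =>
      hinj ω ω.2 _ _ (hT t ht) (hT T le_rfl)
    set a := σ (history σ x T) with ha
    have htail := history_tail_eq (σ := σ) (s := x) (f := fun a => P.density a ω)
      (g := fun a => P.density a !₂[P.bStar, P.wStar]) (fun a y => P.density_pos a _ y)
      fun t ht => P.density_eq_of_bias_eq_zero (hT t ht)
    have hother : ∀ ω' : θ.Ω, ω' ≠ ω → Tendsto (fun t => posterior θ π₀ (history σ x t) ω')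
        atTop (nhds 0) := by
      intro ω' hne
      have h1 := hx₁ ω' ((eventually_atTop.2 ⟨T, fun t ht h0 => hne (Subtype.ext
        (hsep ω' ω'.2 ω ω.2 _ h0 (hT t ht)))⟩ : ∀ᶠ t in atTop,
          P.bias ω' (σ (history σ x t)) ≠ 0)).frequently
      set c := histProd (fun a => P.density a ω) (history σ x T) /
        histProd (fun a => P.density a !₂[P.bStar, P.wStar]) (history σ x T) with hc
      have hc0 : 0 < c := div_pos (hpos _ _) (hpos _ _)
      have h2 := h1.const_mul (π₀ ω' / (π₀ ω * c))
      rw [mul_zero] at h2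
      refine squeeze_zero' (Eventually.of_forall fun t => (hθ.posterior_mem hπ _).1 ω') ?_ h2
      filter_upwards [eventually_ge_atTop T] with t ht
      rw [hθ.posterior_eq hπ, hqθ]
      have hL : π₀ ω * histProd (fun a => P.density a ω) (history σ x t)
          ≤ likelihood θ π₀ (history σ x t) := by
        rw [← hqθ ω]
        exact Finset.single_le_sum (f := fun ω => π₀ ω * histProd (fun a => θ.q a ω)
          (history σ x t)) (fun ω _ => (mul_pos (hπ.2 ω) (hθ.histProd_pos ω _)).le)
          (Finset.mem_univ ω)
      have h3 := htail t ht
      rw [div_eq_iff (hpos _ _).ne'] at h3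
      have hπω := hπ.2 ω
      have hp1 := hpos ω (history σ x t)
      have hp2 := hpos !₂[P.bStar, P.wStar] (history σ x t)
      calc π₀ ω' * histProd (fun a => P.density a ω') (history σ x t)
            / likelihood θ π₀ (history σ x t)
          ≤ π₀ ω' * histProd (fun a => P.density a ω') (history σ x t)
            / (π₀ ω * histProd (fun a => P.density a ω) (history σ x t)) := by
            refine div_le_div_of_nonneg_left ?_ (by positivity) hL
            exact (mul_pos (hπ.2 ω') (hpos _ _)).le
        _ = _ := by
            rw [h3]
            field_simp
    have hself : Tendsto (fun t => posterior θ π₀ (history σ x t) ω) atTop (nhds 1) := by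
      have h1 : ∀ t, posterior θ π₀ (history σ x t) ω
          = 1 - ∑ ω' ∈ Finset.univ.erase ω, posterior θ π₀ (history σ x t) ω' := by
        intro t
        rw [eq_sub_iff_add_eq, Finset.add_sum_erase _ _ (Finset.mem_univ ω)]
        exact (hθ.posterior_mem hπ _).2
      simp_rw [h1]
      have h2 := (tendsto_finsetSum (Finset.univ.erase ω) fun ω' hω' =>
        hother ω' (Finset.ne_of_mem_erase hω')).const_sub 1
      simpa using h2
    obtain ⟨κ, hκ, hnear⟩ := hθ.exists_myopic_near_vertex hp ω
    obtain ⟨t, ht1, ht2, ht3⟩ := ((hself.eventually_const_lt (sub_lt_self 1 hκ)).and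
      (hact.and (eventually_ge_atTop T))).exists
    have h4 := hnear _ (hθ.posterior_mem hπ _) ht1
    rw [← ht2, hconst t ht3] at h4
    obtain ⟨a', ha'⟩ := hno ω ω.2 a (hT T le_rfl)
    have h5 := h4 a'
    rw [P.meanPayoff_eq (hq _ ω ω.2), P.meanPayoff_eq (hq _ ω ω.2)] at h5
    exact absurd h5 (not_le.2 ha')
  -- Each parameter of θ vanishes relative to its dominator, which has positive prior mass in the
  -- competing model; finitely many such terms bound the whole Bayes factor.
  have hratio : Tendsto (fun t => likelihood θ π₀ (history σ x t)
      / likelihood θc πc (history σ x t)) atTop (nhds 0) := by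
    have h1 : Tendsto (fun t => ∑ ω : θ.Ω, π₀ ω / πc ⟨f ω ω.2, hf ω ω.2⟩ *
        (histProd (fun a => P.density a ω) (history σ x t) /
          histProd (fun a => P.density a (f ω ω.2)) (history σ x t))) atTop (nhds 0) := by
      have := tendsto_finsetSum Finset.univ fun (ω : θ.Ω) _ =>
        (hx₂ ω (hfreq ω)).const_mul (π₀ ω / πc ⟨f ω ω.2, hf ω ω.2⟩)
      simpa using this
    refine squeeze_zero (fun t => (div_pos (hθ.likelihood_pos hπ _)
      (hθc.likelihood_pos hπc _)).le) (fun t => ?_) h1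
    rw [likelihood_eq θ, Finset.sum_div]
    refine Finset.sum_le_sum fun ω _ => ?_
    rw [hqθ]
    have hL : πc ⟨f ω ω.2, hf ω ω.2⟩ * histProd (fun a => P.density a (f ω ω.2)) (history σ x t)
        ≤ likelihood θc πc (history σ x t) := by
      have := Finset.single_le_sum (f := fun ω => πc ω * histProd (fun a => θc.q a ω)
        (history σ x t)) (fun ω _ => (mul_pos (hπc.2 ω) (hθc.histProd_pos ω _)).le)
        (Finset.mem_univ (⟨f ω ω.2, hf ω ω.2⟩ : θc.Ω))
      rwa [hqθc ⟨f ω ω.2, hf ω ω.2⟩] at this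
    rw [div_mul_div_comm]
    exact div_le_div_of_nonneg_left (mul_pos (hπ.2 ω) (hpos _ _)).le
      (mul_pos (hπc.2 _) (hpos _ _)) hL
  have hα : 0 < P.env.α := by linarith [P.env.one_lt_α]
  have hev := hratio.eventually_lt_const (inv_pos.2 hα)
  -- Two consecutive periods with θ adopted, the second with a Bayes factor for the competitor above
  -- α: the switching rule forbids this.
  obtain ⟨t, ht1, ht2, ht3⟩ := (hx.and (((tendsto_add_atTop_nat 1).eventually hx).and
    ((tendsto_add_atTop_nat 1).eventually hev))).exists
  rw [history] at ht2 ht3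
  rcases modelChoice_cons_eq_initial.1 ht2 with h | h
  · refine absurd h.2 (not_le.2 ?_)
    rw [← inv_div]
    rw [lt_inv_comm₀ hα (div_pos (hθ.likelihood_pos hπ _) (hθc.likelihood_pos hπc _))]
    exact ht3
  · exact h.1 ht1

end TeamProblem

namespace TeamProblem

namespace Regular

variable {P : TeamProblem} (hP : P.Regular)
include hP

/-! ### Single crossing -/

theorem differentiableAt {a b w : ℝ} (ha : a ∈ convexHull ℝ (P.A : Set ℝ))
    (hb : b ∈ Icc P.bLo P.bHi) (hw : w ∈ Icc P.wLo P.wHi) :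
    DifferentiableAt ℝ (fun x : ℝ × ℝ × ℝ => P.g x.1 x.2.1 x.2.2) (a, b, w) :=
  (hP.contDiff a ha b hb w hw).differentiableAt (by norm_num)

theorem differentiableAt_effort {a b w : ℝ} (ha : a ∈ convexHull ℝ (P.A : Set ℝ))
    (hb : b ∈ Icc P.bLo P.bHi) (hw : w ∈ Icc P.wLo P.wHi) :
    DifferentiableAt ℝ (fun a => P.g a b w) a :=
  (hP.differentiableAt ha hb hw).comp (f := fun a : ℝ => ((a, b, w) : ℝ × ℝ × ℝ)) a (by fun_prop)

/-- The marginal product of effort is differentiable in all arguments. -/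
theorem differentiableAt_deriv {a b w : ℝ} (ha : a ∈ convexHull ℝ (P.A : Set ℝ))
    (hb : b ∈ Icc P.bLo P.bHi) (hw : w ∈ Icc P.wLo P.wHi) :
    DifferentiableAt ℝ (fun x : ℝ × ℝ × ℝ => deriv (fun a => P.g a x.2.1 x.2.2) x.1)
      (a, b, w) := by
  have h := hP.contDiff a ha b hb w hw
  have h1 : DifferentiableAt ℝ (fderiv ℝ fun x : ℝ × ℝ × ℝ => P.g x.1 x.2.1 x.2.2) (a, b, w) :=
    (h.fderiv_right (m := 1) (by norm_num)).differentiableAt (by norm_num)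
  -- The marginal product is the total derivative in the direction (1, 0, 0), and the total
  -- derivative of a C² function is differentiable.
  have h2 : DifferentiableAt ℝ (fun x => fderiv ℝ (fun x : ℝ × ℝ × ℝ => P.g x.1 x.2.1 x.2.2) x
      (1, 0, 0)) (a, b, w) := h1.clm_apply (by fun_prop)
  refine h2.congr_of_eventuallyEq ?_
  filter_upwards [h.eventually (by simp)] with x hx
  have h3 : HasDerivAt (fun t : ℝ => ((t, x.2.1, x.2.2) : ℝ × ℝ × ℝ)) (1, 0, 0) x.1 :=
    (hasDerivAt_id _).prodMk ((hasDerivAt_const _ _).prodMk (hasDerivAt_const _ _))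
  have h4 := (hx.differentiableAt (by norm_num)).hasFDerivAt
  exact (HasFDerivAt.comp_hasDerivAt (f := fun t : ℝ => ((t, x.2.1, x.2.2) : ℝ × ℝ × ℝ))
    x.1 h4 h3).deriv

theorem continuousOn_params {a : ℝ} (ha : a ∈ convexHull ℝ (P.A : Set ℝ)) :
    ContinuousOn (fun x : ℝ × ℝ => P.g a x.1 x.2) (Icc P.bLo P.bHi ×ˢ Icc P.wLo P.wHi) := by
  rintro ⟨b, w⟩ ⟨hb, hw⟩
  exact ((hP.differentiableAt ha hb hw).continuousAt.comp
    (f := fun x : ℝ × ℝ => ((a, x.1, x.2) : ℝ × ℝ × ℝ)) (by fun_prop)).continuousWithinAt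

theorem continuousAt_ability {a b w : ℝ} (ha : a ∈ convexHull ℝ (P.A : Set ℝ))
    (hb : b ∈ Icc P.bLo P.bHi) (hw : w ∈ Icc P.wLo P.wHi) :
    ContinuousAt (fun b => P.g a b w) b :=
  (hP.differentiableAt ha hb hw).continuousAt.comp
    (f := fun b : ℝ => ((a, b, w) : ℝ × ℝ × ℝ)) (by fun_prop)

theorem continuousAt_teammate {a b w : ℝ} (ha : a ∈ convexHull ℝ (P.A : Set ℝ))
    (hb : b ∈ Icc P.bLo P.bHi) (hw : w ∈ Icc P.wLo P.wHi) :
    ContinuousAt (fun w => P.g a b w) w :=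
  (hP.differentiableAt ha hb hw).continuousAt.comp
    (f := fun w : ℝ => ((a, b, w) : ℝ × ℝ × ℝ)) (by fun_prop)

theorem continuousOn_effort {b w : ℝ} (hb : b ∈ Icc P.bLo P.bHi) (hw : w ∈ Icc P.wLo P.wHi) :
    ContinuousOn (fun a => P.g a b w) (convexHull ℝ (P.A : Set ℝ)) := fun _ ha =>
  (hP.differentiableAt_effort ha hb hw).continuousAt.continuousWithinAt

theorem deriv_lt {a b₁ b₂ w₁ w₂ : ℝ} (ha : a ∈ convexHull ℝ (P.A : Set ℝ))
    (hb₁ : b₁ ∈ Icc P.bLo P.bHi) (hb₂ : b₂ ∈ Icc P.bLo P.bHi) (hw₁ : w₁ ∈ Icc P.wLo P.wHi)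
    (hw₂ : w₂ ∈ Icc P.wLo P.wHi) (hb : b₁ ≤ b₂) (hw : w₂ < w₁) :
    deriv (fun a => P.g a b₂ w₂) a < deriv (fun a => P.g a b₁ w₁) a := by
  have h1 : AntitoneOn (fun b => deriv (fun a => P.g a b w₁) a) (Icc P.bLo P.bHi) := by
    have hd : ∀ b ∈ Icc P.bLo P.bHi, DifferentiableAt ℝ (fun b => deriv (fun a => P.g a b w₁) a) b :=
      fun b hb => (hP.differentiableAt_deriv ha hb hw₁).comp
        (f := fun b : ℝ => ((a, b, w₁) : ℝ × ℝ × ℝ)) b (by fun_prop)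
    refine antitoneOn_of_deriv_nonpos (convex_Icc _ _)
      (fun b hb => (hd b hb).continuousAt.continuousWithinAt)
      (fun b hb => (hd b (interior_subset hb)).differentiableWithinAt) fun b hb => ?_
    exact hP.g_ab_nonpos a ha b (interior_subset hb) w₁ hw₁
  have h2 : StrictMonoOn (fun w => deriv (fun a => P.g a b₂ w) a) (Icc P.wLo P.wHi) := by
    have hd : ∀ w ∈ Icc P.wLo P.wHi, DifferentiableAt ℝ (fun w => deriv (fun a => P.g a b₂ w) a) w :=
      fun w hw => (hP.differentiableAt_deriv ha hb₂ hw).comp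
        (f := fun w : ℝ => ((a, b₂, w) : ℝ × ℝ × ℝ)) w (by fun_prop)
    refine strictMonoOn_of_deriv_pos (convex_Icc _ _)
      (fun w hw => (hd w hw).continuousAt.continuousWithinAt) fun w hw => ?_
    exact hP.g_aw_pos a ha b₂ hb₂ w (interior_subset hw)
  exact (h2 hw₂ hw₁ hw).trans_le (h1 hb₁ hb₂ hb)

/-- A higher teammate ability and a lower own ability raise the returns to effort. -/
theorem strictMonoOn_sub {b₁ b₂ w₁ w₂ : ℝ}
    (hb₁ : b₁ ∈ Icc P.bLo P.bHi) (hb₂ : b₂ ∈ Icc P.bLo P.bHi) (hw₁ : w₁ ∈ Icc P.wLo P.wHi)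
    (hw₂ : w₂ ∈ Icc P.wLo P.wHi) (hb : b₁ ≤ b₂) (hw : w₂ < w₁) :
    StrictMonoOn (fun a => P.g a b₁ w₁ - P.g a b₂ w₂) (convexHull ℝ (P.A : Set ℝ)) := by
  refine strictMonoOn_of_deriv_pos (convex_convexHull ℝ _)
    ((hP.continuousOn_effort hb₁ hw₁).sub (hP.continuousOn_effort hb₂ hw₂)) fun a ha => ?_
  have ha := interior_subset ha
  rw [deriv_fun_sub (hP.differentiableAt_effort ha hb₁ hw₁)
    (hP.differentiableAt_effort ha hb₂ hw₂), sub_pos]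
  exact hP.deriv_lt ha hb₁ hb₂ hw₁ hw₂ hb hw

theorem strictConcaveOn {b w : ℝ} (hb : b ∈ Icc P.bLo P.bHi) (hw : w ∈ Icc P.wLo P.wHi) :
    StrictConcaveOn ℝ (convexHull ℝ (P.A : Set ℝ)) fun a => P.g a b w :=
  strictConcaveOn_of_deriv2_neg (convex_convexHull ℝ _) (hP.continuousOn_effort hb hw)
    fun a ha => by simpa using hP.g_aa_neg a (interior_subset ha) b hb w hw

/-- Strict concavity: an intermediate effort beats the worse of two outer ones. It excludes ties of
a maximizer with efforts on both sides. -/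
theorem min_lt {b w a₁ a₂ a₃ : ℝ} (hb : b ∈ Icc P.bLo P.bHi) (hw : w ∈ Icc P.wLo P.wHi)
    (h₁ : a₁ ∈ P.A) (h₃ : a₃ ∈ P.A) (h₁₂ : a₁ < a₂) (h₂₃ : a₂ < a₃) :
    min (P.g a₁ b w) (P.g a₃ b w) < P.g a₂ b w := by
  refine (hP.strictConcaveOn hb hw).lt_on_openSegment (subset_convexHull ℝ _ h₁)
    (subset_convexHull ℝ _ h₃) (h₁₂.trans h₂₃).ne ?_
  rw [openSegment_eq_Ioo (h₁₂.trans h₂₃)]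
  exact ⟨h₁₂, h₂₃⟩

end Regular

/-! ### Fitted abilities and self-confirming efforts -/

/-- The teammate's ability that matches the true mean output at the effort `a`, given the own
ability `b`. -/
noncomputable def fit (P : TeamProblem) (a b : ℝ) : ℝ :=
  Classical.epsilon fun w => w ∈ Icc P.wLo P.wHi ∧ P.g a b w = P.g a P.bStar P.wStar

/-- The effort `a` is optimal under the parameter that matches the truth at `a`. -/
def SelfConfirming (P : TeamProblem) (a b : ℝ) : Prop :=
  ∀ a' ∈ P.A, P.g a' b (P.fit a b) ≤ P.g a b (P.fit a b)

namespace Regular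

variable {P : TeamProblem} (hP : P.Regular)
include hP

theorem fit_spec {a b : ℝ} (ha : a ∈ P.A) (hb : b ∈ Icc P.bLo P.bHi) :
    P.fit a b ∈ Icc P.wLo P.wHi ∧ P.g a b (P.fit a b) = P.g a P.bStar P.wStar :=
  Classical.epsilon_spec (p := fun w => w ∈ Icc P.wLo P.wHi ∧ P.g a b w = P.g a P.bStar P.wStar)
    (hP.exists_fit a ha b hb)

theorem eq_of_fit {a b w w' : ℝ} (ha : a ∈ convexHull ℝ (P.A : Set ℝ)) (hb : b ∈ Icc P.bLo P.bHi)
    (hw : w ∈ Icc P.wLo P.wHi) (hw' : w' ∈ Icc P.wLo P.wHi) (h : P.g a b w = P.g a b w') :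
    w = w' :=
  (hP.strictMono_w a ha b hb).injOn hw hw' h

theorem fit_eq {a b w : ℝ} (ha : a ∈ P.A) (hb : b ∈ Icc P.bLo P.bHi) (hw : w ∈ Icc P.wLo P.wHi)
    (h : P.g a b w = P.g a P.bStar P.wStar) : P.fit a b = w :=
  hP.eq_of_fit (subset_convexHull ℝ _ ha) hb (hP.fit_spec ha hb).1 hw
    ((hP.fit_spec ha hb).2.trans h.symm)

/-- Output increases in both abilities, so equal output with a higher own ability needs a lower
teammate's ability. -/
theorem lt_of_fit {a b₁ b₂ w₁ w₂ : ℝ} (ha : a ∈ convexHull ℝ (P.A : Set ℝ))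
    (hb₁ : b₁ ∈ Icc P.bLo P.bHi) (hb₂ : b₂ ∈ Icc P.bLo P.bHi) (hw₁ : w₁ ∈ Icc P.wLo P.wHi)
    (hw₂ : w₂ ∈ Icc P.wLo P.wHi) (hb : b₁ < b₂) (h : P.g a b₁ w₁ = P.g a b₂ w₂) : w₂ < w₁ := by
  by_contra hcon
  have h1 := (hP.strictMono_w a ha b₁ hb₁).monotoneOn hw₁ hw₂ (not_lt.1 hcon)
  have h2 := hP.strictMono_b a ha w₂ hw₂ hb₁ hb₂ hb
  simp only at h1 h2
  linarith

theorem fit_lt {a b₁ b₂ : ℝ} (ha : a ∈ P.A) (hb₁ : b₁ ∈ Icc P.bLo P.bHi)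
    (hb₂ : b₂ ∈ Icc P.bLo P.bHi) (hb : b₁ < b₂) : P.fit a b₂ < P.fit a b₁ :=
  hP.lt_of_fit (subset_convexHull ℝ _ ha) hb₁ hb₂ (hP.fit_spec ha hb₁).1 (hP.fit_spec ha hb₂).1 hb
    ((hP.fit_spec ha hb₁).2.trans (hP.fit_spec ha hb₂).2.symm)

theorem fit_bStar {a : ℝ} (ha : a ∈ P.A) : P.fit a P.bStar = P.wStar :=
  hP.fit_eq ha P.bStar_mem P.wStar_mem rfl

/-- Moving b up along the fit at a lowers the returns to effort while output at a stays pinned to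
the truth, so predictions above a fall; in `lt_of_lower` those below a rise. -/
theorem lt_of_higher {a a' b₁ b₂ : ℝ} (ha : a ∈ P.A) (ha' : a' ∈ P.A)
    (hb₁ : b₁ ∈ Icc P.bLo P.bHi) (hb₂ : b₂ ∈ Icc P.bLo P.bHi) (hb : b₁ < b₂) (h : a < a') :
    P.g a' b₂ (P.fit a b₂) < P.g a' b₁ (P.fit a b₁) := by
  have h1 := hP.strictMonoOn_sub hb₁ hb₂ (hP.fit_spec ha hb₁).1 (hP.fit_spec ha hb₂).1 hb.le
    (hP.fit_lt ha hb₁ hb₂ hb) (subset_convexHull ℝ _ ha) (subset_convexHull ℝ _ ha') h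
  have h2 := (hP.fit_spec ha hb₁).2
  have h3 := (hP.fit_spec ha hb₂).2
  simp only at h1
  linarith

theorem lt_of_lower {a a' b₁ b₂ : ℝ} (ha : a ∈ P.A) (ha' : a' ∈ P.A)
    (hb₁ : b₁ ∈ Icc P.bLo P.bHi) (hb₂ : b₂ ∈ Icc P.bLo P.bHi) (hb : b₁ < b₂) (h : a' < a) :
    P.g a' b₁ (P.fit a b₁) < P.g a' b₂ (P.fit a b₂) := by
  have h1 := hP.strictMonoOn_sub hb₁ hb₂ (hP.fit_spec ha hb₁).1 (hP.fit_spec ha hb₂).1 hb.le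
    (hP.fit_lt ha hb₁ hb₂ hb) (subset_convexHull ℝ _ ha') (subset_convexHull ℝ _ ha) h
  have h2 := (hP.fit_spec ha hb₁).2
  have h3 := (hP.fit_spec ha hb₂).2
  simp only at h1
  linarith

/-- A bound strictly on one side of the fitted value gives a strict inequality of outputs. This
survives small changes of b and, by monotonicity in w, transfers back to the fit. -/
theorem continuousOn_fit {a : ℝ} (ha : a ∈ P.A) :
    ContinuousOn (P.fit a) (Icc P.bLo P.bHi) := by
  have haH := subset_convexHull ℝ (P.A : Set ℝ) ha
  intro b₀ hb₀
  obtain ⟨hw₀, hg₀⟩ := hP.fit_spec ha hb₀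
  have hmono := hP.strictMono_w a haH
  rw [ContinuousWithinAt, tendsto_order]
  constructor
  · intro l hl
    by_cases hlW : P.wLo ≤ l
    · have hlm : l ∈ Icc P.wLo P.wHi := ⟨hlW, hl.le.trans hw₀.2⟩
      have h1 : P.g a b₀ l < P.g a P.bStar P.wStar := by
        rw [← hg₀]; exact hmono b₀ hb₀ hlm hw₀ hl
      have h2 := (hP.continuousAt_ability haH hb₀ hlm).eventually_lt continuousAt_const h1
      filter_upwards [nhdsWithin_le_nhds h2, self_mem_nhdsWithin] with b hb hbm
      rw [← (hP.fit_spec ha hbm).2] at hb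
      exact ((hmono b hbm).lt_iff_lt hlm (hP.fit_spec ha hbm).1).1 hb
    · filter_upwards [self_mem_nhdsWithin] with b hbm
      exact (not_le.1 hlW).trans_le (hP.fit_spec ha hbm).1.1
  · intro u hu
    by_cases huW : u ≤ P.wHi
    · have hum : u ∈ Icc P.wLo P.wHi := ⟨hw₀.1.trans hu.le, huW⟩
      have h1 : P.g a P.bStar P.wStar < P.g a b₀ u := by
        rw [← hg₀]; exact hmono b₀ hb₀ hw₀ hum hu
      have h2 := continuousAt_const.eventually_lt (hP.continuousAt_ability haH hb₀ hum) h1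
      filter_upwards [nhdsWithin_le_nhds h2, self_mem_nhdsWithin] with b hb hbm
      rw [← (hP.fit_spec ha hbm).2] at hb
      exact ((hmono b hbm).lt_iff_lt (hP.fit_spec ha hbm).1 hum).1 hb
    · filter_upwards [self_mem_nhdsWithin] with b hbm
      exact (hP.fit_spec ha hbm).1.2.trans_lt (not_le.1 huW)

theorem continuousOn_fitted {a a' : ℝ} (ha : a ∈ P.A) (ha' : a' ∈ P.A) :
    ContinuousOn (fun b => P.g a' b (P.fit a b)) (Icc P.bLo P.bHi) :=
  (hP.continuousOn_params (subset_convexHull ℝ _ ha')).comp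
    (continuousOn_id.prodMk (hP.continuousOn_fit ha)) fun _ hb => ⟨hb, (hP.fit_spec ha hb).1⟩

theorem isClosed_selfConfirming {a : ℝ} (ha : a ∈ P.A) {c : ℝ} (hc : c ≤ P.bHi) :
    IsClosed {b | b ∈ Icc P.bLo c ∧ P.SelfConfirming a b} := by
  have hsub : Icc P.bLo c ⊆ Icc P.bLo P.bHi := Icc_subset_Icc_right hc
  have : {b | b ∈ Icc P.bLo c ∧ P.SelfConfirming a b} = ⋂ a' : P.A, Icc P.bLo c ∩
      (fun b => P.g a' b (P.fit a b) - P.g a b (P.fit a b)) ⁻¹' Iic 0 := by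
    ext b
    have : Nonempty P.A := inferInstance
    simp [SelfConfirming, forall_and]
  rw [this]
  refine isClosed_iInter fun a' => ContinuousOn.preimage_isClosed_of_isClosed ?_ isClosed_Icc
    isClosed_Iic
  exact ((hP.continuousOn_fitted ha a'.2).mono hsub).sub ((hP.continuousOn_fitted ha ha).mono hsub)

/-- Under underconfidence a matching parameter overstates the returns to effort. -/
theorem strictMonoOn_bias {b w a₀ : ℝ} (ha₀ : a₀ ∈ convexHull ℝ (P.A : Set ℝ))
    (hb : b ∈ Icc P.bLo P.bHi) (hbs : b < P.bStar) (hw : w ∈ Icc P.wLo P.wHi)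
    (h : P.g a₀ b w = P.g a₀ P.bStar P.wStar) :
    StrictMonoOn (fun a => P.g a b w - P.g a P.bStar P.wStar) (convexHull ℝ (P.A : Set ℝ)) :=
  hP.strictMonoOn_sub hb P.bStar_mem hw P.wStar_mem hbs.le
    (hP.lt_of_fit ha₀ hb P.bStar_mem hw P.wStar_mem hbs h)

/-- Underconfidence creates a negative feedback. The fit at a lower effort overpredicts at a higher
one, so the higher effort has the lower fit and hence lower returns, under which it cannot become
the preferred effort. -/
theorem selfConfirming_unique {a a' b : ℝ} (ha : a ∈ P.A) (ha' : a' ∈ P.A)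
    (hb : b ∈ Icc P.bLo P.bHi) (hbs : b < P.bStar) (h : P.SelfConfirming a b)
    (h' : P.SelfConfirming a' b) : a = a' := by
  wlog haa : a < a' generalizing a a' with H
  · rcases lt_trichotomy a a' with h1 | h1 | h1
    · exact absurd h1 haa
    · exact h1
    · exact (H ha' ha h' h h1).symm
  exfalso
  have haH := subset_convexHull ℝ (P.A : Set ℝ) ha
  have haH' := subset_convexHull ℝ (P.A : Set ℝ) ha'
  obtain ⟨hw, hg⟩ := hP.fit_spec ha hb
  obtain ⟨hw', hg'⟩ := hP.fit_spec ha' hb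
  have h1 := hP.strictMonoOn_bias haH hb hbs hw hg haH haH' haa
  have h2 : P.fit a' b < P.fit a b := by
    refine ((hP.strictMono_w a' haH' b hb).lt_iff_lt hw' hw).1 ?_
    simp only at h1 ⊢
    linarith
  have h3 := hP.strictMonoOn_sub hb hb hw hw' le_rfl h2 haH haH' haa
  have h4 := h a' ha'
  have h5 := h' a ha
  simp only at h3
  linarith

/-- Away from the boundary a self-confirming effort remains so on one side. -/
theorem selfConfirming_side {a b : ℝ} (ha : a ∈ P.A) (hb : b ∈ Ioo P.bLo P.bStar)
    (h : P.SelfConfirming a b) :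
    (∃ c < b, Ioo c b ⊆ {b' | b' ∈ Icc P.bLo P.bStar ∧ P.SelfConfirming a b'}) ∨
      ∃ c > b, Ioo b c ⊆ {b' | b' ∈ Icc P.bLo P.bStar ∧ P.SelfConfirming a b'} := by
  have hs := P.bStar_mem
  have hbI : b ∈ Icc P.bLo P.bHi := ⟨hb.1.le, hb.2.le.trans hs.2⟩
  obtain ⟨hw, hg⟩ := hP.fit_spec ha hbI
  have hcont : ∀ a' ∈ P.A, P.g a' b (P.fit a b) < P.g a b (P.fit a b) →
      ∀ᶠ b' in nhds b, b' ∈ Icc P.bLo P.bHi →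
        P.g a' b' (P.fit a b') < P.g a b' (P.fit a b') := by
    intro a' ha' hlt
    have := ((hP.continuousOn_fitted ha ha') b hbI).eventually_lt
      ((hP.continuousOn_fitted ha ha) b hbI) hlt
    exact eventually_nhdsWithin_iff.1 this
  have hev : ∀ T : ℝ → Prop, (∀ a' ∈ P.A, T a' → P.g a' b (P.fit a b) < P.g a b (P.fit a b)) →
      ∀ᶠ b' in nhds b, ∀ a' : P.A, T a' → b' ∈ Icc P.bLo P.bHi →
        P.g a' b' (P.fit a b') < P.g a b' (P.fit a b') := by
    intro T hT
    rw [eventually_all]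
    intro a'
    by_cases h1 : T a'
    · filter_upwards [hcont a' a'.2 (hT a' a'.2 h1)] with b' hb' _ using hb'
    · exact Eventually.of_forall fun _ h2 => absurd h2 h1
  -- With a tie from above, strict concavity makes all lower efforts strictly worse; increasing b
  -- hurts the higher efforts and continuity controls the lower ones. Without such a tie, decreasing
  -- b does the same with the roles exchanged.
  by_cases htie : ∃ a' ∈ P.A, a < a' ∧ P.g a' b (P.fit a b) = P.g a b (P.fit a b)
  · right
    obtain ⟨a₃, ha₃, haa₃, heq⟩ := htie
    have hlow : ∀ a' ∈ P.A, a' < a → P.g a' b (P.fit a b) < P.g a b (P.fit a b) := by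
      intro a' ha' hlt
      have := hP.min_lt hbI hw ha' ha₃ hlt haa₃
      rw [heq, min_lt_iff] at this
      exact this.resolve_right (lt_irrefl _)
    obtain ⟨ε, hε, hball⟩ := Metric.eventually_nhds_iff.1 (hev _ hlow)
    refine ⟨min (b + ε) P.bStar, lt_min (by linarith) hb.2, fun b' hb' => ?_⟩
    have h2 := hb'.2.trans_le (min_le_left _ _)
    have h3 := hb'.2.trans_le (min_le_right _ _)
    have hb'I : b' ∈ Icc P.bLo P.bHi := ⟨hb.1.le.trans hb'.1.le, h3.le.trans hs.2⟩
    refine ⟨⟨hb'I.1, h3.le⟩, fun a' ha' => ?_⟩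
    rcases lt_trichotomy a' a with h4 | rfl | h4
    · refine (hball ?_ ⟨a', ha'⟩ h4 hb'I).le
      rw [Real.dist_eq, abs_lt]; constructor <;> linarith [hb'.1]
    · exact le_rfl
    · have h5 := hP.lt_of_higher ha ha' hbI hb'I hb'.1 h4
      have h6 := h a' ha'
      have h7 := (hP.fit_spec ha hb'I).2
      linarith
  · left
    have hhigh : ∀ a' ∈ P.A, a < a' → P.g a' b (P.fit a b) < P.g a b (P.fit a b) :=
      fun a' ha' hlt => lt_of_le_of_ne (h a' ha') fun heq => htie ⟨a', ha', hlt, heq⟩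
    obtain ⟨ε, hε, hball⟩ := Metric.eventually_nhds_iff.1 (hev _ hhigh)
    refine ⟨max (b - ε) P.bLo, max_lt (by linarith) hb.1, fun b' hb' => ?_⟩
    have h2 := (le_max_left _ _).trans_lt hb'.1
    have h3 := (le_max_right _ _).trans_lt hb'.1
    have hb'I : b' ∈ Icc P.bLo P.bHi := ⟨h3.le, hb'.2.le.trans hbI.2⟩
    refine ⟨⟨hb'I.1, hb'.2.le.trans hb.2.le⟩, fun a' ha' => ?_⟩
    rcases lt_trichotomy a' a with h4 | rfl | h4
    · have h5 := hP.lt_of_lower ha ha' hb'I hbI hb'.2 h4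
      have h6 := h a' ha'
      have h7 := (hP.fit_spec ha hb'I).2
      linarith
    · exact le_rfl
    · refine (hball ?_ ⟨a', ha'⟩ h4 hb'I).le
      rw [Real.dist_eq, abs_lt]; constructor <;> linarith [hb'.2]

/-- Some effort is self-confirming under mild underconfidence. -/
theorem exists_selfConfirming_near (hlt : P.bLo < P.bStar) : ∃ a ∈ P.A, ∃ c < P.bStar,
    Ioo c P.bStar ⊆ {b' | b' ∈ Icc P.bLo P.bStar ∧ P.SelfConfirming a b'} := by
  have hs := P.bStar_mem
  obtain ⟨a₁, ha₁, hmax⟩ := P.A.exists_max_image (fun a => P.g a P.bStar P.wStar) P.A_nonempty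
  let M := P.A.filter fun a => ∀ a' ∈ P.A, P.g a' P.bStar P.wStar ≤ P.g a P.bStar P.wStar
  have hM : M.Nonempty := ⟨a₁, Finset.mem_filter.2 ⟨ha₁, hmax⟩⟩
  obtain ⟨ha, hbest⟩ := Finset.mem_filter.1 (M.max'_mem hM)
  -- The largest effort that is optimal at the truth: higher efforts are strictly worse, and ties
  -- with lower ones are broken in its favour when b falls below b*.
  set a := M.max' hM with hadef
  have hhigh : ∀ a' ∈ P.A, a < a' → P.g a' P.bStar P.wStar < P.g a P.bStar P.wStar := by
    intro a' ha' h
    by_contra hcon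
    have : a' ∈ M := Finset.mem_filter.2 ⟨ha', fun a'' h'' => (hbest a'' h'').trans (not_lt.1 hcon)⟩
    exact absurd h (not_lt.2 (M.le_max' a' this))
  have hev : ∀ᶠ b' in nhds P.bStar, ∀ a' : P.A, a < a' → b' ∈ Icc P.bLo P.bHi →
        P.g a' b' (P.fit a b') < P.g a b' (P.fit a b') := by
    rw [eventually_all]
    intro a'
    by_cases h1 : a < a'
    · have := ((hP.continuousOn_fitted ha a'.2) P.bStar hs).eventually_lt
        ((hP.continuousOn_fitted ha ha) P.bStar hs)
        (by simpa only [hP.fit_bStar ha] using hhigh a' a'.2 h1)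
      filter_upwards [eventually_nhdsWithin_iff.1 this] with b' hb' _ using hb'
    · exact Eventually.of_forall fun _ h2 => absurd h2 h1
  obtain ⟨ε, hε, hball⟩ := Metric.eventually_nhds_iff.1 hev
  refine ⟨a, ha, max (P.bStar - ε) P.bLo, max_lt (by linarith) hlt, fun b' hb' => ?_⟩
  have h2 := (le_max_left _ _).trans_lt hb'.1
  have h3 := (le_max_right _ _).trans_lt hb'.1
  have hb'I : b' ∈ Icc P.bLo P.bHi := ⟨h3.le, hb'.2.le.trans hs.2⟩
  refine ⟨⟨hb'I.1, hb'.2.le⟩, fun a' ha' => ?_⟩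
  rcases lt_trichotomy a' a with h4 | h4 | h4
  · have h5 := hP.lt_of_lower ha ha' hb'I hs hb'.2 h4
    rw [hP.fit_bStar ha] at h5
    have h6 := hbest a' ha'
    have h7 := (hP.fit_spec ha hb'I).2
    linarith
  · rw [h4]
  · refine (hball ?_ ⟨a', ha'⟩ h4 hb'I).le
    rw [Real.dist_eq, abs_lt]; constructor <;> linarith [hb'.2]

end Regular

/-! ### Parameters that match the truth wherever they are optimal -/

/-- At the self-perception `b`, some teammate's ability matches the truth at every effort that is
optimal under it. -/
def HasStrictFit (P : TeamProblem) (b : ℝ) : Prop :=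
  ∃ w ∈ Icc P.wLo P.wHi, ∃ a ∈ P.A, P.g a b w = P.g a P.bStar P.wStar ∧
    ∀ a ∈ P.A, (∀ a' ∈ P.A, P.g a' b w ≤ P.g a b w) → P.g a b w = P.g a P.bStar P.wStar

namespace Regular

variable {P : TeamProblem} (hP : P.Regular)
include hP

theorem hasStrictFit_of_strict {a b : ℝ} (ha : a ∈ P.A) (hb : b ∈ Icc P.bLo P.bHi)
    (h : ∀ a' ∈ P.A, a' ≠ a → P.g a' b (P.fit a b) < P.g a b (P.fit a b)) :
    P.HasStrictFit b := by
  obtain ⟨hw, hg⟩ := hP.fit_spec ha hb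
  refine ⟨_, hw, a, ha, hg, fun a' ha' hbest => ?_⟩
  by_cases heq : a' = a
  · rw [heq, hg]
  · exact absurd (hbest a ha) (not_le.2 (h a' ha' heq))

/-- The weak optimality at b₁ turns strict against higher efforts when b increases, and that at b₂
turns strict against lower efforts when b decreases. -/
theorem hasStrictFit_between {a b b₁ b₂ : ℝ} (ha : a ∈ P.A) (hb₁ : b₁ ∈ Icc P.bLo P.bHi)
    (hb₂ : b₂ ∈ Icc P.bLo P.bHi) (h₁ : b₁ < b) (h₂ : b < b₂) (hs₁ : P.SelfConfirming a b₁)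
    (hs₂ : P.SelfConfirming a b₂) : P.HasStrictFit b := by
  have hb : b ∈ Icc P.bLo P.bHi := ⟨hb₁.1.trans h₁.le, h₂.le.trans hb₂.2⟩
  refine hP.hasStrictFit_of_strict ha hb fun a' ha' hne => ?_
  have h0 := (hP.fit_spec ha hb).2
  have h3 := (hP.fit_spec ha hb₁).2
  have h4 := (hP.fit_spec ha hb₂).2
  have h5 := hs₁ a' ha'
  have h6 := hs₂ a' ha'
  rcases lt_or_gt_of_ne hne with h | h
  · have := hP.lt_of_lower ha ha' hb hb₂ h₂ h
    linarith
  · have := hP.lt_of_higher ha ha' hb₁ hb h₁ h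
    linarith

theorem hasStrictFit_of_ge {b : ℝ} (hb : b ∈ Icc P.bLo P.bHi) (hbs : P.bStar ≤ b) :
    P.HasStrictFit b := by
  rcases hbs.eq_or_lt with rfl | hbs
  · obtain ⟨a, ha⟩ := P.A_nonempty
    exact ⟨P.wStar, P.wStar_mem, a, ha, rfl, fun _ _ _ => rfl⟩
  -- Overconfidence reverses the feedback: a fitted parameter understates the returns to effort, so
  -- it underpredicts above its match and the fit increases with effort.
  have hfit_mono : ∀ a ∈ P.A, ∀ a' ∈ P.A, a < a' → P.fit a b < P.fit a' b := by
    intro a ha a' ha' h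
    have haH' := subset_convexHull ℝ (P.A : Set ℝ) ha'
    obtain ⟨hw, hg⟩ := hP.fit_spec ha hb
    obtain ⟨hw', hg'⟩ := hP.fit_spec ha' hb
    have haH := subset_convexHull ℝ (P.A : Set ℝ) ha
    have h1 := hP.strictMonoOn_sub P.bStar_mem hb P.wStar_mem hw hbs.le
      (hP.lt_of_fit haH P.bStar_mem hb P.wStar_mem hw hbs hg.symm) haH haH' h
    refine ((hP.strictMono_w a' haH' b hb).lt_iff_lt hw hw').1 ?_
    simp only at h1 ⊢
    linarith
  -- The least effort that, under its own fit, strictly beats all higher ones. An optimum below it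
  -- under that fit would, under its own lower fit, belong to `T` as well; so the least element is
  -- the unique optimum.
  let T := P.A.filter fun a => ∀ a' ∈ P.A, a < a' → P.g a' b (P.fit a b) < P.g a b (P.fit a b)
  have hT : T.Nonempty := ⟨P.A.max' P.A_nonempty, Finset.mem_filter.2 ⟨P.A.max'_mem _,
    fun a' ha' h => absurd (P.A.le_max' a' ha') (not_le.2 h)⟩⟩
  obtain ⟨ha, hhigh⟩ := Finset.mem_filter.1 (T.min'_mem hT)
  set a := T.min' hT with hadef
  obtain ⟨c, hc, hcmax⟩ := P.A.exists_max_image (fun c => P.g c b (P.fit a b)) P.A_nonempty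
  have key : ∀ c ∈ P.A, (∀ a' ∈ P.A, P.g a' b (P.fit a b) ≤ P.g c b (P.fit a b)) → c = a := by
    intro c hc hcmax
    rcases lt_trichotomy c a with h | h | h
    · exfalso
      have hcT : c ∈ T := by
        refine Finset.mem_filter.2 ⟨hc, fun a' ha' h' => ?_⟩
        have h1 := hP.strictMonoOn_sub hb hb (hP.fit_spec ha hb).1 (hP.fit_spec hc hb).1 le_rfl
          (hfit_mono c hc a ha h) (subset_convexHull ℝ _ hc) (subset_convexHull ℝ _ ha') h'
        have h2 := hcmax a' ha'
        simp only at h1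
        linarith
      exact absurd h (not_lt.2 (T.min'_le c hcT))
    · exact h
    · exact absurd (hcmax a ha) (not_le.2 (hhigh c hc h))
  refine hP.hasStrictFit_of_strict ha hb fun a' ha' hne => ?_
  have hca := key c hc hcmax
  rw [hca] at hcmax
  refine lt_of_le_of_ne (hcmax a' ha') fun heq => hne (key a' ha' fun a'' h'' => ?_)
  rw [heq]
  exact hcmax a'' h''

end Regular

end TeamProblem

/-! ### Alternating sequences of interval endpoints -/

/-- Immediately below l, the set S i is absent because l is its least point, and the other sets
because they are closed and miss l. -/
theorem exists_gap_below {ι : Type*} [Finite ι] {S : ι → Set ℝ} {hi : ℝ}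
    (hclosed : ∀ i, IsClosed (S i))
    (huniq : ∀ i j b, b < hi → b ∈ S i → b ∈ S j → i = j) {i : ι} {l : ℝ} (hl : IsLeast (S i) l)
    (hlhi : l < hi) : ∃ y < l, ∀ j, ∀ b ∈ Ioo y l, b ∉ S j := by
  have hev : ∀ᶠ b in nhdsWithin l (Iio l), ∀ j, b ∉ S j := by
    rw [eventually_all]
    intro j
    by_cases hij : j = i
    · filter_upwards [self_mem_nhdsWithin] with b hb hbS
      rw [hij] at hbS
      exact absurd (hl.2 hbS) (not_le.2 hb)
    · have : l ∉ S j := fun h => hij (huniq j i l hlhi h hl.1)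
      exact nhdsWithin_le_nhds ((hclosed j).isOpen_compl.mem_nhds this)
  obtain ⟨y, hy, hsub⟩ := (mem_nhdsLT_iff_exists_Ioo_subset' (sub_one_lt l)).1 hev
  exact ⟨y, hy, fun j b hb => hsub hb j⟩

/-- A finite family of closed sets, disjoint below `hi` and without isolated points there, splits
`[lo, x]` into alternating intervals, starting with a gap to the left of `x`. -/
theorem exists_alternating_below {ι : Type*} [Finite ι] {S : ι → Set ℝ} {lo hi : ℝ}
    (hclosed : ∀ i, IsClosed (S i)) (hsub : ∀ i, S i ⊆ Icc lo hi)
    (huniq : ∀ i j b, b < hi → b ∈ S i → b ∈ S j → i = j)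
    (hside : ∀ i, ∀ b ∈ Ioo lo hi, b ∈ S i → (∃ c < b, Ioo c b ⊆ S i) ∨ ∃ c > b, Ioo b c ⊆ S i)
    (n : ℕ) (x : ℝ) (hn : {i | ∃ b ∈ S i, b < x}.ncard ≤ n) (hlo : lo ≤ x) (hhi : x < hi)
    (hgap : x = lo ∨ ∃ y < x, ∀ i, ∀ b ∈ Ioo y x, b ∉ S i) :
    ∃ (N : ℕ) (β : ℕ → ℝ), 1 ≤ N ∧ StrictAntiOn β (Icc 1 N) ∧ β 1 = x ∧ β N = lo ∧
      (∀ k : ℕ, 1 ≤ k → 2 * k ≤ N → ∀ b ∈ Ioo (β (2 * k)) (β (2 * k - 1)), ∀ i, b ∉ S i) ∧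
      (∀ k : ℕ, 1 ≤ k → 2 * k + 1 ≤ N → ∀ b ∈ Ioo (β (2 * k + 1)) (β (2 * k)),
        ∃ i, ∃ b₁ ∈ S i, b₁ < b ∧ ∃ b₂ ∈ S i, b < b₂) := by
  induction n generalizing x with
  | zero =>
    have hempty : {i | ∃ b ∈ S i, b < x} = ∅ :=
      (Set.ncard_eq_zero (Set.toFinite _)).1 (Nat.le_zero.1 hn)
    have hnone : ∀ b < x, ∀ i, b ∉ S i := fun b hb i hi =>
      (Set.eq_empty_iff_forall_notMem.1 hempty i) ⟨b, hi, hb⟩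
    rcases hlo.eq_or_lt with rfl | hlo
    · exact ⟨1, fun _ => lo, le_rfl, by intro a ha b hb hab; simp at ha hb; omega, rfl, rfl,
        fun k _ _ => by omega, fun k _ _ => by omega⟩
    · refine ⟨2, fun n => if n ≤ 1 then x else lo, by omega, ?_, by simp, by simp, ?_, ?_⟩
      · intro a ha b hb hab
        simp only [mem_Icc] at ha hb
        have h1 : a ≤ 1 := by omega
        have h2 : ¬ b ≤ 1 := by omega
        simpa [h1, h2] using hlo
      · intro k hk hkN b hb
        obtain rfl : k = 1 := by omega
        exact hnone b (by simpa using hb.2)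
      · intro k _ _; omega
  | succ n ih =>
    rcases hlo.eq_or_lt with rfl | hlo
    · exact ⟨1, fun _ => lo, le_rfl, by intro a ha b hb hab; simp at ha hb; omega, rfl, rfl,
        fun k _ _ => by omega, fun k _ _ => by omega⟩
    by_cases hU : ∃ b ∈ Ioo lo x, ∃ i, b ∈ S i
    swap
    · refine ⟨2, fun n => if n ≤ 1 then x else lo, by omega, ?_, by simp, by simp, ?_, ?_⟩
      · intro a ha b hb hab
        simp only [mem_Icc] at ha hb
        have h1 : a ≤ 1 := by omega
        have h2 : ¬ b ≤ 1 := by omega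
        simpa [h1, h2] using hlo
      · intro k hk hkN b hb i hi
        obtain rfl : k = 1 := by omega
        exact hU ⟨b, by simpa using hb, i, hi⟩
      · intro k _ _; omega
    obtain ⟨b₀, hb₀, i₀, hi₀⟩ := hU
    obtain ⟨y, hyx, hy⟩ := hgap.resolve_left hlo.ne'
    have hCc : IsCompact ((⋃ i, S i) ∩ Iic y) := by
      refine (isCompact_Icc (a := lo) (b := hi)).of_isClosed_subset
        ((isClosed_iUnion_of_finite hclosed).inter isClosed_Iic) ?_
      exact inter_subset_left.trans (iUnion_subset hsub)
    have hley : ∀ b < x, ∀ i, b ∈ S i → b ≤ y := fun b hb i hbi =>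
      not_lt.1 fun h => hy i b ⟨h, hb⟩ hbi
    -- Here h is the top of the next occupied stretch below the gap and l the least point of its
    -- set. The stretch is nondegenerate because h is not isolated, and below l that set drops out,
    -- which decreases the induction count.
    obtain ⟨h, ⟨hhS, hhy⟩, hhmax⟩ := hCc.exists_isGreatest
      ⟨b₀, mem_iUnion.2 ⟨i₀, hi₀⟩, hley b₀ hb₀.2 i₀ hi₀⟩
    obtain ⟨i, hhi'⟩ := mem_iUnion.1 hhS
    have hmax : ∀ b < x, ∀ j, b ∈ S j → b ≤ h := fun b hb j hbj =>
      hhmax ⟨mem_iUnion.2 ⟨j, hbj⟩, hley b hb j hbj⟩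
    have hhx : h < x := lt_of_le_of_lt hhy hyx
    have hloh : lo < h := hb₀.1.trans_le (hmax b₀ hb₀.2 i₀ hi₀)
    obtain ⟨l, hl⟩ := ((isCompact_Icc (a := lo) (b := hi)).of_isClosed_subset (hclosed i)
      (hsub i)).exists_isLeast ⟨h, hhi'⟩
    have hlh : l < h := by
      rcases hside i h ⟨hloh, hhx.trans hhi⟩ hhi' with ⟨c, hc, hcS⟩ | ⟨c, hc, hcS⟩
      · obtain ⟨z, hz⟩ := exists_between hc
        exact (hl.2 (hcS hz)).trans_lt hz.2
      · obtain ⟨z, hz1, hz2⟩ := exists_between (lt_min hc hhx)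
        have := hmax z (hz2.trans_le (min_le_right _ _)) i
          (hcS ⟨hz1, hz2.trans_le (min_le_left _ _)⟩)
        exact absurd hz1 (not_lt.2 this)
    have hlhi : l < hi := hlh.trans (hhx.trans hhi)
    have hcard : {j | ∃ b ∈ S j, b < l}.ncard ≤ n := by
      refine Nat.lt_succ_iff.1 (lt_of_lt_of_le (Set.ncard_lt_ncard ?_ (Set.toFinite _)) hn)
      refine ⟨fun j ⟨b, hb, hbl⟩ => ⟨b, hb, hbl.trans (hlh.trans hhx)⟩, fun hss => ?_⟩
      obtain ⟨b, hb, hbl⟩ := hss (⟨h, hhi', hhx⟩ : i ∈ {j | ∃ b ∈ S j, b < x})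
      exact absurd (hl.2 hb) (not_le.2 hbl)
    obtain ⟨N, β, hN, hanti, hβ1, hβN, hgaps, hfull⟩ := ih l hcard (hsub i hl.1).1 hlhi
      (Or.inr (exists_gap_below hclosed huniq hl hlhi))
    have hβle : ∀ m ∈ Icc 1 N, β m ≤ l := fun m hm => by
      rw [← hβ1]
      exact hanti.antitoneOn ⟨le_rfl, hN⟩ hm hm.1
    -- The gap (h, x) and the stretch (l, h) precede the sequence from the induction, whose first
    -- term is l. The shift by two preserves the parity that separates gaps from stretches.
    let γ : ℕ → ℝ := fun m => if m ≤ 1 then x else if m = 2 then h else β (m - 2)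
    have hγ : ∀ m, γ (m + 3) = β (m + 1) := fun m => by
      simp only [γ]
      rw [if_neg (by omega), if_neg (by omega)]
      rfl
    refine ⟨N + 2, γ, by omega, ?_, by simp [γ], ?_, ?_, ?_⟩
    · intro a ha b hb hab
      simp only [mem_Icc] at ha hb
      have h3 : ∀ m, m + 3 ≤ N + 2 → γ (m + 3) ≤ l := fun m hm => by
        rw [hγ]; exact hβle _ ⟨by omega, by omega⟩
      have e1 : γ 1 = x := by simp [γ]
      have e2 : γ 2 = h := by simp [γ]
      obtain rfl | rfl | ⟨a, rfl⟩ : a = 1 ∨ a = 2 ∨ ∃ m, a = m + 3 := by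
        rcases a with _ | _ | _ | a
        · omega
        · simp
        · simp
        · exact Or.inr (Or.inr ⟨a, rfl⟩)
      · obtain rfl | ⟨b, rfl⟩ : b = 2 ∨ ∃ m, b = m + 3 := by
          rcases b with _ | _ | _ | b
          · omega
          · omega
          · simp
          · exact Or.inr ⟨b, rfl⟩
        · rw [e1, e2]; exact hhx
        · rw [e1]; linarith [h3 b hb.2]
      · obtain ⟨b, rfl⟩ : ∃ m, b = m + 3 := ⟨b - 3, by omega⟩
        rw [e2]; linarith [h3 b hb.2]
      · obtain ⟨b, rfl⟩ : ∃ m, b = m + 3 := ⟨b - 3, by omega⟩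
        rw [hγ, hγ]
        exact hanti ⟨by omega, by omega⟩ ⟨by omega, by omega⟩ (by omega)
    · obtain ⟨m, rfl⟩ : ∃ m, N = m + 1 := ⟨N - 1, by omega⟩
      rw [show m + 1 + 2 = m + 3 from rfl, hγ, hβN]
    · intro k hk hkN b hb j hj
      obtain rfl | ⟨m, rfl⟩ : k = 1 ∨ ∃ m, k = m + 2 := by
        rcases k with _ | _ | k
        · omega
        · simp
        · exact Or.inr ⟨k, rfl⟩
      · simp [γ] at hb
        exact absurd hb.1 (not_lt.2 (hmax b hb.2 j hj))
      · rw [show 2 * (m + 2) = (2 * m + 1) + 3 by ring,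
          show 2 * m + 1 + 3 - 1 = 2 * m + 3 by omega, hγ, hγ] at hb
        refine hgaps (m + 1) (by omega) (by omega) b ?_ j hj
        rwa [show 2 * (m + 1) - 1 = 2 * m + 1 by omega]
    · intro k hk hkN b hb
      obtain rfl | ⟨m, rfl⟩ : k = 1 ∨ ∃ m, k = m + 2 := by
        rcases k with _ | _ | k
        · omega
        · simp
        · exact Or.inr ⟨k, rfl⟩
      · simp [γ, hβ1] at hb
        exact ⟨i, l, hl.1, hb.1, h, hhi', hb.2⟩
      · rw [show 2 * (m + 2) + 1 = (2 * m + 2) + 3 by ring,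
          show 2 * (m + 2) = (2 * m + 1) + 3 by ring, hγ, hγ] at hb
        exact hfull (m + 1) (by omega) (by omega) b hb

theorem exists_alternating {ι : Type*} [Finite ι] {S : ι → Set ℝ} {lo hi : ℝ}
    (hclosed : ∀ i, IsClosed (S i)) (hsub : ∀ i, S i ⊆ Icc lo hi)
    (huniq : ∀ i j b, b < hi → b ∈ S i → b ∈ S j → i = j)
    (hside : ∀ i, ∀ b ∈ Ioo lo hi, b ∈ S i → (∃ c < b, Ioo c b ⊆ S i) ∨ ∃ c > b, Ioo b c ⊆ S i)
    (hnear : ∃ i, ∃ c < hi, Ioo c hi ⊆ S i) :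
    ∃ (N : ℕ) (β : ℕ → ℝ), 1 ≤ N ∧ StrictAntiOn β (Icc 1 N) ∧ β 1 < hi ∧ β N = lo ∧
      (∀ b ∈ Ioo (β 1) hi, ∃ i, ∃ b₁ ∈ S i, b₁ < b ∧ ∃ b₂ ∈ S i, b < b₂) ∧
      (∀ k : ℕ, 1 ≤ k → 2 * k ≤ N → ∀ b ∈ Ioo (β (2 * k)) (β (2 * k - 1)), ∀ i, b ∉ S i) ∧
      (∀ k : ℕ, 1 ≤ k → 2 * k + 1 ≤ N → ∀ b ∈ Ioo (β (2 * k + 1)) (β (2 * k)),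
        ∃ i, ∃ b₁ ∈ S i, b₁ < b ∧ ∃ b₂ ∈ S i, b < b₂) := by
  obtain ⟨i, c, hc, hcS⟩ := hnear
  obtain ⟨z, hz⟩ := exists_between hc
  obtain ⟨l, hl⟩ := ((isCompact_Icc (a := lo) (b := hi)).of_isClosed_subset (hclosed i)
      (hsub i)).exists_isLeast ⟨z, hcS hz⟩
  have hlhi : l < hi := (hl.2 (hcS hz)).trans_lt hz.2
  obtain ⟨N, β, hN, hanti, hβ1, hβN, hgaps, hfull⟩ := exists_alternating_below hclosed hsub huniq
    hside _ l le_rfl (hsub i hl.1).1 hlhi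
    (Or.inr (exists_gap_below hclosed huniq hl hlhi))
  refine ⟨N, β, hN, hanti, hβ1 ▸ hlhi, hβN, fun b hb => ?_, hgaps, hfull⟩
  obtain ⟨b₂, h1, h2⟩ := exists_between (max_lt hc hb.2)
  exact ⟨i, l, hl.1, hβ1 ▸ hb.1, b₂, hcS ⟨(le_max_left _ _).trans_lt h1, h2⟩,
    (le_max_right _ _).trans_lt h1⟩

namespace TeamProblem.Regular

variable {P : TeamProblem} (hP : P.Regular)
include hP

/-! ### Dominating parameters -/

/-- Both parameters are exact at a₀, and the one with the larger b has flatter predictions in effort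
that are still at least as steep as the truth. Its output therefore lies between that of the other
parameter and the truth on either side of a₀. -/
theorem bias_compare {a₀ b b' w w' : ℝ} (ha₀ : a₀ ∈ convexHull ℝ (P.A : Set ℝ))
    (hb : b ∈ Icc P.bLo P.bHi) (hb' : b' ∈ Icc P.bLo P.bHi) (hw : w ∈ Icc P.wLo P.wHi)
    (hw' : w' ∈ Icc P.wLo P.wHi) (hbb' : b < b') (hbs : b' ≤ P.bStar)
    (h : P.g a₀ b w = P.g a₀ P.bStar P.wStar) (h' : P.g a₀ b' w' = P.g a₀ P.bStar P.wStar)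
    {a : ℝ} (ha : a ∈ convexHull ℝ (P.A : Set ℝ)) :
    (a < a₀ → P.g a b w < P.g a b' w' ∧ P.g a b' w' ≤ P.g a P.bStar P.wStar) ∧
      (a₀ < a → P.g a b' w' < P.g a b w ∧ P.g a P.bStar P.wStar ≤ P.g a b' w') := by
  have h1 := hP.strictMonoOn_sub hb hb' hw hw' hbb'.le
    (hP.lt_of_fit ha₀ hb hb' hw hw' hbb' (h.trans h'.symm))
  have h2 : MonotoneOn (fun a => P.g a b' w' - P.g a P.bStar P.wStar)
      (convexHull ℝ (P.A : Set ℝ)) := by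
    rcases hbs.eq_or_lt with rfl | hbs
    · have : w' = P.wStar := hP.eq_of_fit ha₀ hb' hw' P.wStar_mem h'
      rw [this]
      intro x _ y _ _
      simp
    · exact (hP.strictMonoOn_bias ha₀ hb' hbs hw' h').monotoneOn
  constructor
  · intro hlt
    have h3 := h1 ha ha₀ hlt
    have h4 := h2 ha ha₀ hlt.le
    simp only at h3 h4
    constructor <;> linarith
  · intro hlt
    have h3 := h1 ha₀ ha hlt
    have h4 := h2 ha₀ ha hlt.le
    simp only at h3 h4
    constructor <;> linarith

theorem dominates_of_fit {a₀ b b' w w' : ℝ} (ha₀ : a₀ ∈ convexHull ℝ (P.A : Set ℝ))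
    (hb : b ∈ Icc P.bLo P.bHi) (hb' : b' ∈ Icc P.bLo P.bHi) (hw : w ∈ Icc P.wLo P.wHi)
    (hw' : w' ∈ Icc P.wLo P.wHi) (hbb' : b < b') (hbs : b' ≤ P.bStar)
    (h : P.g a₀ b w = P.g a₀ P.bStar P.wStar) (h' : P.g a₀ b' w' = P.g a₀ P.bStar P.wStar) :
    P.Dominates !₂[b', w'] !₂[b, w] := by
  intro a
  have hcmp := hP.bias_compare ha₀ hb hb' hw hw' hbb' hbs h h' (subset_convexHull ℝ _ a.2)
  simp only [bias, Matrix.cons_val_zero, Matrix.cons_val_one]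
  rcases lt_trichotomy (a : ℝ) a₀ with hlt | heq | hlt
  · obtain ⟨h1, h2⟩ := hcmp.1 hlt
    refine ⟨fun h3 => by linarith, fun _ => ?_⟩
    rw [abs_of_nonpos (by linarith), abs_of_nonpos (by linarith)]
    linarith
  · rw [heq, h, h']
    simp
  · obtain ⟨h1, h2⟩ := hcmp.2 hlt
    refine ⟨fun h3 => by linarith, fun _ => ?_⟩
    rw [abs_of_nonneg (by linarith), abs_of_nonneg (by linarith)]
    linarith

/-- The bias under any parameter either vanishes somewhere or has a constant sign. -/
theorem bias_cases {b w : ℝ} (hb : b ∈ Icc P.bLo P.bHi) (hw : w ∈ Icc P.wLo P.wHi) :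
    (∃ a₀ ∈ convexHull ℝ (P.A : Set ℝ), P.g a₀ b w = P.g a₀ P.bStar P.wStar) ∨
      (∀ a ∈ P.A, P.g a b w < P.g a P.bStar P.wStar) ∨
      ∀ a ∈ P.A, P.g a P.bStar P.wStar < P.g a b w := by
  by_contra hcon
  push Not at hcon
  obtain ⟨hne, ⟨a₁, ha₁, h₁⟩, a₂, ha₂, h₂⟩ := hcon
  have hconv := (convex_convexHull ℝ (P.A : Set ℝ)).isPreconnected
  have hcont := (hP.continuousOn_effort hb hw).sub (hP.continuousOn_effort P.bStar_mem P.wStar_mem)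
  obtain ⟨a₀, ha₀, h₀⟩ := hconv.intermediate_value (subset_convexHull ℝ _ ha₂)
    (subset_convexHull ℝ _ ha₁) hcont (show (0 : ℝ) ∈ Icc _ _ from ⟨by simpa using h₂, by simpa using h₁⟩)
  exact hne a₀ ha₀ (sub_eq_zero.1 h₀)

/-- The intermediate value theorem replaces `exists_fit`, since the zero a₀ of the bias may lie
strictly between the available efforts. -/
theorem exists_fit_near {a₀ w b' l : ℝ} (ha₀ : a₀ ∈ convexHull ℝ (P.A : Set ℝ))
    (hb' : b' ∈ Icc P.bLo P.bHi) (hl : l ∈ Icc P.wLo P.wHi) (hw : w ∈ Icc P.wLo P.wHi)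
    (hlw : l ≤ w) (h₁ : P.g a₀ b' l ≤ P.g a₀ P.bStar P.wStar)
    (h₂ : P.g a₀ P.bStar P.wStar ≤ P.g a₀ b' w) :
    ∃ w' ∈ Icc l w, P.g a₀ b' w' = P.g a₀ P.bStar P.wStar := by
  have hcont : ContinuousOn (fun w => P.g a₀ b' w) (Icc l w) := fun w' hw' =>
    (hP.continuousAt_teammate ha₀ hb' ⟨hl.1.trans hw'.1, hw'.2.trans hw.2⟩).continuousWithinAt
  exact intermediate_value_Icc hlw hcont ⟨h₁, h₂⟩

/-- If the bias vanishes at some a₀ of the hull, refitting at a₀ flattens it. If it is negative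
everywhere, the fit at the highest effort lifts outputs without exceeding the truth; if positive,
the fit at the lowest effort lowers them without falling short. -/
theorem exists_dominating {b b' w : ℝ} (hb : b ∈ Icc P.bLo P.bHi) (hb' : b' ∈ Icc P.bLo P.bHi)
    (hw : w ∈ Icc P.wLo P.wHi) (hbb' : b < b') (hbs : b' ≤ P.bStar) :
    ∃ w' ∈ Icc P.wLo P.wHi, P.Dominates !₂[b', w'] !₂[b, w] := by
  rcases hP.bias_cases hb hw with ⟨a₀, ha₀, h₀⟩ | hneg | hpos
  · have hlt := hP.lt_of_fit ha₀ hb P.bStar_mem hw P.wStar_mem (hbb'.trans_le hbs) h₀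
    obtain ⟨w', hw', h'⟩ := hP.exists_fit_near ha₀ hb' P.wStar_mem hw hlt.le
      ((hP.strictMono_b a₀ ha₀ _ P.wStar_mem).monotoneOn hb' P.bStar_mem hbs)
      (h₀ ▸ (hP.strictMono_b a₀ ha₀ _ hw hb hb' hbb').le)
    have hw'm : w' ∈ Icc P.wLo P.wHi := ⟨P.wStar_mem.1.trans hw'.1, hw'.2.trans hw.2⟩
    exact ⟨w', hw'm, hP.dominates_of_fit ha₀ hb hb' hw hw'm hbb' hbs h₀ h'⟩
  · have hm := P.A.max'_mem P.A_nonempty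
    set m := P.A.max' P.A_nonempty
    have hmH := subset_convexHull ℝ (P.A : Set ℝ) hm
    obtain ⟨hw₁, h₁⟩ := hP.fit_spec hm hb
    obtain ⟨hw', h'⟩ := hP.fit_spec hm hb'
    refine ⟨_, hw', fun a => ?_⟩
    have haH := subset_convexHull ℝ (P.A : Set ℝ) a.2
    have hlt : w < P.fit m b := by
      refine ((hP.strictMono_w m hmH b hb).lt_iff_lt hw hw₁).1 ?_
      simp only [h₁]
      exact hneg m hm
    have h2 := hP.strictMono_w a haH b hb hw hw₁ hlt
    have h3 := hP.bias_compare hmH hb hb' hw₁ hw' hbb' hbs h₁ h' haH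
    have h4 := hneg a a.2
    simp only [bias, Matrix.cons_val_zero, Matrix.cons_val_one]
    refine ⟨fun h5 => by linarith, fun _ => ?_⟩
    rcases (P.A.le_max' a a.2).eq_or_lt with heq | hlt'
    · rw [heq, show P.A.max' _ = m from rfl, h', sub_self, abs_zero, abs_pos, sub_ne_zero]
      exact (hneg m hm).ne
    · obtain ⟨h5, h6⟩ := h3.1 hlt'
      simp only at h2
      rw [abs_of_nonpos (by linarith), abs_of_nonpos (by linarith)]
      linarith
  · have hm := P.A.min'_mem P.A_nonempty
    set m := P.A.min' P.A_nonempty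
    have hmH := subset_convexHull ℝ (P.A : Set ℝ) hm
    obtain ⟨hw₁, h₁⟩ := hP.fit_spec hm hb
    obtain ⟨hw', h'⟩ := hP.fit_spec hm hb'
    refine ⟨_, hw', fun a => ?_⟩
    have haH := subset_convexHull ℝ (P.A : Set ℝ) a.2
    have hlt : P.fit m b < w := by
      refine ((hP.strictMono_w m hmH b hb).lt_iff_lt hw₁ hw).1 ?_
      simp only [h₁]
      exact hpos m hm
    have h2 := hP.strictMono_w a haH b hb hw₁ hw hlt
    have h3 := hP.bias_compare hmH hb hb' hw₁ hw' hbb' hbs h₁ h' haH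
    have h4 := hpos a a.2
    simp only [bias, Matrix.cons_val_zero, Matrix.cons_val_one]
    refine ⟨fun h5 => by linarith, fun _ => ?_⟩
    rcases (P.A.min'_le a a.2).eq_or_lt with heq | hlt'
    · rw [← heq, show P.A.min' _ = m from rfl, h', sub_self, abs_zero, abs_pos, sub_ne_zero]
      exact (hpos m hm).ne'
    · obtain ⟨h5, h6⟩ := h3.2 hlt'
      simp only at h2
      rw [abs_of_nonneg (by linarith), abs_of_nonneg (by linarith)]
      linarith

/-- Every parameter with underconfidence is dominated by an arbitrarily close one. -/
theorem exists_dominating_near {b w : ℝ} (hb : b ∈ Icc P.bLo P.bHi) (hbs : b < P.bStar)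
    (hw : w ∈ Icc P.wLo P.wHi) {ε : ℝ} (hε : 0 < ε) :
    ∃ b' ∈ Icc P.bLo P.bHi, ∃ w' ∈ Icc P.wLo P.wHi, |b' - b| < ε ∧ |w' - w| < ε ∧
      P.Dominates !₂[b', w'] !₂[b, w] := by
  have hs := P.bStar_mem
  rcases hP.bias_cases hb hw with ⟨a₀, ha₀, h₀⟩ | hneg | hpos
  · have hlt := hP.lt_of_fit ha₀ hb hs hw P.wStar_mem hbs h₀
    -- Output at a₀ under (b, l) is strictly below the truth, so a slightly larger b' still admits a
    -- refit between l and w, within ε of w. In the cases of constant sign, a small increase of b or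
    -- decrease of w shrinks the bias without changing its sign.
    obtain ⟨l, hl1, hl2⟩ := exists_between (max_lt hlt (sub_lt_self w hε))
    have hlm : l ∈ Icc P.wLo P.wHi :=
      ⟨P.wStar_mem.1.trans ((le_max_left _ _).trans hl1.le), hl2.le.trans hw.2⟩
    have h1 : P.g a₀ b l < P.g a₀ P.bStar P.wStar := h₀ ▸ hP.strictMono_w a₀ ha₀ b hb hlm hw hl2
    have h2 := (hP.continuousAt_ability ha₀ hb hlm).eventually_lt continuousAt_const h1
    obtain ⟨r, hr, hball⟩ := Metric.eventually_nhds_iff.1 h2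
    obtain ⟨b', hb1, hb2⟩ := exists_between
      (lt_min hbs (lt_min (lt_add_of_pos_right b hε) (lt_add_of_pos_right b hr)))
    have hb3 := hb2.trans_le (min_le_left _ _)
    have hb4 := (hb2.trans_le (min_le_right _ _)).trans_le (min_le_left _ _)
    have hb5 := (hb2.trans_le (min_le_right _ _)).trans_le (min_le_right _ _)
    have hb' : b' ∈ Icc P.bLo P.bHi := ⟨hb.1.trans hb1.le, hb3.le.trans hs.2⟩
    have h3 := hball (y := b') (by rw [Real.dist_eq, abs_lt]; constructor <;> linarith)
    obtain ⟨w', hw', h'⟩ := hP.exists_fit_near ha₀ hb' hlm hw hl2.le h3.le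
      (h₀ ▸ (hP.strictMono_b a₀ ha₀ _ hw hb hb' hb1).le)
    have hw'm : w' ∈ Icc P.wLo P.wHi := ⟨hlm.1.trans hw'.1, hw'.2.trans hw.2⟩
    refine ⟨b', hb', w', hw'm, ?_, ?_,
      hP.dominates_of_fit ha₀ hb hb' hw hw'm hb1 hb3.le h₀ h'⟩
    · rw [abs_lt]; constructor <;> linarith
    · have := (le_max_right _ _).trans_lt hl1
      rw [abs_lt]; constructor <;> linarith [hw'.1, hw'.2]
  · have hev : ∀ᶠ b' in nhds b, ∀ a : P.A, P.g a b' w < P.g a P.bStar P.wStar :=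
      eventually_all.2 fun a => (hP.continuousAt_ability (subset_convexHull ℝ _ a.2) hb hw
        ).eventually_lt continuousAt_const (hneg a a.2)
    obtain ⟨r, hr, hball⟩ := Metric.eventually_nhds_iff.1 hev
    obtain ⟨b', hb1, hb2⟩ := exists_between
      (lt_min hbs (lt_min (lt_add_of_pos_right b hε) (lt_add_of_pos_right b hr)))
    have hb3 := hb2.trans_le (min_le_left _ _)
    have hb4 := (hb2.trans_le (min_le_right _ _)).trans_le (min_le_left _ _)
    have hb5 := (hb2.trans_le (min_le_right _ _)).trans_le (min_le_right _ _)
    have hb' : b' ∈ Icc P.bLo P.bHi := ⟨hb.1.trans hb1.le, hb3.le.trans hs.2⟩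
    refine ⟨b', hb', w, hw, ?_, by simpa using hε, fun a => ?_⟩
    · rw [abs_lt]; constructor <;> linarith
    have h3 := hball (y := b') (by rw [Real.dist_eq, abs_lt]; constructor <;> linarith) a
    have h4 := hP.strictMono_b a (subset_convexHull ℝ _ a.2) w hw hb hb' hb1
    have h5 := hneg a a.2
    simp only [bias, Matrix.cons_val_zero, Matrix.cons_val_one]
    simp only at h4
    refine ⟨fun h6 => by linarith, fun _ => ?_⟩
    rw [abs_of_neg (by linarith), abs_of_neg (by linarith)]
    linarith
  · have hlt : P.wStar < w := by
      obtain ⟨a, ha⟩ := P.A_nonempty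
      have haH := subset_convexHull ℝ (P.A : Set ℝ) ha
      by_contra hcon
      have h1 := (hP.strictMono_w a haH b hb).monotoneOn hw P.wStar_mem (not_lt.1 hcon)
      have h2 := hP.strictMono_b a haH _ P.wStar_mem hb hs hbs
      have h3 := hpos a ha
      simp only at h1 h2
      linarith
    have hev : ∀ᶠ w' in nhds w, ∀ a : P.A, P.g a P.bStar P.wStar < P.g a b w' :=
      eventually_all.2 fun a => continuousAt_const.eventually_lt
        (hP.continuousAt_teammate (subset_convexHull ℝ _ a.2) hb hw) (hpos a a.2)
    obtain ⟨r, hr, hball⟩ := Metric.eventually_nhds_iff.1 hev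
    obtain ⟨w', hw1, hw2⟩ := exists_between
      (max_lt hlt (max_lt (sub_lt_self w hε) (sub_lt_self w hr)))
    have hw3 := (le_max_left _ _).trans_lt hw1
    have hw4 := (le_max_left _ _).trans_lt ((le_max_right _ _).trans_lt hw1)
    have hw5 := (le_max_right _ _).trans_lt ((le_max_right _ _).trans_lt hw1)
    have hw' : w' ∈ Icc P.wLo P.wHi := ⟨P.wStar_mem.1.trans hw3.le, hw2.le.trans hw.2⟩
    refine ⟨b, hb, w', hw', by simpa using hε, ?_, fun a => ?_⟩
    · rw [abs_lt]; constructor <;> linarith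
    have h3 := hball (y := w') (by rw [Real.dist_eq, abs_lt]; constructor <;> linarith) a
    have h4 := hP.strictMono_w a (subset_convexHull ℝ _ a.2) b hb hw' hw hw2
    have h5 := hpos a a.2
    simp only [bias, Matrix.cons_val_zero, Matrix.cons_val_one]
    simp only at h4
    refine ⟨fun h6 => by linarith, fun _ => ?_⟩
    rw [abs_of_pos (by linarith), abs_of_pos (by linarith)]
    linarith

end TeamProblem.Regular

/-! ### From fits and domination to robustness of the effort models -/

namespace TeamProblem

variable {P : TeamProblem}

theorem mem_model {b : ℝ} {W : Finset ℝ} {ω : EuclideanSpace ℝ (Fin 2)} :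
    ω ∈ (P.model b W).Ω ↔ ∃ w ∈ W, !₂[b, w] = ω := by
  simp [model]

theorem inFamily_model {b : ℝ} {W : Finset ℝ} (hne : W.Nonempty) (hb : b ∈ Icc P.bLo P.bHi)
    (hW : (W : Set ℝ) ⊆ Icc P.wLo P.wHi) :
    InFamily P.env P.paramSpace P.density (P.model b W) := by
  classical
  refine ⟨P.admissible_of_density ?_ fun _ _ _ => rfl, fun ω hω => ?_, fun _ _ _ => rfl⟩
  · obtain ⟨w, hw⟩ := hne
    exact ⟨_, mem_model.2 ⟨w, hw, rfl⟩⟩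
  · obtain ⟨w, hw, rfl⟩ := mem_model.1 hω
    exact ⟨by simpa using hb, by simpa using hW hw⟩

namespace Regular

variable (hP : P.Regular)
include hP

theorem initialSpace_nonempty {b : ℝ} {W : Finset ℝ} (hb : b ∈ Icc P.bLo P.bHi)
    (hW : P.IsInitialSpace b W) : W.Nonempty := by
  obtain ⟨a, ha⟩ := P.A_nonempty
  obtain ⟨hw, hg⟩ := hP.fit_spec ha hb
  exact ⟨_, hW.2 a ha _ hw hg⟩

theorem robust_of_hasStrictFit {b : ℝ} {W : Finset ℝ} (hb : b ∈ Icc P.bLo P.bHi)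
    (hW : P.IsInitialSpace b W) (h : P.HasStrictFit b) : P.Robust b W := by
  obtain ⟨w, hw, a, ha, hg, hfit⟩ := h
  have hmem : !₂[b, w] ∈ (P.model b W).Ω := mem_model.2 ⟨w, hW.2 a ha w hw hg, rfl⟩
  refine globallyRobust_of_fit (inFamily_model (hP.initialSpace_nonempty hb hW) hb hW.1).1
    ⟨_, hmem⟩ fun a' ha' => ?_
  have h1 : ∀ c : P.A, meanPayoff P.env (P.model b W) c !₂[b, w] = P.g c b w := fun c => by
    rw [P.meanPayoff_eq rfl]
    simp
  refine P.density_eq_of_bias_eq_zero (sub_eq_zero.2 ?_)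
  have := hfit a' a'.2 fun c hc => by
    have := ha' ⟨c, hc⟩
    rwa [h1, h1] at this
  simpa using this

/-- Under underconfidence a matching parameter has strictly increasing bias, so it matches at one
effort only; monotonicity in w lets each effort be matched by one parameter only. A match is the fit
at its effort, so it is not optimal there. -/
theorem neverPersists_model {b : ℝ} {W : Finset ℝ} (hb : b ∈ Icc P.bLo P.bHi)
    (hbs : b < P.bStar) (hW : P.IsInitialSpace b W)
    (hno : ∀ a ∈ P.A, ¬ P.SelfConfirming a b) {θc : Model P.A ℝ 2}
    (hθc : InFamily P.env P.paramSpace P.density θc)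
    (hdom : ∀ ω ∈ (P.model b W).Ω, ∃ ω' ∈ θc.Ω, P.Dominates ω' ω) :
    P.NeverPersists (P.model b W) θc := by
  have hθ := inFamily_model (hP.initialSpace_nonempty hb hW) hb hW.1
  have hbias : ∀ w (a : P.A), P.bias !₂[b, w] a = 0 ↔ P.g a b w = P.g a P.bStar P.wStar :=
    fun w a => by simp [bias, sub_eq_zero]
  refine P.neverPersists_of_dominated hθ.1 hθ.2.2 hθc.1 hθc.2.2 ?_ ?_ ?_ hdom
  · intro ω hω a a' h h'
    obtain ⟨w, hw, rfl⟩ := mem_model.1 hω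
    rw [hbias] at h h'
    have haH := subset_convexHull ℝ (P.A : Set ℝ) a.2
    refine Subtype.ext ((hP.strictMonoOn_bias haH hb hbs (hW.1 hw) h).injOn haH
      (subset_convexHull ℝ _ a'.2) ?_)
    simp only [h, h', sub_self]
  · intro ω hω ω' hω' a h h'
    obtain ⟨w, hw, rfl⟩ := mem_model.1 hω
    obtain ⟨w', hw', rfl⟩ := mem_model.1 hω'
    rw [hbias] at h h'
    rw [hP.eq_of_fit (subset_convexHull ℝ _ a.2) hb (hW.1 hw) (hW.1 hw') (h.trans h'.symm)]
  · intro ω hω a h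
    obtain ⟨w, hw, rfl⟩ := mem_model.1 hω
    rw [hbias] at h
    have hfit := hP.fit_eq a.2 hb (hW.1 hw) h
    have := hno a a.2
    rw [SelfConfirming, hfit] at this
    push Not at this
    obtain ⟨a', ha', hlt⟩ := this
    exact ⟨⟨a', ha'⟩, by simpa using hlt⟩

theorem exists_neverPersists {b b' : ℝ} {W : Finset ℝ} (hb : b ∈ Icc P.bLo P.bHi)
    (hb' : b' ∈ Ioc b P.bStar) (hW : P.IsInitialSpace b W)
    (hno : ∀ a ∈ P.A, ¬ P.SelfConfirming a b) :
    ∃ W' : Finset ℝ, InFamily P.env P.paramSpace P.density (P.model b' W') ∧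
      P.NeverPersists (P.model b W) (P.model b' W') := by
  classical
  have hs := P.bStar_mem
  have hb'I : b' ∈ Icc P.bLo P.bHi := ⟨hb.1.trans hb'.1.le, hb'.2.trans hs.2⟩
  choose f hf hfdom using fun w : W => hP.exists_dominating hb hb'I (hW.1 w.2) hb'.1 hb'.2
  have hne := hP.initialSpace_nonempty hb hW
  have hmem : ∀ w, f w ∈ W.attach.image f := fun w =>
    Finset.mem_image.2 ⟨w, Finset.mem_attach _ _, rfl⟩
  have hfam : InFamily P.env P.paramSpace P.density (P.model b' (W.attach.image f)) := by
    refine inFamily_model (hne.attach.image f) hb'I fun w hw => ?_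
    obtain ⟨w₀, -, rfl⟩ := Finset.mem_image.1 (Finset.mem_coe.1 hw)
    exact hf w₀
  refine ⟨_, hfam, hP.neverPersists_model hb (hb'.1.trans_le hb'.2) hW hno hfam fun ω hω => ?_⟩
  obtain ⟨w, hw, rfl⟩ := mem_model.1 hω
  exact ⟨_, mem_model.2 ⟨_, hmem ⟨w, hw⟩, rfl⟩, hfdom ⟨w, hw⟩⟩

end Regular

end TeamProblem

/-- Moving every parameter by less than `ε` moves a belief by at most `ε` in the Prokhorov
distance. -/
theorem levyProkhorovDist_sum_dirac_le {X ι : Type*} [PseudoMetricSpace X] [MeasurableSpace X]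
    [OpensMeasurableSpace X] [Fintype ι] (p : ι → ℝ≥0∞) (x x' : ι → X) {ε : ℝ} (hε : 0 < ε)
    (h : ∀ i, dist (x' i) (x i) < ε) :
    levyProkhorovDist (∑ i, p i • Measure.dirac (x i)) (∑ i, p i • Measure.dirac (x' i)) ≤ ε := by
  refine ENNReal.toReal_le_of_le_ofReal hε.le ?_
  have key : ∀ z z' : ι → X, (∀ i, dist (z' i) (z i) < ε) → ∀ δ, ε ≤ δ → ∀ B, MeasurableSet B →
      (∑ i, p i • Measure.dirac (z i)) B
        ≤ (∑ i, p i • Measure.dirac (z' i)) (Metric.thickening δ B) := by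
    intro z z' hz δ hδ B hB
    simp only [Measure.coe_finsetSum, Finset.sum_apply, Measure.smul_apply, smul_eq_mul]
    refine Finset.sum_le_sum fun i _ => mul_le_mul_right ?_ _
    rw [Measure.dirac_apply' _ hB, Measure.dirac_apply' _ Metric.isOpen_thickening.measurableSet]
    by_cases hi : z i ∈ B
    · have : z' i ∈ Metric.thickening δ B :=
        Metric.mem_thickening_iff.2 ⟨z i, hi, (hz i).trans_le hδ⟩
      simp [hi, this]
    · simp [hi]
  refine levyProkhorovEDist_le_of_forall _ _ _ fun δ B hδ hδtop hB => ?_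
  have hδ' : ε ≤ δ.toReal := by
    rw [← ENNReal.ofReal_le_iff_le_toReal hδtop.ne]
    exact hδ.le
  exact ⟨(key x x' h _ hδ' B hB).trans le_self_add,
    (key x' x (fun i => by rw [dist_comm]; exact h i) _ hδ' B hB).trans le_self_add⟩

namespace TeamProblem.Regular

variable {P : TeamProblem} (hP : P.Regular)
include hP

/-- Moving each parameter to a dominating one within ε and carrying the prior along gives a model
and prior close to θ against which θ never persists. -/
theorem not_qRobust {b : ℝ} {W : Finset ℝ} (hb : b ∈ Icc P.bLo P.bHi)
    (hbs : b < P.bStar) (hW : P.IsInitialSpace b W)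
    (hno : ∀ a ∈ P.A, ¬ P.SelfConfirming a b) : ¬ P.QRobust b W := by
  classical
  rintro ⟨ε, hε, π₀, hπ₀, p, hp, hpers⟩
  let θ := P.model b W
  have hθ : InFamily P.env P.paramSpace P.density θ :=
    inFamily_model (hP.initialSpace_nonempty hb hW) hb hW.1
  have hex : ∀ ω : θ.Ω, ∃ ω' ∈ P.paramSpace, dist ω' (ω : EuclideanSpace ℝ (Fin 2)) < ε ∧
      P.Dominates ω' ω := by
    rintro ⟨ω, hω⟩
    obtain ⟨w, hw, rfl⟩ := mem_model.1 hω
    obtain ⟨b', hb', w', hw', h1, h2, h3⟩ :=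
      hP.exists_dominating_near hb hbs (hW.1 hw) (half_pos hε)
    refine ⟨!₂[b', w'], ⟨by simpa using hb', by simpa using hw'⟩, ?_, h3⟩
    rw [EuclideanSpace.dist_eq, Real.sqrt_lt' hε]
    simp only [Fin.sum_univ_two, Matrix.cons_val_zero, Matrix.cons_val_one, Real.dist_eq, sq_abs]
    rw [abs_lt] at h1 h2
    nlinarith [sq_lt_sq' h1.1 h1.2, sq_lt_sq' h2.1 h2.2]
  choose f hfmem hfdist hfdom using hex
  let θc : Model P.A ℝ 2 := { Ω := Finset.univ.image f, q := P.density }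
  have hne : (Finset.univ : Finset θ.Ω).Nonempty := by
    obtain ⟨ω, hω⟩ := hθ.1.nonempty
    exact ⟨⟨ω, hω⟩, Finset.mem_univ _⟩
  have hf : ∀ ω, f ω ∈ θc.Ω := fun ω => Finset.mem_image.2 ⟨ω, Finset.mem_univ _, rfl⟩
  have hθc : InFamily P.env P.paramSpace P.density θc := by
    refine ⟨P.admissible_of_density (hne.image f) fun _ _ _ => rfl, fun ω' hω' => ?_,
      fun _ _ _ => rfl⟩
    obtain ⟨ω, -, rfl⟩ := Finset.mem_image.1 (Finset.mem_coe.1 hω')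
    exact hfmem ω
  let F : θ.Ω → θc.Ω := fun ω => ⟨f ω, hf ω⟩
  -- The masses are summed over fibres because several parameters may share a dominator.
  let πc : θc.Ω → ℝ := fun ω' => ∑ ω with F ω = ω', π₀ ω
  have hπc : IsFullSupport θc πc := by
    have hpos : ∀ ω', 0 < πc ω' := by
      rintro ⟨ω', hω'⟩
      obtain ⟨ω, -, rfl⟩ := Finset.mem_image.1 hω'
      exact Finset.sum_pos (fun ω _ => hπ₀.2 ω) ⟨ω, by simp [F]⟩
    refine ⟨⟨fun ω' => (hpos ω').le, ?_⟩, hpos⟩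
    rw [← hπ₀.1.2]
    exact Finset.sum_fiberwise _ _ _
  have hmeasure : beliefMeasure θc πc = ∑ ω, ENNReal.ofReal (π₀ ω) • Measure.dirac (f ω) := by
    rw [beliefMeasure, ← Finset.sum_fiberwise Finset.univ F]
    refine Finset.sum_congr rfl fun ω' _ => ?_
    simp only [πc]
    rw [ENNReal.ofReal_sum_of_nonneg fun ω _ => (hπ₀.2 ω).le, Finset.sum_smul]
    refine Finset.sum_congr rfl fun ω hω => ?_
    rw [← (Finset.mem_filter.1 hω).2]
  have hLP : levyProkhorovDist (beliefMeasure θ π₀) (beliefMeasure θc πc) ≤ ε := by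
    rw [hmeasure]
    exact levyProkhorovDist_sum_dirac_le _ _ _ hε hfdist
  have hH : Metric.hausdorffDist (θ.Ω : Set (EuclideanSpace ℝ (Fin 2))) θc.Ω ≤ ε := by
    refine Metric.hausdorffDist_le_of_mem_dist hε.le (fun ω hω => ?_) fun ω' hω' => ?_
    · exact ⟨f ⟨ω, hω⟩, hf _, by rw [dist_comm]; exact (hfdist ⟨ω, hω⟩).le⟩
    · obtain ⟨ω, -, rfl⟩ := Finset.mem_image.1 (Finset.mem_coe.1 hω')
      exact ⟨ω, ω.2, (hfdist ω).le⟩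
  -- Local robustness speaks of all optimal policies of the competitor, so one must exist for a
  -- contradiction.
  obtain ⟨pc, hpc⟩ := hθc.1.exists_optimalPolicy
  exact hP.neverPersists_model hb hbs hW hno hθc (fun ω hω => ⟨_, hf ⟨ω, hω⟩, hfdom ⟨ω, hω⟩⟩)
    π₀ hπ₀ p hp πc hπc pc hpc (hpers θc hθc hH πc hπc hLP pc hpc)

end TeamProblem.Regular

end ModelSwitching

/-! ### The thresholds of the effort problem -/

theorem proposition2 (P : ModelSwitching.TeamProblem) (hP : P.Regular) :
    ∃ (N : ℕ) (β : ℕ → ℝ), 1 ≤ N ∧ StrictAntiOn β (Set.Icc 1 N) ∧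
      β 1 < P.bStar ∧ β N ≤ P.bLo ∧
      ∀ B : Finset ℝ, (B : Set ℝ) ⊆ Set.Icc P.bLo P.bHi →
        ∀ b ∈ B, ∀ W : Finset ℝ, P.IsInitialSpace b W →
          (β 1 < b → P.Robust b W) ∧
          (∀ k : ℕ, 1 ≤ k → 2 * k ≤ N → b ∈ Set.Ioo (β (2 * k)) (β (2 * k - 1)) →
            ¬ P.QRobust b W ∧
            ∀ b' ∈ B, b' ∈ Set.Ioc b P.bStar →
              ∃ W' : Finset ℝ,
                ModelSwitching.InFamily P.env P.paramSpace P.density (P.model b' W') ∧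
                P.NeverPersists (P.model b W) (P.model b' W')) ∧
          (∀ k : ℕ, 1 ≤ k → 2 * k + 1 ≤ N → b ∈ Set.Ioo (β (2 * k + 1)) (β (2 * k)) →
            P.Robust b W) := by
  have hs := P.bStar_mem
  rcases hs.1.eq_or_lt with heq | hlt
  -- When b* is the lowest ability there is no underconfidence; a single threshold below the range
  -- puts every self-perception into the first case.
  · refine ⟨1, fun _ => P.bLo - 1, le_rfl, ?_, by linarith, by linarith,
      fun B hB b hb W hW => ⟨fun _ => ?_, fun k _ _ => by omega, fun k _ _ => by omega⟩⟩
    · intro i hi j hj hij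
      simp only [Icc_self, mem_singleton_iff] at hi hj
      omega
    · exact hP.robust_of_hasStrictFit (hB hb) hW
        (hP.hasStrictFit_of_ge (hB hb) (heq ▸ (hB hb).1))
  -- The sets include the endpoint b*, which keeps them closed; disjointness is needed, and holds,
  -- only below b*.
  let S : P.A → Set ℝ := fun a => {b | b ∈ Icc P.bLo P.bStar ∧ P.SelfConfirming a b}
  have hsub : Icc P.bLo P.bStar ⊆ Icc P.bLo P.bHi := Icc_subset_Icc_right hs.2
  have hnear : ∃ a, ∃ c < P.bStar, Ioo c P.bStar ⊆ S a := by
    obtain ⟨a, ha, h⟩ := hP.exists_selfConfirming_near hlt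
    exact ⟨⟨a, ha⟩, h⟩
  obtain ⟨N, β, hN, hanti, hβ1, hβN, htop, hgaps, hfull⟩ := ModelSwitching.exists_alternating
    (S := S) (fun a => hP.isClosed_selfConfirming a.2 hs.2) (fun a b hb => hb.1)
    (fun a a' b hb h h' => Subtype.ext
      (hP.selfConfirming_unique a.2 a'.2 (hsub h.1) hb h.2 h'.2))
    (fun a b hb h => hP.selfConfirming_side a.2 hb h.2) hnear
  have hbetween : ∀ b, (∃ a, ∃ b₁ ∈ S a, b₁ < b ∧ ∃ b₂ ∈ S a, b < b₂) → P.HasStrictFit b := by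
    rintro b ⟨a, b₁, hb₁, h₁, b₂, hb₂, h₂⟩
    exact hP.hasStrictFit_between a.2 (hsub hb₁.1) (hsub hb₂.1) h₁ h₂ hb₁.2 hb₂.2
  refine ⟨N, β, hN, hanti, hβ1, hβN.le, fun B hB b hb W hW => ⟨fun h => ?_, ?_, ?_⟩⟩
  · refine hP.robust_of_hasStrictFit (hB hb) hW ?_
    rcases lt_or_ge b P.bStar with hbs | hbs
    · exact hbetween b (htop b ⟨h, hbs⟩)
    · exact hP.hasStrictFit_of_ge (hB hb) hbs
  · intro k hk hkN hbk
    have hbs : b < P.bStar := by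
      have : β (2 * k - 1) ≤ β 1 :=
        hanti.antitoneOn ⟨le_rfl, hN⟩ ⟨by omega, by omega⟩ (by omega)
      linarith [hbk.2]
    have hno : ∀ a ∈ P.A, ¬ P.SelfConfirming a b := fun a ha h =>
      hgaps k hk hkN b hbk ⟨a, ha⟩ ⟨⟨(hB hb).1, hbs.le⟩, h⟩
    exact ⟨hP.not_qRobust (hB hb) hbs hW hno, fun b' _ hb' =>
      hP.exists_neverPersists (hB hb) hb' hW hno⟩
  · intro k hk hkN hbk
    exact hP.robust_of_hasStrictFit (hB hb) hW (hbetween b (hfull k hk hkN b hbk))
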